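/- **Setting.** Let $(X,A,D,Y^*)\sim P$ with $X\in\mathcal X$, protected attribute $A\in\{0,1\}$, decision $D\in\{0,1\}$ and outcome $Y^*\in[0,1]$, and let $(X_i,A_i,D_i,Y_i^*)$, $i\le n$, be i.i.d. draws from $P$; $Y_i^*$ is observed only if $D_i=1$. Assume selection on observables, $D\perp Y^*\mid X$, and positivity, $\mathbb P(D=1\mid X)>0$ almost surely. Let $\mu(x)=\mathbb E[Y^*\mid X=x]$. Let $\mathcal F$ be a class of measurable $f:\mathcal X\to[0,1]$, $\Delta(\mathcal F)$ the (countably supported) distributions on $\mathcal F$, $l:[0,1]^2\to[0,1]$ a loss that is 1-Lipschitz in the $\ell_1$-norm, and $\epsilon\ge 0$. Put $\operatorname{loss}_\mu(f)=\mathbb E[l(\mu(X),f(X))]$, and $$\operatorname{disparity}(f)=\sum_{a\in\{0,1\}}\beta_a\,\frac{\mathbb E[g(X,\mu(X))f(X)\mid\mathcal E_a]}{\mathbb E[g(X,\mu(X))\mid\mathcal E_a]},\qquad \mathcal E_a=\{A\in S_a\},\ S_a\subseteq\{0,1\},$$ with a measurable weight $g$ with values in $[0,1]$, where $\mathbb E[g(X,\mu(X))\mid\mathcal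 E_a]\ge\omega>0$ whenever $\beta_a\ne0$; both are extended linearly to $Q\in\Delta(\mathcal F)$. Call $\tilde Q\in\Delta(\mathcal F)$ feasible if $\operatorname{loss}_\mu(\tilde Q)\le\epsilon$; the problem is to minimize $|\operatorname{disparity}(Q)|$ over feasible $Q$. Let $n_a$ be the number of $i\le n$ with $A_i\in S_a$. **Discretization.** Let $\alpha=1/N$, $h_f(x,z)=1\{f(x)\ge z\}$ for $z\in[0,1]$, $\mathcal H=\{h_f:f\in\mathcal F\}$, and let $Z$ be uniform on $\{j\alpha:1\le j\le N\}$. Fix a finite subset of $[0,1]$ that is an $\frac\alpha2$-cover of the values of $\mu$, and let $\underline y$ be its smallest element within $\frac\alpha2$ of $y$. Let $c(y,z)=N\,(l(y,z+\frac\alpha2)-l(y,z-\frac\alpha2))$ (with $z+\frac\alpha2$ replaced by $1$ if it exceeds $1$), $\widehat{\operatorname{cost}}(h)=\frac1n\sum_i\mathbb E_Z[c(\underline{\mu(X_i)},Z)h(X_i,Z)]$, $\hat c_0=\frac1n\sum_i l(\underline{\mu(X_i)},\frac\alpha2)$, and let $\widehat{\operatorname{disparity}}(h)$ be the sample analogue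 of $\operatorname{disparity}$ with $\mathbb E_Z[h(X_i,Z)]$ for $f(X_i)$. **Algorithm** (input: data $(X_i,A_i,\mu(X_i))_{i\le n}$). With constraint vector $v(\xi,h)=(\widehat{\operatorname{disparity}}(h)-\xi,\,-\widehat{\operatorname{disparity}}(h)-\xi,\,\widehat{\operatorname{cost}}(h)-\hat\epsilon)$ let $L(\xi,h,\lambda)=\xi+\lambda\cdot v(\xi,h)$ for $\xi\in[0,B_\xi]$, $\lambda=(\lambda_+,\lambda_-,\lambda_{\rm cost})\ge0$, $\|\lambda\|_1\le B_\lambda$, extended linearly to distributions over $\mathcal H$. Start at $\theta_1=0\in\mathbb R^3$. In iteration $t$ put $\lambda_{t,k}=B_\lambda e^{\theta_{t,k}}/(1+\sum_{k'}e^{\theta_{t,k'}})$; let $(\xi_t,h_t)$ be an exact best response to $\lambda_t$ ($h_t$ from a best-response oracle); form the averages $\hat\xi_t,\hat\lambda_t$ and the uniform distribution $\hat Q_t$ on $h_1,\dots,h_t$. Stop if $(\hat\xi_t,\hat Q_t,\hat\lambda_t)$ is a $\nu$-approximate saddle point of $L$; then return $\hat Q_t$ if $\widehat{\operatorname{cost}}(\hat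 Q_t)\le\hat\epsilon+(B_\xi+2\nu)/B_\lambda$ and $null$ otherwise. If not stopped, $\theta_{t+1}=\theta_t+\eta\,v(\xi_t,h_t)$, with $\eta=\nu/(2\rho^2B_\lambda)$, $\rho=\sup_{f\in\mathcal F,\,\xi\in[0,B_\xi]}\|v(\xi,h_f)\|_\infty$. Here $B_\xi>0$ is a constant with $|\beta_0u+\beta_1v|\le B_\xi$ for all $u,v\in[0,1]$. **Theorem.** Suppose that, for constants $C>0$ and $0<\phi\le 1/2$, the Rademacher complexity satisfies $R_m(\mathcal H)\le Cm^{-\phi}$ for all $m\ge1$, and that $\mathcal F$ has a countable subclass such that for every cutoff $z\in[0,1]$ each $h_f(\cdot,z)$, $f\in\mathcal F$, is a pointwise limit of classifiers $h_{f'}(\cdot,z)$ with $f'$ in the subclass. Let $\hat\epsilon=\epsilon-\hat c_0+C'n^{-\phi}-C''n^{-1/2}$ with $$C'\ge 2C+2+\sqrt{2\ln(8N/\delta)},\qquad C''\ge\sqrt{-\ln(\delta/8)/2},\qquad 0<\delta<1,$$ and let $\nu=c_\nu n^{-\phi}$, $B_\lambda=c_Bn^{\phi}$, $c_Nn^{\phi}\le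 N\le c_N'n^{\phi}$ with positive constants. There are $K$, $p$ and a function $n_*(\delta,C'')$, which depend only on $\epsilon,\beta,B_\xi,C,\phi,\omega,c_\nu,c_B,c_N,c_N'$, such that the following holds, where $\tilde O(m^{-\phi})$ stands for $K(1+\ln n+\ln(1/\delta))^p\,m^{-\phi}$. (i) On every sample the algorithm terminates, in at most $K(1+C'n^{-\phi}+C''n^{-1/2})^2\,n^{4\phi}$ iterations, i.e. in $O(n^{4\phi})$ iterations. (ii) If $n\ge n_*(\delta,C'')$, or if $C'\ge C''+n^\phi/N+\sqrt{-\ln(\delta/8)/2}$, then with probability at least $1-\delta$ the returned $\hat Q_h$, viewed as a distribution over $\mathcal F$, satisfies one of the following: 1) $\hat Q_h\neq null$, $\operatorname{loss}_\mu(\hat Q_h)\le\epsilon+C'\,\tilde O(n^{-\phi})$, and, if $n_a>0$ for each $a$ with $\beta_a\neq0$, then $|\operatorname{disparity}(\hat Q_h)|\le|\operatorname{disparity}(\tilde Q)|+\tilde O(n_0^{-\phi})+\tilde O(n_1^{-\phi})$ for every feasible $\tilde Q$ (a term with $n_a=0$ is omitted); or 2) $\hat Q_h=null$ and the problem is infeasible.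 (iii) For $g=1$, $\operatorname{disparity}(Q)$ is $\beta_0\mathbb E[f(X)\mid\mathcal E_0]+\beta_1\mathbb E[f(X)\mid\mathcal E_1]$ averaged over $f\sim Q$. If $Y^*\in\{0,1\}$ almost surely and $A\perp Y^*\mid X$ (for instance, if $A$ is a function of $X$), then $g=\mu$ and $g=1-\mu$ give the same expression with conditioning events $\{Y^*=1,A\in S_a\}$ and $\{Y^*=0,A\in S_a\}$. If $l(\cdot,u)$ is convex for every $u$, then $\operatorname{loss}_\mu(Q)\le\mathbb E[l(Y^*,f(X))]$ averaged over $f\sim Q$, so that every $\tilde Q$ feasible for the true loss is feasible for $\operatorname{loss}_\mu$. -/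

import Mathlib

open MeasureTheory ProbabilityTheory

noncomputable section

namespace FairRashomon

/-! ### The population -/

/-- One draw `(X, A, D, Y*)`: features, protected attribute in `{0,1}`, binary decision
(`true` means `D = 1`, i.e. the outcome is observed), and outcome. -/
abbrev Obs (𝒳 : Type*) := 𝒳 × Fin 2 × Bool × ℝ

def featX {𝒳 : Type*} (o : Obs 𝒳) : 𝒳 := o.1
def attrA {𝒳 : Type*} (o : Obs 𝒳) : Fin 2 := o.2.1
def decD {𝒳 : Type*} (o : Obs 𝒳) : Bool := o.2.2.1
def outY {𝒳 : Type*} (o : Obs 𝒳) : ℝ := o.2.2.2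

/-- The σ-algebra generated by the features `X`. -/
abbrev sigmaX (𝒳 : Type*) [MeasurableSpace 𝒳] : MeasurableSpace (Obs 𝒳) :=
  MeasurableSpace.comap featX inferInstance

/-- `U` and `V` are conditionally independent given `X`. -/
def CondIndepGivenX {𝒳 : Type*} [MeasurableSpace 𝒳] (P : Measure (Obs 𝒳))
    {α γ : Type*} [MeasurableSpace α] [MeasurableSpace γ]
    (U : Obs 𝒳 → α) (V : Obs 𝒳 → γ) : Prop :=
  ∀ (s : Set α) (t : Set γ), MeasurableSet s → MeasurableSet t →
    P[(U ⁻¹' s ∩ V ⁻¹' t).indicator (fun _ => (1 : ℝ)) | sigmaX 𝒳] =ᵐ[P]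
      P[(U ⁻¹' s).indicator (fun _ => (1 : ℝ)) | sigmaX 𝒳] *
        P[(V ⁻¹' t).indicator (fun _ => (1 : ℝ)) | sigmaX 𝒳]

/-- Selection on observables: `D ⫫ Y* | X`. -/
def SelectionOnObservables {𝒳 : Type*} [MeasurableSpace 𝒳] (P : Measure (Obs 𝒳)) : Prop :=
  CondIndepGivenX P decD outY

/-- Positivity: `P(D = 1 | X) > 0` with probability one. -/
def Positivity {𝒳 : Type*} [MeasurableSpace 𝒳] (P : Measure (Obs 𝒳)) : Prop :=
  ∀ᵐ o ∂P, 0 < (P[(decD ⁻¹' {true}).indicator (fun _ => (1 : ℝ)) | sigmaX 𝒳]) o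

/-- `μ` is (a `[0,1]`-valued measurable version of) the regression function
`μ(x) = E[Y* | X = x]`. -/
structure IsRegression {𝒳 : Type*} [MeasurableSpace 𝒳] (P : Measure (Obs 𝒳))
    (μ : 𝒳 → ℝ) : Prop where
  measurable : Measurable μ
  mem_Icc : ∀ x, μ x ∈ Set.Icc (0 : ℝ) 1
  ae_eq : (fun o : Obs 𝒳 => μ (featX o)) =ᵐ[P] P[outY | sigmaX 𝒳]

/-! ### Loss and disparity of prediction functions and of randomized prediction functions -/

/-- `loss(f) = E[l(Y*, f(X))]`. -/
def loss {𝒳 : Type*} [MeasurableSpace 𝒳] (P : Measure (Obs 𝒳)) (l : ℝ → ℝ → ℝ)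
    (f : 𝒳 → ℝ) : ℝ :=
  ∫ o, l (outY o) (f (featX o)) ∂P

/-- `loss_μ(f) = E[l(μ(X), f(X))]`. -/
def lossMu {𝒳 : Type*} [MeasurableSpace 𝒳] (P : Measure (Obs 𝒳)) (μ : 𝒳 → ℝ)
    (l : ℝ → ℝ → ℝ) (f : 𝒳 → ℝ) : ℝ :=
  ∫ o, l (μ (featX o)) (f (featX o)) ∂P

/-- `disparity(f) = β₀ E[f(X) | E₀] + β₁ E[f(X) | E₁]` for conditioning events `E₀, E₁`. -/
def disparityOn {𝒳 : Type*} [MeasurableSpace 𝒳] (P : Measure (Obs 𝒳))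
    (E : Fin 2 → Set (Obs 𝒳)) (β : Fin 2 → ℝ) (f : 𝒳 → ℝ) : ℝ :=
  ∑ a, β a * ∫ o, f (featX o) ∂P[|E a]

/-- The predictive disparity under selective labels:
`∑ₐ βₐ E[g f(X) | Eₐ] / E[g | Eₐ]` with `g = g(X, μ(X))` and `Eₐ = {A ∈ Sₐ}`. -/
def disparity {𝒳 : Type*} [MeasurableSpace 𝒳] (P : Measure (Obs 𝒳)) (μ : 𝒳 → ℝ)
    (g : 𝒳 → ℝ → ℝ) (S : Fin 2 → Set (Fin 2)) (β : Fin 2 → ℝ) (f : 𝒳 → ℝ) : ℝ :=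
  ∑ a, β a *
    ((∫ o, g (featX o) (μ (featX o)) * f (featX o) ∂P[|attrA ⁻¹' S a]) /
      ∫ o, g (featX o) (μ (featX o)) ∂P[|attrA ⁻¹' S a])

/-- The average `∑_f Q(f) v(f)` of `v` under a distribution `Q ∈ Δ(ℱ)`. -/
def mix {ι : Type*} (Q : PMF ι) (v : ι → ℝ) : ℝ := ∑' f, (Q f).toReal * v f

/-! ### Threshold classifiers and Rademacher complexity -/

/-- `h_f(x, z) = 1{f(x) ≥ z}`. -/
def thr {𝒳 : Type*} (f : 𝒳 → ℝ) (x : 𝒳) (z : ℝ) : ℝ :=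
  open Classical in if z ≤ f x then 1 else 0

/-- `ℋ = {h_f : f ∈ ℱ}`, as functions on `𝒳 × [0,1]`. -/
def thrClass {𝒳 : Type*} (ℱ : Set (𝒳 → ℝ)) : Set (𝒳 × Set.Icc (0 : ℝ) 1 → ℝ) :=
  (fun f u => thr f u.1 u.2) '' ℱ

/-- `R_n(𝒢) = sup_{u₁,…,uₙ} E_σ sup_{g ∈ 𝒢} |n⁻¹ ∑ᵢ σᵢ g(uᵢ)|`, with independent uniform
signs `σᵢ`. -/
def rademacher {U : Type*} (𝒢 : Set (U → ℝ)) (n : ℕ) : ℝ :=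
  ⨆ u : Fin n → U, (1 / (2 : ℝ) ^ n) * ∑ σ : Fin n → Bool,
    ⨆ g : 𝒢, |(1 / (n : ℝ)) * ∑ i, (if σ i then (1 : ℝ) else -1) * (g : U → ℝ) (u i)|

/-- Measurability condition for suprema over `ℱ`: at every cutoff the threshold classifiers
are pointwise limits of those from one countable subclass (trivial for countable `ℱ`). -/
def PointwiseMeasurable {𝒳 : Type*} (ℱ : Set (𝒳 → ℝ)) : Prop :=
  ∃ 𝒢 ⊆ ℱ, 𝒢.Countable ∧ ∀ f ∈ ℱ, ∀ z ∈ Set.Icc (0 : ℝ) 1,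
    ∃ G : ℕ → 𝒳 → ℝ, (∀ k, G k ∈ 𝒢) ∧
      ∀ x, ∀ᶠ k in Filter.atTop, (z ≤ G k x ↔ z ≤ f x)

/-! ### Discretization and empirical quantities -/

/-- The smallest element of the cover within distance `1/(2N)` of `y`. -/
def lowerY (N : ℕ) (cover : Finset ℝ) (y : ℝ) : ℝ :=
  sInf {t : ℝ | t ∈ cover ∧ |y - t| ≤ 1 / (2 * (N : ℝ))}

/-- `c(y, z) = N (l(y, z + α/2) - l(y, z - α/2))` with `α = 1/N`. The prediction argument
`z + α/2` exceeds `1` for the last grid point only; it is then read as `1`. -/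
def costWeight (l : ℝ → ℝ → ℝ) (N : ℕ) (y z : ℝ) : ℝ :=
  (N : ℝ) * (l y (min (z + 1 / (2 * (N : ℝ))) 1) - l y (z - 1 / (2 * (N : ℝ))))

/-- Empirical version of the constant `c₀ = E[l(y̲, α/2)]`, for data `(Xᵢ, Aᵢ, yᵢ)`. -/
def c0Hat {𝒳 : Type*} {n : ℕ} (l : ℝ → ℝ → ℝ) (N : ℕ) (cover : Finset ℝ)
    (data : Fin n → 𝒳 × Fin 2 × ℝ) : ℝ :=
  (1 / (n : ℝ)) * ∑ i, l (lowerY N cover (data i).2.2) (1 / (2 * (N : ℝ)))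

/-- The input of the algorithm (apart from the learning rate). -/
structure AlgInput (𝒳 : Type*) (n : ℕ) where
  /-- the training data `(Xᵢ, Aᵢ, yᵢ)` -/
  data : Fin n → 𝒳 × Fin 2 × ℝ
  /-- parameters and group events of the disparity -/
  β : Fin 2 → ℝ
  S : Fin 2 → Set (Fin 2)
  /-- weight function `g` of the disparity -/
  g : 𝒳 → ℝ → ℝ
  /-- loss function -/
  l : ℝ → ℝ → ℝ
  /-- grid size and cover of the outcomes -/
  N : ℕ
  cover : Finset ℝ
  /-- empirical loss tolerance -/
  epsHat : ℝ
  /-- bounds for the multipliers and the slack variable, and the accuracy -/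
  Blam : ℝ
  Bxi : ℝ
  nu : ℝ

namespace AlgInput

variable {𝒳 : Type*} {n : ℕ}

/-- `E_{Z_α}[h_f(x, Z_α)]`, with `Z_α` uniform on the grid `{j/N : j = 1, …, N}`. -/
def gridThr (I : AlgInput 𝒳 n) (f : 𝒳 → ℝ) (x : 𝒳) : ℝ :=
  (1 / (I.N : ℝ)) * ∑ j ∈ Finset.Icc 1 I.N, thr f x ((j : ℝ) / I.N)

/-- `g(Xᵢ, yᵢ) 1{Aᵢ ∈ Sₐ}`. -/
def groupWeight (I : AlgInput 𝒳 n) (a : Fin 2) (i : Fin n) : ℝ :=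
  (I.S a).indicator (fun _ => I.g (I.data i).1 (I.data i).2.2) (I.data i).2.1

/-- Empirical disparity of the threshold classifier `h_f`. -/
def dispHat (I : AlgInput 𝒳 n) (f : 𝒳 → ℝ) : ℝ :=
  ∑ a, I.β a *
    ((∑ i, I.groupWeight a i * I.gridThr f (I.data i).1) / ∑ i, I.groupWeight a i)

/-- Empirical cost `Ê[E_{Z_α}[c(y̲ᵢ, Z_α) h_f(Xᵢ, Z_α)]]` of the threshold classifier `h_f`. -/
def costHat (I : AlgInput 𝒳 n) (f : 𝒳 → ℝ) : ℝ :=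
  (1 / (n : ℝ)) * ∑ i, (1 / (I.N : ℝ)) * ∑ j ∈ Finset.Icc 1 I.N,
    costWeight I.l I.N (lowerY I.N I.cover (I.data i).2.2) ((j : ℝ) / I.N) *
      thr f (I.data i).1 ((j : ℝ) / I.N)

/-- The constraint values `(d - ξ, -d - ξ, c - ε̂)` at slack `ξ`, empirical disparity `d` and
empirical cost `c`; the coordinates `0, 1, 2` stand for `+`, `-`, `cost`. -/
def viol (I : AlgInput 𝒳 n) (ξ d c : ℝ) : Fin 3 → ℝ := ![d - ξ, -d - ξ, c - I.epsHat]

/-- The Lagrangian, as a function of slack, empirical disparity, empirical cost, multipliers. -/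
def lagrangian (I : AlgInput 𝒳 n) (ξ d c : ℝ) (lam : Fin 3 → ℝ) : ℝ :=
  ξ + ∑ k, lam k * I.viol ξ d c k

/-- `ρ`: the largest absolute constraint value over `h ∈ ℋ`, `ξ ∈ [0, B_ξ]`. -/
def rho (I : AlgInput 𝒳 n) (ℱ : Set (𝒳 → ℝ)) : ℝ :=
  ⨆ p : ℱ × Set.Icc (0 : ℝ) I.Bxi × Fin 3,
    |I.viol p.2.1 (I.dispHat p.1) (I.costHat p.1) p.2.2|

/-- The learning rate `η = ν / (2 ρ² B_λ)`. -/
def learningRate (I : AlgInput 𝒳 n) (ℱ : Set (𝒳 → ℝ)) : ℝ :=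
  I.nu / (2 * I.rho ℱ ^ 2 * I.Blam)

/-! ### The exponentiated gradient algorithm -/

/-- `best` is a best-response oracle of the `h`-player: for every vector of multipliers it
returns an `f ∈ ℱ` minimizing `(λ₊ - λ₋) disp^(h_f) + λ_cost (cost^(h_f) - ε̂)`. -/
def IsBestH (I : AlgInput 𝒳 n) (ℱ : Set (𝒳 → ℝ)) (best : (Fin 3 → ℝ) → ℱ) : Prop :=
  ∀ lam : Fin 3 → ℝ, (∀ k, 0 ≤ lam k) → ∑ k, lam k ≤ I.Blam → ∀ f : ℱ,
    (lam 0 - lam 1) * I.dispHat (best lam) + lam 2 * (I.costHat (best lam) - I.epsHat) ≤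
      (lam 0 - lam 1) * I.dispHat f + lam 2 * (I.costHat f - I.epsHat)

/-- Best response of the slack variable. -/
def bestXi (I : AlgInput 𝒳 n) (lam : Fin 3 → ℝ) : ℝ :=
  open Classical in if 1 - lam 0 - lam 1 < 0 then I.Bxi else 0

/-- Best response of the multiplier player to constraint values `v`: all zero if no constraint
is violated, otherwise `B_λ` on a maximally violated constraint. -/
def bestLam (I : AlgInput 𝒳 n) (v : Fin 3 → ℝ) : Fin 3 → ℝ :=
  open Classical in
  if ∀ k, v k ≤ 0 then 0
  else if v 1 ≤ v 0 ∧ v 2 ≤ v 0 then ![I.Blam, 0, 0]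
  else if v 2 ≤ v 1 then ![0, I.Blam, 0]
  else ![0, 0, I.Blam]

/-- `λ_k = B_λ exp(θ_k) / (1 + ∑_{k'} exp(θ_{k'}))`. -/
def weights (I : AlgInput 𝒳 n) (θ : Fin 3 → ℝ) : Fin 3 → ℝ :=
  fun k => I.Blam * Real.exp (θ k) / (1 + ∑ k', Real.exp (θ k'))

variable {ℱ : Set (𝒳 → ℝ)}

/-- The parameter `θ` used in iteration `t + 1`. -/
def theta (I : AlgInput 𝒳 n) (η : ℝ) (best : (Fin 3 → ℝ) → ℱ) : ℕ → Fin 3 → ℝ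
  | 0 => 0
  | t + 1 =>
    let lam := I.weights (I.theta η best t)
    I.theta η best t +
      η • I.viol (I.bestXi lam) (I.dispHat (best lam)) (I.costHat (best lam))

/-- The multipliers of iteration `t + 1`. -/
def lamAt (I : AlgInput 𝒳 n) (η : ℝ) (best : (Fin 3 → ℝ) → ℱ) (t : ℕ) : Fin 3 → ℝ :=
  I.weights (I.theta η best t)

/-- The uniform distribution on the predictors `f_1, …, f_{t+1}` of the first `t + 1`
iterations: `Q̂` after iteration `t + 1`, viewed as a distribution over `ℱ`. -/
def QHat (I : AlgInput 𝒳 n) (η : ℝ) (best : (Fin 3 → ℝ) → ℱ) (t : ℕ) : PMF ℱ :=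
  (PMF.uniformOfFintype (Fin (t + 1))).map fun s => best (I.lamAt η best s)

/-- The average slack after iteration `t + 1`. -/
def xiHat (I : AlgInput 𝒳 n) (η : ℝ) (best : (Fin 3 → ℝ) → ℱ) (t : ℕ) : ℝ :=
  (1 / ((t : ℝ) + 1)) * ∑ s ∈ Finset.range (t + 1), I.bestXi (I.lamAt η best s)

/-- The average multipliers after iteration `t + 1`. -/
def lamHat (I : AlgInput 𝒳 n) (η : ℝ) (best : (Fin 3 → ℝ) → ℱ) (t : ℕ) : Fin 3 → ℝ :=
  (1 / ((t : ℝ) + 1)) • ∑ s ∈ Finset.range (t + 1), I.lamAt η best s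

/-- `disp^(Q)` and `cost^(Q)` for `Q ∈ Δ(ℱ)`. -/
def dispHatQ (I : AlgInput 𝒳 n) (Q : PMF ℱ) : ℝ := mix Q fun f => I.dispHat f
def costHatQ (I : AlgInput 𝒳 n) (Q : PMF ℱ) : ℝ := mix Q fun f => I.costHat f

/-- `ν_{t+1}`: the duality gap after iteration `t + 1`. -/
def gap (I : AlgInput 𝒳 n) (η : ℝ) (best : (Fin 3 → ℝ) → ℱ) (t : ℕ) : ℝ :=
  let ξ := I.xiHat η best t
  let d := I.dispHatQ (I.QHat η best t)
  let c := I.costHatQ (I.QHat η best t)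
  let lam := I.lamHat η best t
  let L := I.lagrangian ξ d c lam
  let Lupper := I.lagrangian ξ d c (I.bestLam (I.viol ξ d c))
  let Llower := I.lagrangian (I.bestXi lam) (I.dispHat (best lam)) (I.costHat (best lam)) lam
  max (L - Llower) (Lupper - L)

/-- The algorithm stops after exactly `t + 1` iterations. -/
def StopsAt (I : AlgInput 𝒳 n) (η : ℝ) (best : (Fin 3 → ℝ) → ℱ) (t : ℕ) : Prop :=
  I.gap η best t ≤ I.nu ∧ ∀ s < t, I.nu < I.gap η best s

/-- The value returned when the algorithm stops after iteration `t + 1`; `none` is `null`. -/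
def output (I : AlgInput 𝒳 n) (η : ℝ) (best : (Fin 3 → ℝ) → ℱ) (t : ℕ) : Option (PMF ℱ) :=
  open Classical in
  if I.costHatQ (I.QHat η best t) ≤ I.epsHat + (I.Bxi + 2 * I.nu) / I.Blam
  then some (I.QHat η best t) else none

end AlgInput

/-- The modified training data `(Xᵢ, Aᵢ, μ(Xᵢ))`. -/
def modifiedData {𝒳 : Type*} {n : ℕ} (μ : 𝒳 → ℝ) (s : Fin n → Obs 𝒳) :
    Fin n → 𝒳 × Fin 2 × ℝ :=
  fun i => (featX (s i), attrA (s i), μ (featX (s i)))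

/-- The number of observations with `Aᵢ ∈ T`. -/
def groupCount {𝒳 : Type*} {n : ℕ} (T : Set (Fin 2)) (s : Fin n → Obs 𝒳) : ℕ :=
  Set.ncard {i | attrA (s i) ∈ T}

/-- The input of the algorithm on the modified training data, with empirical tolerance
`ε̂ = ε - ĉ₀ + C' n^{-φ} - C'' n^{-1/2}`, `ν = c_ν n^{-φ}` and `B_λ = c_B n^φ`. -/
def selectiveInput {𝒳 : Type*} {n : ℕ} (μ : 𝒳 → ℝ) (β : Fin 2 → ℝ)
    (S : Fin 2 → Set (Fin 2)) (g : 𝒳 → ℝ → ℝ) (l : ℝ → ℝ → ℝ) (ε Bxi φ cν cB : ℝ)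
    (C' C'' : ℝ) (N : ℕ) (cover : Finset ℝ) (s : Fin n → Obs 𝒳) : AlgInput 𝒳 n where
  data := modifiedData μ s
  β := β
  S := S
  g := g
  l := l
  N := N
  cover := cover
  epsHat := ε - c0Hat l N cover (modifiedData μ s) + C' * (n : ℝ) ^ (-φ)
    - C'' * (n : ℝ) ^ (-(1 / 2) : ℝ)
  Blam := cB * (n : ℝ) ^ φ
  Bxi := Bxi
  nu := cν * (n : ℝ) ^ (-φ)

/-- The factor hidden in `Õ(·)`: a constant times a power of `1 + ln n + ln(1/δ)`. -/
def polylog (K : ℝ) (p n : ℕ) (δ : ℝ) : ℝ := K * (1 + Real.log n + Real.log (1 / δ)) ^ p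

end FairRashomon

end

set_option linter.unusedSectionVars false

namespace FairRashomon

section

/-! ### Averages over random signs -/

/-! The argument has an optimization half, valid on every sample, and a statistical half, valid on
an event that does not depend on the oracle.

Optimization. The multiplier updates are exponential weights over four actions: the three
constraints and an idle action of payoff 0. A log-partition potential controls their regret
(`exponentiated_gradient_regret`). Since the other player best-responds in every round, average
regret bounds the duality gap (`AlgInput.gap_le`), which forces termination. Testing an approximate
saddle point against zero multipliers and against full weight on one constraint shows that it passes
the cost test, and is nearly as fair as `Q`, whenever `Q` satisfies the empirical cost constraint
(`AlgInput.saddle_guarantee`).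

Statistics. Up to one grid step, `f(x)` is the mean of its threshold classifiers over the grid, and
`l(y, f(x))` is a constant plus a weighted mean of the same classifiers. So it suffices to control
weighted sample means of the classifiers, uniformly in `f`, at each grid cutoff. Symmetrization with
bounded differences in the signs gives an exponential bound (`exp_uniform_deviation_le`); bounded
weights are absorbed by contraction (`signMean_mul_le`), and the countable subclass carries the
bound to all of `ℱ` (`measure_thr_deviation`). Given which indices fall into a group, the group
members are i.i.d. from the conditional law, so the same bound holds at the random group size
(`measure_hits_le`).

Combination. One nearly optimal feasible `Qs` is fixed before sampling. For it Hoeffding's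
inequality suffices, with error of order `n^(-1/2)` and no complexity term
(`measure_empirical_loss_ge_le`). The offset in the empirical tolerance covers this error and the
discretization error `1/N`, so `Qs` is empirically feasible: a null output certifies infeasibility,
and otherwise the comparison with `Qs` transfers to the population (`output_of_good_sample`). The
offset is large enough when `n` is large because `C'` exceeds a multiple of `√(log (N/δ))`.

The identities for the weights `μ` and `1 - μ` come from pulling functions of `X` out of conditional
expectations together with conditional independence; the comparison of the two losses is conditional
Jensen. -/

theorem exp_average_two_le (t a b : ℝ) (h : |a - b| ≤ 2) :
    (Real.exp (t * a) + Real.exp (t * b)) / 2 ≤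
      Real.exp (t ^ 2 / 2) * Real.exp (t * ((a + b) / 2)) := by
  -- Factoring out the midpoint leaves `cosh` of `t` times half the difference, which is at most 1
  -- in absolute value.
  have h1 : (Real.exp (t * a) + Real.exp (t * b)) / 2 =
      Real.cosh (t * ((a - b) / 2)) * Real.exp (t * ((a + b) / 2)) := by
    rw [Real.cosh_eq, div_mul_eq_mul_div, add_mul, ← Real.exp_add, ← Real.exp_add]
    congr 3 <;> ring
  rw [h1]
  refine mul_le_mul_of_nonneg_right ((Real.cosh_le_exp_half_sq _).trans ?_) (Real.exp_pos _).le
  refine Real.exp_le_exp.2 ?_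
  have h2 : ((a - b) / 2) ^ 2 ≤ 1 := by
    rw [sq_le_one_iff_abs_le_one, abs_div, abs_two]; linarith
  rw [mul_pow]
  nlinarith [sq_nonneg t]

/-- Exponential moments of a function of `n` random signs with bounded differences. -/
theorem exp_signs_fin (t : ℝ) : ∀ (n : ℕ) (F : (Fin n → Bool) → ℝ),
    (∀ σ i b, |F σ - F (Function.update σ i b)| ≤ 2) →
    (1 / (2 : ℝ) ^ n) * ∑ σ, Real.exp (t * F σ) ≤
      Real.exp (t * ((1 / (2 : ℝ) ^ n) * ∑ σ, F σ) + n * (t ^ 2 / 2)) := by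
  intro n
  induction n with
  | zero => intro F _; simp
  | succ n ih =>
    intro F hF
    have hsplit : ∀ G : (Fin (n + 1) → Bool) → ℝ, ∑ σ, G σ =
        ∑ σ : Fin n → Bool, (G (Fin.cons true σ) + G (Fin.cons false σ)) := by
      intro G
      rw [← (Fin.consEquiv fun _ => Bool).sum_comp, Fintype.sum_prod_type]
      simp [Finset.sum_add_distrib, Fin.consEquiv]
    -- Averaging out the first sign preserves the bounded differences and costs one factor `exp (t²
    -- / 2)`.
    set M : (Fin n → Bool) → ℝ := fun σ => (F (Fin.cons true σ) + F (Fin.cons false σ)) / 2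
    have hM : ∀ σ i b, |M σ - M (Function.update σ i b)| ≤ 2 := by
      intro σ i b
      have h1 := hF (Fin.cons true σ) i.succ b
      have h2 := hF (Fin.cons false σ) i.succ b
      rw [← Fin.cons_update] at h1 h2
      simp only [M]
      rw [abs_le] at *
      constructor <;> linarith [h1.1, h1.2, h2.1, h2.2]
    have hstep : ∀ σ : Fin n → Bool,
        Real.exp (t * F (Fin.cons true σ)) + Real.exp (t * F (Fin.cons false σ)) ≤
          2 * (Real.exp (t ^ 2 / 2) * Real.exp (t * M σ)) := by
      intro σ
      have := exp_average_two_le t (F (Fin.cons true σ)) (F (Fin.cons false σ)) (by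
        have := hF (Fin.cons true σ) 0 false
        rwa [Fin.update_cons_zero] at this)
      simp only [M]; linarith
    have hsum : ∑ σ, F σ = 2 * ∑ σ, M σ := by
      rw [hsplit, Finset.mul_sum]
      exact Finset.sum_congr rfl fun σ _ => by simp only [M]; ring
    rw [hsum, hsplit]
    calc (1 / (2 : ℝ) ^ (n + 1)) * ∑ σ : Fin n → Bool,
          (Real.exp (t * F (Fin.cons true σ)) + Real.exp (t * F (Fin.cons false σ)))
        ≤ (1 / (2 : ℝ) ^ (n + 1)) * ∑ σ : Fin n → Bool,
          2 * (Real.exp (t ^ 2 / 2) * Real.exp (t * M σ)) := by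
          gcongr with σ; exact hstep σ
      _ = Real.exp (t ^ 2 / 2) * ((1 / (2 : ℝ) ^ n) * ∑ σ, Real.exp (t * M σ)) := by
          rw [← Finset.mul_sum, ← Finset.mul_sum, pow_succ]; field_simp
      _ ≤ Real.exp (t ^ 2 / 2) *
          Real.exp (t * ((1 / (2 : ℝ) ^ n) * ∑ σ, M σ) + n * (t ^ 2 / 2)) := by
          gcongr; exact ih M hM
      _ = _ := by
          rw [← Real.exp_add, pow_succ]; congr 1; push_cast; field_simp; ring

variable {ι κ : Type*} [Fintype ι]

/-- `sup_k |∑ᵢ σᵢ x_k(i)|`. -/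
noncomputable def signSup (x : κ → ι → ℝ) (σ : ι → Bool) : ℝ :=
  ⨆ k, |∑ i, (if σ i then (1 : ℝ) else -1) * x k i|

/-- `E_σ sup_k |∑ᵢ σᵢ x_k(i)|` for independent uniform signs. -/
noncomputable def signMean [DecidableEq ι] (x : κ → ι → ℝ) : ℝ :=
  (1 / (2 : ℝ) ^ Fintype.card ι) * ∑ σ : ι → Bool, signSup x σ

theorem le_signSup [Finite κ] (x : κ → ι → ℝ) (σ : ι → Bool) (k : κ) :
    |∑ i, (if σ i then (1 : ℝ) else -1) * x k i| ≤ signSup x σ :=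
  le_ciSup (f := fun k => |∑ i, (if σ i then (1 : ℝ) else -1) * x k i|)
    (Set.finite_range _).bddAbove k

variable [DecidableEq ι]

/-- Only the `j`-th summand changes, by at most 2. This is the bounded difference required by
`exp_signs_fin`. -/
theorem signSup_update_le [Finite κ] [Nonempty κ] (x : κ → ι → ℝ) (hx : ∀ k i, |x k i| ≤ 1)
    (σ : ι → Bool) (j : ι) (b : Bool) :
    signSup x σ ≤ signSup x (Function.update σ j b) + 2 := by
  refine ciSup_le fun k => ?_
  have h1 := le_signSup x (Function.update σ j b) k
  have h2 : |∑ i, (if σ i then (1 : ℝ) else -1) * x k i -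
      ∑ i, (if Function.update σ j b i then (1 : ℝ) else -1) * x k i| ≤ 2 := by
    rw [← Finset.sum_sub_distrib, Finset.sum_eq_single j]
    · rw [← sub_mul, abs_mul]
      calc _ ≤ (2 : ℝ) * 1 := by
            gcongr
            · split_ifs <;> norm_num
            · exact hx k j
        _ = 2 := by norm_num
    · intro i _ hi; simp [Function.update_of_ne hi]
    · simp
  have h3 := abs_sub_abs_le_abs_sub (∑ i, (if σ i then (1 : ℝ) else -1) * x k i)
    (∑ i, (if Function.update σ j b i then (1 : ℝ) else -1) * x k i)
  linarith

theorem exp_signSup_le [Finite κ] [Nonempty κ] (t : ℝ) (x : κ → ι → ℝ)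
    (hx : ∀ k i, |x k i| ≤ 1) :
    (1 / (2 : ℝ) ^ Fintype.card ι) * ∑ σ : ι → Bool, Real.exp (t * signSup x σ) ≤
      Real.exp (t * signMean x + Fintype.card ι * (t ^ 2 / 2)) := by
  set e := Fintype.equivFin ι
  set E : (Fin (Fintype.card ι) → Bool) ≃ (ι → Bool) := e.symm.arrowCongr (Equiv.refl Bool)
  have h := exp_signs_fin t (Fintype.card ι) (fun σ => signSup x (E σ)) (by
    intro σ i b
    have hE : E (Function.update σ i b) = Function.update (E σ) (e.symm i) b := by
      funext j
      by_cases hj : j = e.symm i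
      · subst hj; simp [E, Equiv.arrowCongr]
      · have hj' : e j ≠ i := fun h => hj (by simp [← h])
        simp [E, Equiv.arrowCongr, hj, hj']
    rw [hE, abs_le]
    have h1 := signSup_update_le x hx (E σ) (e.symm i) b
    have h2 := signSup_update_le x hx (Function.update (E σ) (e.symm i) b) (e.symm i)
      (E σ (e.symm i))
    rw [Function.update_idem, Function.update_eq_self] at h2
    constructor <;> linarith)
  rw [E.sum_comp (fun σ => Real.exp (t * signSup x σ)), E.sum_comp (fun σ => signSup x σ)] at h
  exact h

/-- Multiplication by weights in `[-1,1]` does not increase the average over signs. -/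
theorem signMean_mul_le [Finite κ] [Nonempty κ] (w : ι → ℝ) (hw : ∀ i, |w i| ≤ 1)
    (x : κ → ι → ℝ) : signMean (fun k i => w i * x k i) ≤ signMean x := by
  -- Convexity in the weights puts the maximum over the cube at a vertex, that is, at weights `±1`.
  have hconv : ConvexOn ℝ Set.univ fun w : ι → ℝ => signMean (fun k i => w i * x k i) := by
    refine ⟨convex_univ, fun w _ v _ a b ha hb _ => ?_⟩
    simp only [signMean, smul_eq_mul]
    rw [mul_left_comm a, mul_left_comm b, ← mul_add, Finset.mul_sum _ _ a, Finset.mul_sum _ _ b,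
      ← Finset.sum_add_distrib]
    gcongr with σ
    refine ciSup_le fun k => ?_
    have h1 := le_signSup (fun k i => w i * x k i) σ k
    have h2 := le_signSup (fun k i => v i * x k i) σ k
    have h3 : ∑ i, (if σ i then (1 : ℝ) else -1) * ((a • w + b • v) i * x k i) =
        a * ∑ i, (if σ i then (1 : ℝ) else -1) * (w i * x k i) +
        b * ∑ i, (if σ i then (1 : ℝ) else -1) * (v i * x k i) := by
      rw [Finset.mul_sum, Finset.mul_sum, ← Finset.sum_add_distrib]
      refine Finset.sum_congr rfl fun i _ => ?_
      simp only [Pi.add_apply, Pi.smul_apply, smul_eq_mul]; ring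
    rw [h3]
    refine (abs_add_le _ _).trans ?_
    rw [abs_mul, abs_mul, abs_of_nonneg ha, abs_of_nonneg hb]
    gcongr
  have hmem : w ∈ convexHull ℝ (Set.univ.pi fun _ : ι => ({-1, 1} : Set ℝ)) := by
    refine mem_convexHull_pi fun i _ => ?_
    rw [convexHull_pair, segment_eq_Icc (by norm_num)]
    exact abs_le.1 (hw i)
  obtain ⟨v, hv, hle⟩ := hconv.exists_ge_of_mem_convexHull (Set.subset_univ _) hmem
  refine hle.trans (le_of_eq ?_)
  simp only [signMean]
  congr 1
  have hv' : ∀ i, v i = -1 ∨ v i = 1 := fun i => by simpa using hv i trivial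
  -- At a vertex the weights only flip some of the random signs, which permutes the sign vectors.
  let E : (ι → Bool) ≃ (ι → Bool) :=
    Equiv.piCongrRight fun i => if v i = 1 then Equiv.refl Bool else Equiv.boolNot
  rw [← E.sum_comp]
  refine Finset.sum_congr rfl fun σ _ => ?_
  simp only [signSup]
  congr 1; funext k; congr 1
  refine Finset.sum_congr rfl fun i _ => ?_
  rcases hv' i with h | h
  · have h' : v i ≠ 1 := by rw [h]; norm_num
    simp only [E, Equiv.piCongrRight_apply, Pi.map_apply, if_neg h']
    cases σ i <;> simp [h]
  · simp [E, h]

/-! ### Comparison with the Rademacher complexity -/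

theorem abs_thr_le {𝒳 : Type*} (f : 𝒳 → ℝ) (x : 𝒳) (z : ℝ) : |thr f x z| ≤ 1 := by
  unfold thr; split_ifs <;> simp

theorem thr_nonneg {𝒳 : Type*} (f : 𝒳 → ℝ) (x : 𝒳) (z : ℝ) : 0 ≤ thr f x z := by
  unfold thr; split_ifs <;> simp

theorem abs_sign_average_le {n : ℕ} (σ : Fin n → Bool) (y : Fin n → ℝ) (hy : ∀ i, |y i| ≤ 1) :
    |(1 / (n : ℝ)) * ∑ i, (if σ i then (1 : ℝ) else -1) * y i| ≤ 1 := by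
  rw [abs_mul, abs_of_nonneg (by positivity)]
  have : |∑ i, (if σ i then (1 : ℝ) else -1) * y i| ≤ n := by
    refine (Finset.abs_sum_le_sum_abs _ _).trans ?_
    calc _ ≤ ∑ i : Fin n, (1 : ℝ) := by
          gcongr with i
          rw [abs_mul]
          split_ifs <;> simpa using hy i
      _ = n := by simp
  calc _ ≤ (1 / (n : ℝ)) * n := by gcongr
    _ ≤ 1 := by rw [one_div]; exact inv_mul_le_one

/-- The complexity takes a supremum over all point sequences in `𝒳 × [0,1]`, in particular over
those sharing one cutoff. The factor `card ι` appears because `signMean` is not normalized. -/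
theorem signMean_thr_le {𝒳 : Type*} (ℱ : Set (𝒳 → ℝ)) [Finite κ] [Nonempty κ] (G : κ → 𝒳 → ℝ)
    (hG : ∀ k, G k ∈ ℱ) (z : ℝ) (hz : z ∈ Set.Icc (0 : ℝ) 1) (u : ι → 𝒳) :
    signMean (fun k i => thr (G k) (u i) z) ≤
      Fintype.card ι * rademacher (thrClass ℱ) (Fintype.card ι) := by
  rcases isEmpty_or_nonempty ι with hι | hι
  · simp [signMean, signSup]
  set m := Fintype.card ι with hm
  have hm0 : (0 : ℝ) < m := by exact_mod_cast Fintype.card_pos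
  set e := Fintype.equivFin ι
  set E : (Fin m → Bool) ≃ (ι → Bool) := e.symm.arrowCongr (Equiv.refl Bool)
  set U : Fin m → 𝒳 × Set.Icc (0 : ℝ) 1 := fun i => (u (e.symm i), ⟨z, hz⟩)
  -- Boundedness must be supplied for both suprema, since an unbounded real supremum defaults to 0.
  have hbd1 : ∀ g : thrClass ℱ, ∀ p, |(g : 𝒳 × Set.Icc (0 : ℝ) 1 → ℝ) p| ≤ 1 := by
    rintro ⟨_, f, _, rfl⟩ p; exact abs_thr_le _ _ _
  have hbd : ∀ (V : Fin m → 𝒳 × Set.Icc (0 : ℝ) 1) (σ : Fin m → Bool), BddAbove (Set.range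
      fun g : thrClass ℱ => |(1 / (m : ℝ)) * ∑ i, (if σ i then (1 : ℝ) else -1) *
        (g : 𝒳 × Set.Icc (0 : ℝ) 1 → ℝ) (V i)|) := by
    intro V σ
    refine ⟨1, ?_⟩
    rintro _ ⟨g, rfl⟩
    exact abs_sign_average_le _ _ fun i => hbd1 g _
  have hrad : (1 / (2 : ℝ) ^ m) * ∑ σ : Fin m → Bool,
      ⨆ g : thrClass ℱ, |(1 / (m : ℝ)) * ∑ i, (if σ i then (1 : ℝ) else -1) *
        (g : 𝒳 × Set.Icc (0 : ℝ) 1 → ℝ) (U i)| ≤ rademacher (thrClass ℱ) m := by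
    unfold rademacher
    refine le_ciSup (f := fun U : Fin m → 𝒳 × Set.Icc (0 : ℝ) 1 =>
      (1 / (2 : ℝ) ^ m) * ∑ σ : Fin m → Bool,
      ⨆ g : thrClass ℱ, |(1 / (m : ℝ)) * ∑ i, (if σ i then (1 : ℝ) else -1) *
        (g : 𝒳 × Set.Icc (0 : ℝ) 1 → ℝ) (U i)|) ⟨1, ?_⟩ U
    rintro _ ⟨V, rfl⟩
    calc _ ≤ (1 / (2 : ℝ) ^ m) * ∑ σ : Fin m → Bool, (1 : ℝ) := by
          refine mul_le_mul_of_nonneg_left (Finset.sum_le_sum fun σ _ => ?_) (by positivity)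
          exact Real.iSup_le (fun g => abs_sign_average_le _ _ fun i => hbd1 g _) zero_le_one
      _ ≤ 1 := by simp
  refine le_trans ?_ (mul_le_mul_of_nonneg_left hrad hm0.le)
  rw [signMean, ← hm, mul_left_comm (m : ℝ), ← E.sum_comp, Finset.mul_sum _ _ (m : ℝ)]
  refine mul_le_mul_of_nonneg_left (Finset.sum_le_sum fun σ _ => ?_) (by positivity)
  refine ciSup_le fun k => ?_
  have := le_ciSup (hbd U σ) ⟨fun p => thr (G k) p.1 p.2, G k, hG k, rfl⟩
  have h2 := mul_le_mul_of_nonneg_left this hm0.le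
  refine le_trans (le_of_eq ?_) h2
  rw [abs_mul, abs_of_nonneg (by positivity : (0 : ℝ) ≤ 1 / m), ← mul_assoc,
    mul_one_div_cancel hm0.ne', one_mul, ← e.sum_comp]
  simp [U, E, Equiv.arrowCongr]

end

section

/-! ### Symmetrization -/

variable {ι κ Ω : Type*} [Fintype ι] [DecidableEq ι] [MeasurableSpace Ω]

/-- Symmetrization and concentration: the exponential moment of a uniform deviation. -/
theorem exp_uniform_deviation_le [Finite κ] [Nonempty κ] (ν : Measure Ω) [IsProbabilityMeasure ν]
    (h : κ → Ω → ℝ) (hm : ∀ k, Measurable (h k)) (hb : ∀ k x, |h k x| ≤ 1) (R t : ℝ) (ht : 0 ≤ t)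
    (hR : ∀ u : ι → Ω, signMean (fun k i => h k (u i)) ≤ R) :
    ∫ s : ι → Ω, Real.exp (t * ⨆ k, |∑ i, h k (s i) - Fintype.card ι * ∫ x, h k x ∂ν|)
      ∂(Measure.pi fun _ => ν) ≤
      Real.exp (2 * t * R + 2 * Fintype.card ι * t ^ 2) := by
  have := Fintype.ofFinite κ
  set m : ℝ := (Fintype.card ι : ℝ) with hmdef
  set Pi1 : Measure (ι → Ω) := Measure.pi fun _ => ν with hPi1
  set D : κ → (ι → Ω × Ω) → ℝ := fun k p => ∑ i, (h k (p i).1 - h k (p i).2) with hD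
  set Φ : (ι → Ω × Ω) → ℝ := fun p => Real.exp (t * ⨆ k, |D k p|) with hΦ
  have hint : ∀ k, Integrable (h k) ν := fun k =>
    Integrable.of_bound (hm k).aestronglyMeasurable 1 (ae_of_all _ fun x => hb k x)
  have hDm : ∀ k, Measurable (D k) := fun k => by
    simp only [hD]
    refine Finset.measurable_fun_sum _ fun i _ => ?_
    exact ((hm k).comp (measurable_fst.comp (measurable_pi_apply i))).sub
      ((hm k).comp (measurable_snd.comp (measurable_pi_apply i)))
  have hDb : ∀ k p, |D k p| ≤ 2 * m := fun k p => by
    refine (Finset.abs_sum_le_sum_abs _ _).trans ?_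
    calc _ ≤ ∑ i : ι, (2 : ℝ) := by
          refine Finset.sum_le_sum fun i _ => ?_
          have h1 := abs_le.1 (hb k (p i).1); have h2 := abs_le.1 (hb k (p i).2)
          rw [abs_le]; constructor <;> linarith [h1.1, h1.2, h2.1, h2.2]
      _ = 2 * m := by simp [hmdef, mul_comm]
  have hΦm : Measurable Φ := by
    refine Real.measurable_exp.comp (Measurable.const_mul ?_ t)
    exact Measurable.iSup fun k => (hDm k).abs
  have hΦb : ∀ p, ‖Φ p‖ ≤ Real.exp (t * (2 * m)) := fun p => by
    rw [Real.norm_of_nonneg (Real.exp_pos _).le]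
    exact Real.exp_le_exp.2 (mul_le_mul_of_nonneg_left (ciSup_le fun k => hDb k p) ht)
  set PP : Measure (ι → Ω × Ω) := Measure.pi fun _ => ν.prod ν with hPP
  have hΦi : Integrable Φ PP := Integrable.of_bound hΦm.aestronglyMeasurable _ (ae_of_all _ hΦb)
  have he := measurePreserving_arrowProdEquivProdArrow Ω Ω ι (fun _ => ν) (fun _ => ν)
  set e := MeasurableEquiv.arrowProdEquivProdArrow Ω Ω ι
  have hΦei : Integrable (fun q : (ι → Ω) × (ι → Ω) => Φ (e.symm q)) (Pi1.prod Pi1) := by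
    refine Integrable.of_bound (hΦm.comp e.symm.measurable).aestronglyMeasurable _
      (ae_of_all _ fun q => hΦb _)
  have hesymm : ∀ s s' : ι → Ω, e.symm (s, s') = fun i => (s i, s' i) := fun s s' => rfl
  -- the ghost sample
  have hghost : ∫ s : ι → Ω, Real.exp (t * ⨆ k, |∑ i, h k (s i) - m * ∫ x, h k x ∂ν|) ∂Pi1 ≤
      ∫ p, Φ p ∂PP := by
    rw [← (he.symm e).integral_comp e.symm.measurableEmbedding, integral_prod _ hΦei]
    refine integral_mono_of_nonneg (ae_of_all _ fun s => (Real.exp_pos _).le)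
      hΦei.integral_prod_left (ae_of_all _ fun s => ?_)
    -- The maximizing `k` depends on `s` only, so Jensen for the absolute value and for `exp` over
    -- the ghost sample can be applied at this fixed `k`.
    obtain ⟨k, hk⟩ := exists_eq_ciSup_of_finite
      (f := fun k => |∑ i, h k (s i) - m * ∫ x, h k x ∂ν|)
    have hΦs : Integrable (fun s' => Φ (e.symm (s, s'))) Pi1 := by
      refine Integrable.of_bound (hΦm.comp (e.symm.measurable.comp
        measurable_prodMk_left)).aestronglyMeasurable _ (ae_of_all _ fun q => hΦb _)
    have hDs : Measurable fun s' => D k (e.symm (s, s')) :=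
      (hDm k).comp (e.symm.measurable.comp measurable_prodMk_left)
    have hDsi : Integrable (fun s' => D k (e.symm (s, s'))) Pi1 :=
      Integrable.of_bound hDs.aestronglyMeasurable _ (ae_of_all _ fun q => hDb _ _)
    have hexpi : Integrable (fun s' => Real.exp (t * |D k (e.symm (s, s'))|)) Pi1 := by
      refine Integrable.of_bound (Real.measurable_exp.comp
        (hDs.abs.const_mul t)).aestronglyMeasurable (Real.exp (t * (2 * m)))
        (ae_of_all _ fun q => ?_)
      rw [Real.norm_of_nonneg (Real.exp_pos _).le]
      exact Real.exp_le_exp.2 (mul_le_mul_of_nonneg_left (hDb _ _) ht)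
    have hmean : ∫ s', D k (e.symm (s, s')) ∂Pi1 = ∑ i, h k (s i) - m * ∫ x, h k x ∂ν := by
      simp only [hesymm, hD]
      have hc : ∀ i : ι, Integrable (fun s' : ι → Ω => h k (s' i)) Pi1 := fun i =>
        Integrable.of_bound ((hm k).comp (measurable_pi_apply i)).aestronglyMeasurable 1
          (ae_of_all _ fun x => hb k _)
      have hsub : ∀ i ∈ (Finset.univ : Finset ι),
          Integrable (fun s' : ι → Ω => h k (s i) - h k (s' i)) Pi1 :=
        fun i _ => (integrable_const _).sub (hc i)
      rw [integral_finsetSum _ hsub]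
      have : ∀ i : ι, ∫ s' : ι → Ω, (h k (s i) - h k (s' i)) ∂Pi1 = h k (s i) - ∫ x, h k x ∂ν := by
        intro i
        rw [integral_sub (integrable_const _) (hc i)]
        simp only [integral_const, probReal_univ, one_smul]
        congr 1
        exact integral_comp_eval (μ := fun _ : ι => ν) (hm k).aestronglyMeasurable
      simp [this, Finset.sum_sub_distrib, hmdef]
    calc Real.exp (t * ⨆ k, |∑ i, h k (s i) - m * ∫ x, h k x ∂ν|)
        = Real.exp (t * |∫ s', D k (e.symm (s, s')) ∂Pi1|) := by rw [hmean, ← hk]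
      _ ≤ Real.exp (∫ s', t * |D k (e.symm (s, s'))| ∂Pi1) := by
          rw [integral_const_mul]
          gcongr; exact abs_integral_le_integral_abs
      _ ≤ ∫ s', Real.exp (t * |D k (e.symm (s, s'))|) ∂Pi1 :=
          convexOn_exp.map_integral_le Real.continuous_exp.continuousOn isClosed_univ
            (by simp) (hDsi.abs.const_mul t) hexpi
      _ ≤ ∫ s', Φ (e.symm (s, s')) ∂Pi1 := by
          refine integral_mono hexpi hΦs fun s' => ?_
          refine Real.exp_le_exp.2 (mul_le_mul_of_nonneg_left ?_ ht)
          exact le_ciSup (f := fun k => |D k (e.symm (s, s'))|) (Set.finite_range _).bddAbove k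
  -- exchange of the coordinates selected by the signs
  let sw : Bool → Ω × Ω → Ω × Ω := fun b => if b then id else Prod.swap
  have hsw : ∀ b, MeasurePreserving (sw b) (ν.prod ν) (ν.prod ν) := by
    intro b; cases b
    · exact Measure.measurePreserving_swap
    · exact MeasurePreserving.id _
  have hswap : ∀ σ : ι → Bool, ∫ p, Φ p ∂PP = ∫ p, Φ (fun i => sw (σ i) (p i)) ∂PP := by
    intro σ
    have h1 := measurePreserving_pi (fun _ : ι => ν.prod ν) (fun _ => ν.prod ν)
      (f := fun i => sw (σ i)) fun i => hsw (σ i)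
    rw [hPP]
    conv_lhs => rw [← h1.map_eq]
    rw [integral_map h1.measurable.aemeasurable hΦm.aestronglyMeasurable]
  have hswi : ∀ σ : ι → Bool, Integrable (fun p => Φ (fun i => sw (σ i) (p i))) PP := by
    intro σ
    have h1 := measurePreserving_pi (fun _ : ι => ν.prod ν) (fun _ => ν.prod ν)
      (f := fun i => sw (σ i)) fun i => hsw (σ i)
    exact Integrable.of_bound (hΦm.comp h1.measurable).aestronglyMeasurable _
      (ae_of_all _ fun q => hΦb _)
  have hpow : (0 : ℝ) < 2 ^ Fintype.card ι := by positivity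
  have havg : ∫ p, Φ p ∂PP =
      ∫ p, (1 / (2 : ℝ) ^ Fintype.card ι) * ∑ σ : ι → Bool, Φ (fun i => sw (σ i) (p i)) ∂PP := by
    rw [integral_const_mul, integral_finsetSum _ fun σ _ => hswi σ]
    simp only [← hswap, Finset.sum_const, Finset.card_univ, nsmul_eq_mul]
    simp only [Fintype.card_pi, Fintype.card_bool, Finset.prod_const, Finset.card_univ]
    push_cast
    field_simp
  refine hghost.trans ?_
  rw [havg]
  -- With the pairs fixed, swapping them puts random signs on the differences. The signed sum splits
  -- into one for each half-sample, and `2ab ≤ a² + b²` separates the two exponentials at the price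
  -- of doubling `t`.
  have hpt : ∀ p : ι → Ω × Ω, (1 / (2 : ℝ) ^ Fintype.card ι) *
      ∑ σ : ι → Bool, Φ (fun i => sw (σ i) (p i)) ≤ Real.exp (2 * t * R + 2 * m * t ^ 2) := by
    intro p
    set x : κ → ι → ℝ := fun k i => h k (p i).1
    set y : κ → ι → ℝ := fun k i => h k (p i).2
    have h1 : ∀ σ : ι → Bool, Φ (fun i => sw (σ i) (p i)) ≤
        (Real.exp (2 * t * signSup x σ) + Real.exp (2 * t * signSup y σ)) / 2 := by
      intro σ
      have hle : (⨆ k, |D k (fun i => sw (σ i) (p i))|) ≤ signSup x σ + signSup y σ := by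
        refine ciSup_le fun k => ?_
        have : D k (fun i => sw (σ i) (p i)) = ∑ i, (if σ i then (1 : ℝ) else -1) * x k i -
            ∑ i, (if σ i then (1 : ℝ) else -1) * y k i := by
          simp only [hD, ← Finset.sum_sub_distrib]
          refine Finset.sum_congr rfl fun i _ => ?_
          cases hσ : σ i <;> simp [sw, x, y]
          ring
        rw [this]
        exact (abs_sub _ _).trans (add_le_add (le_signSup x σ k) (le_signSup y σ k))
      have h2 : Φ (fun i => sw (σ i) (p i)) ≤
          Real.exp (t * signSup x σ) * Real.exp (t * signSup y σ) := by
        rw [← Real.exp_add, ← mul_add]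
        exact Real.exp_le_exp.2 (mul_le_mul_of_nonneg_left hle ht)
      have h3 : ∀ a : ℝ, Real.exp (2 * t * a) = Real.exp (t * a) ^ 2 := fun a => by
        rw [← Real.exp_nat_mul]; congr 1; push_cast; ring
      rw [h3, h3]
      nlinarith [sq_nonneg (Real.exp (t * signSup x σ) - Real.exp (t * signSup y σ))]
    have h2 : ∀ v : ι → Ω, (1 / (2 : ℝ) ^ Fintype.card ι) *
        ∑ σ : ι → Bool, Real.exp (2 * t * signSup (fun k i => h k (v i)) σ) ≤
        Real.exp (2 * t * R + 2 * m * t ^ 2) := by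
      intro v
      refine (exp_signSup_le (2 * t) _ fun k i => hb k _).trans (Real.exp_le_exp.2 ?_)
      have := mul_le_mul_of_nonneg_left (hR v) (by positivity : 0 ≤ 2 * t)
      rw [← hmdef]; nlinarith
    have hx := h2 fun i => (p i).1
    have hy := h2 fun i => (p i).2
    calc _ ≤ (1 / (2 : ℝ) ^ Fintype.card ι) * ∑ σ : ι → Bool,
          (Real.exp (2 * t * signSup x σ) + Real.exp (2 * t * signSup y σ)) / 2 :=
          mul_le_mul_of_nonneg_left (Finset.sum_le_sum fun σ _ => h1 σ) (by positivity)
      _ = ((1 / (2 : ℝ) ^ Fintype.card ι) * ∑ σ : ι → Bool, Real.exp (2 * t * signSup x σ) +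
          (1 / (2 : ℝ) ^ Fintype.card ι) * ∑ σ : ι → Bool, Real.exp (2 * t * signSup y σ)) / 2 := by
          rw [← Finset.sum_div, Finset.sum_add_distrib]; ring
      _ ≤ _ := by linarith
  calc _ ≤ ∫ p, Real.exp (2 * t * R + 2 * m * t ^ 2) ∂PP := by
        refine integral_mono ((integrable_finsetSum _ fun σ _ => hswi σ).const_mul _)
          (integrable_const _) hpt
    _ = _ := by simp

/-- Tail bound for uniform deviations over a finite family. -/
theorem measure_uniform_deviation_finite [Nonempty ι] [Finite κ] [Nonempty κ] (ν : Measure Ω)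
    [IsProbabilityMeasure ν] (h : κ → Ω → ℝ) (hm : ∀ k, Measurable (h k))
    (hb : ∀ k x, |h k x| ≤ 1) (R τ : ℝ) (hτ : 0 ≤ τ)
    (hR : ∀ u : ι → Ω, signMean (fun k i => h k (u i)) ≤ R) :
    (Measure.pi fun _ : ι => ν) {s | ∃ k, 2 * R + τ <
      |∑ i, h k (s i) - Fintype.card ι * ∫ x, h k x ∂ν|} ≤
      ENNReal.ofReal (Real.exp (-τ ^ 2 / (8 * Fintype.card ι))) := by
  have := Fintype.ofFinite κ
  set m : ℝ := (Fintype.card ι : ℝ) with hmdef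
  have hm0 : 0 < m := by rw [hmdef]; exact_mod_cast Fintype.card_pos
  -- Minimizer of the Chernoff exponent `-tτ + 2mt²`, whose minimum is `-τ²/(8m)`.
  set t := τ / (4 * m)
  have ht : 0 ≤ t := by positivity
  set Z : (ι → Ω) → ℝ := fun s => ⨆ k, |∑ i, h k (s i) - m * ∫ x, h k x ∂ν|
  have hZm : Measurable Z := Measurable.iSup fun k => by
    refine Measurable.abs (Measurable.sub_const ?_ _)
    exact Finset.measurable_fun_sum _ fun i _ => (hm k).comp (measurable_pi_apply i)
  have hZb : ∀ s, Z s ≤ 2 * m := fun s => ciSup_le fun k => by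
    have h1 : |∑ i, h k (s i)| ≤ m := by
      refine (Finset.abs_sum_le_sum_abs _ _).trans ?_
      calc _ ≤ ∑ i : ι, (1 : ℝ) := Finset.sum_le_sum fun i _ => hb k _
        _ = m := by simp [hmdef]
    have h2 : |∫ x, h k x ∂ν| ≤ 1 := by
      have := norm_integral_le_of_norm_le_const (μ := ν) (f := h k) (C := 1)
        (ae_of_all _ fun x => hb k x)
      simpa using this
    have h3 : |m * ∫ x, h k x ∂ν| ≤ m := by
      rw [abs_mul, abs_of_pos hm0]; nlinarith
    exact (abs_sub _ _).trans (by linarith)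
  have hexp := exp_uniform_deviation_le (ι := ι) ν h hm hb R t ht hR
  have hint : Integrable (fun s => Real.exp (t * Z s)) (Measure.pi fun _ : ι => ν) := by
    refine Integrable.of_bound (Real.measurable_exp.comp
      (hZm.const_mul t)).aestronglyMeasurable (Real.exp (t * (2 * m))) (ae_of_all _ fun s => ?_)
    rw [Real.norm_of_nonneg (Real.exp_pos _).le]
    exact Real.exp_le_exp.2 (mul_le_mul_of_nonneg_left (hZb s) ht)
  have hch := measure_ge_le_exp_mul_mgf (μ := Measure.pi fun _ : ι => ν) (X := Z) (2 * R + τ) ht hint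
  have hbound : (Measure.pi fun _ : ι => ν).real {s | 2 * R + τ ≤ Z s} ≤
      Real.exp (-τ ^ 2 / (8 * m)) := by
    refine hch.trans ?_
    calc _ ≤ Real.exp (-t * (2 * R + τ)) * Real.exp (2 * t * R + 2 * m * t ^ 2) := by
          gcongr; exact hexp
      _ = _ := by
          rw [← Real.exp_add]; congr 1; simp only [t]; field_simp; ring
  rw [← ofReal_measureReal]
  refine ENNReal.ofReal_le_ofReal ((measureReal_mono ?_).trans hbound)
  rintro s ⟨k, hk⟩
  exact hk.le.trans (le_ciSup (f := fun k => |∑ i, h k (s i) - m * ∫ x, h k x ∂ν|)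
    (Set.finite_range _).bddAbove k)

end

section

variable {ι Ω 𝒳 : Type*} [Fintype ι] [DecidableEq ι] [MeasurableSpace Ω] [MeasurableSpace 𝒳]

/-! ### Uniform deviations over the threshold classifiers at one cutoff -/

theorem measurable_featX : Measurable (featX : Obs 𝒳 → 𝒳) := measurable_fst

theorem measurable_attrA : Measurable (attrA : Obs 𝒳 → Fin 2) := measurable_fst.comp measurable_snd

theorem measurable_outY : Measurable (outY : Obs 𝒳 → ℝ) :=
  measurable_snd.comp (measurable_snd.comp measurable_snd)

theorem measurable_thr {f : 𝒳 → ℝ} (hf : Measurable f) (z : ℝ) : Measurable fun x => thr f x z := by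
  unfold thr
  exact Measurable.ite (measurableSet_le measurable_const hf) measurable_const measurable_const

/-- The finite-family bound does not depend on the size of the family. Strict deviations survive
pointwise approximation by the countable subclass, and continuity from below along its initial
segments then reaches all of `ℱ` without loss. -/
theorem measure_thr_deviation [Nonempty ι] (ℱ : Set (𝒳 → ℝ)) (hℱ : ∀ f ∈ ℱ, Measurable f)
    (hℱm : PointwiseMeasurable ℱ) (r : ℝ)
    (hr : rademacher (thrClass ℱ) (Fintype.card ι) ≤ r)
    (ν : Measure (Obs 𝒳)) [IsProbabilityMeasure ν] (w : Obs 𝒳 → ℝ) (hw : Measurable w)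
    (hw1 : ∀ o, |w o| ≤ 1) (z : ℝ) (hz : z ∈ Set.Icc (0 : ℝ) 1) (τ : ℝ) (hτ : 0 ≤ τ) :
    (Measure.pi fun _ : ι => ν) {s | ∃ f ∈ ℱ, 2 * (Fintype.card ι * r) + τ <
      |∑ i, w (s i) * thr f (featX (s i)) z -
        Fintype.card ι * ∫ o, w o * thr f (featX o) z ∂ν|} ≤
      ENNReal.ofReal (Real.exp (-τ ^ 2 / (8 * Fintype.card ι))) := by
  obtain ⟨𝒢, h𝒢, hcount, happ⟩ := hℱm
  rcases 𝒢.eq_empty_or_nonempty with h0 | hne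
  · refine le_of_eq_of_le ?_ zero_le
    rw [show {s : ι → Obs 𝒳 | ∃ f ∈ ℱ, 2 * (Fintype.card ι * r) + τ <
      |∑ i, w (s i) * thr f (featX (s i)) z -
        Fintype.card ι * ∫ o, w o * thr f (featX o) z ∂ν|} = ∅ from ?_, measure_empty]
    refine Set.eq_empty_of_forall_notMem ?_
    rintro s ⟨f, hf, _⟩
    obtain ⟨G, hG, _⟩ := happ f hf z hz
    simpa [h0] using hG 0
  obtain ⟨e, he⟩ := hcount.exists_eq_range hne
  have heℱ : ∀ k, e k ∈ ℱ := fun k => h𝒢 (he ▸ Set.mem_range_self k)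
  set dev : (𝒳 → ℝ) → (ι → Obs 𝒳) → ℝ := fun f s =>
    |∑ i, w (s i) * thr f (featX (s i)) z - Fintype.card ι * ∫ o, w o * thr f (featX o) z ∂ν|
    with hdev
  set a := 2 * (Fintype.card ι * r) + τ
  have hb : ∀ f o, |w o * thr f (featX o) z| ≤ 1 := fun f o => by
    rw [abs_mul]; exact mul_le_one₀ (hw1 o) (abs_nonneg _) (abs_thr_le _ _ _)
  have hmeas : ∀ f ∈ ℱ, Measurable fun o : Obs 𝒳 => w o * thr f (featX o) z := fun f hf =>
    hw.mul ((measurable_thr (hℱ f hf) z).comp measurable_featX)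
  set B : ℕ → Set (ι → Obs 𝒳) := fun n => {s | ∃ k : Fin (n + 1), a < dev (e k) s}
  have hsub : {s | ∃ f ∈ ℱ, a < dev f s} ⊆ ⋃ n, B n := by
    rintro s ⟨f, hf, hlt⟩
    obtain ⟨G, hG, hGt⟩ := happ f hf z hz
    have hthr : ∀ x, ∀ᶠ k in Filter.atTop, thr (G k) x z = thr f x z := fun x => by
      filter_upwards [hGt x] with k hk
      simp only [thr, hk]
    have hint : Filter.Tendsto (fun k => ∫ o, w o * thr (G k) (featX o) z ∂ν) Filter.atTop
        (nhds (∫ o, w o * thr f (featX o) z ∂ν)) := by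
      refine tendsto_integral_of_dominated_convergence (fun _ => (1 : ℝ))
        (fun k => (hmeas _ (h𝒢 (hG k))).aestronglyMeasurable) (integrable_const _)
        (fun k => ae_of_all _ fun o => hb _ o) (ae_of_all _ fun o => ?_)
      refine tendsto_const_nhds.congr' ?_
      filter_upwards [hthr (featX o)] with k hk
      rw [hk]
    have hsum : ∀ᶠ k in Filter.atTop, ∑ i, w (s i) * thr (G k) (featX (s i)) z =
        ∑ i, w (s i) * thr f (featX (s i)) z := by
      have : ∀ᶠ k in Filter.atTop, ∀ i, thr (G k) (featX (s i)) z = thr f (featX (s i)) z :=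
        Filter.eventually_all.2 fun i => hthr _
      filter_upwards [this] with k hk
      simp only [hk]
    have ht : Filter.Tendsto (fun k => dev (G k) s) Filter.atTop (nhds (dev f s)) := by
      simp only [hdev]
      refine Filter.Tendsto.abs (Filter.Tendsto.sub ?_ (hint.const_mul _))
      refine tendsto_const_nhds.congr' ?_
      filter_upwards [hsum] with k hk
      rw [hk]
    obtain ⟨k, hk⟩ := (ht.eventually_const_lt hlt).exists
    obtain ⟨j, hj⟩ : ∃ j, e j = G k := by
      have := hG k; rw [he] at this; exact this
    refine Set.mem_iUnion.2 ⟨j, ⟨j, Nat.lt_succ_self j⟩, ?_⟩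
    simpa [hj] using hk
  have hmono : Monotone B := by
    rintro n n' hn s ⟨k, hk⟩
    exact ⟨⟨k, by omega⟩, hk⟩
  refine (measure_mono hsub).trans ?_
  rw [hmono.measure_iUnion]
  refine iSup_le fun n => ?_
  refine measure_uniform_deviation_finite (κ := Fin (n + 1)) ν
    (fun k o => w o * thr (e k) (featX o) z) (fun k => hmeas _ (heℱ k)) (fun k o => hb _ o)
    (Fintype.card ι * r) τ hτ fun u => ?_
  -- Contraction removes the weights before the comparison with the Rademacher complexity of the
  -- unweighted classifiers.
  refine (signMean_mul_le (fun i => w (u i)) (fun i => hw1 _)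
    (fun (k : Fin (n + 1)) i => thr (e k) (featX (u i)) z)).trans ?_
  refine (signMean_thr_le ℱ (fun k : Fin (n + 1) => e k) (fun k => heℱ k) z hz
    (fun i => featX (u i))).trans ?_
  gcongr

/-- The uniform deviation bound at confidence level `δ`. -/
theorem measure_thr_mean_deviation [Nonempty ι] (ℱ : Set (𝒳 → ℝ)) (hℱ : ∀ f ∈ ℱ, Measurable f)
    (hℱm : PointwiseMeasurable ℱ) (C φ : ℝ) (hφ : φ ≤ 1 / 2)
    (hR : ∀ m : ℕ, 1 ≤ m → rademacher (thrClass ℱ) m ≤ C * (m : ℝ) ^ (-φ))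
    (ν : Measure (Obs 𝒳)) [IsProbabilityMeasure ν] (w : Obs 𝒳 → ℝ) (hw : Measurable w)
    (hw1 : ∀ o, |w o| ≤ 1) (z : ℝ) (hz : z ∈ Set.Icc (0 : ℝ) 1) (δ : ℝ) (hδ0 : 0 < δ)
    (hδ1 : δ ≤ 1) :
    (Measure.pi fun _ : ι => ν) {s | ∃ f ∈ ℱ,
      (2 * C + √(8 * Real.log (1 / δ))) * (Fintype.card ι : ℝ) ^ (-φ) <
      |(1 / (Fintype.card ι : ℝ)) * ∑ i, w (s i) * thr f (featX (s i)) z -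
        ∫ o, w o * thr f (featX o) z ∂ν|} ≤ ENNReal.ofReal δ := by
  set m : ℝ := (Fintype.card ι : ℝ) with hm
  have hm1 : 1 ≤ m := by rw [hm]; exact_mod_cast Fintype.card_pos
  have hm0 : 0 < m := by linarith
  have hlog : 0 ≤ Real.log (1 / δ) := Real.log_nonneg (by rw [le_div_iff₀ hδ0]; linarith)
  set L := √(8 * Real.log (1 / δ))
  have hL : L ^ 2 = 8 * Real.log (1 / δ) := Real.sq_sqrt (by positivity)
  -- The deviation `√m * L` is chosen so that the exponent becomes exactly `log δ`.
  have h := measure_thr_deviation (ι := ι) ℱ hℱ hℱm (C * m ^ (-φ))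
    (by rw [hm]; exact hR _ Fintype.card_pos) ν w hw hw1 z hz (√m * L) (by positivity)
  rw [← hm, mul_pow, Real.sq_sqrt hm0.le, hL,
    show -(m * (8 * Real.log (1 / δ))) / (8 * m) = Real.log δ by
      rw [one_div, Real.log_inv]; field_simp, Real.exp_log hδ0] at h
  refine (measure_mono ?_).trans h
  rintro s ⟨f, hf, hlt⟩
  refine ⟨f, hf, ?_⟩
  -- Since `φ ≤ 1/2`, the concentration term is absorbed into the complexity rate.
  have h1 : √m ≤ m * m ^ (-φ) := by
    rw [Real.sqrt_eq_rpow, ← Real.rpow_one_add' hm0.le (by linarith)]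
    exact Real.rpow_le_rpow_of_exponent_le hm1 (by linarith)
  have h2 : |∑ i, w (s i) * thr f (featX (s i)) z - m * ∫ o, w o * thr f (featX o) z ∂ν| =
      m * |(1 / m) * ∑ i, w (s i) * thr f (featX (s i)) z - ∫ o, w o * thr f (featX o) z ∂ν| := by
    rw [← abs_of_pos hm0, ← abs_mul, abs_of_pos hm0, mul_sub, ← mul_assoc,
      mul_one_div_cancel hm0.ne', one_mul]
  rw [h2]
  have h3 := mul_lt_mul_of_pos_left hlt hm0
  have h4 : √m * L ≤ m * m ^ (-φ) * L := by gcongr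
  linarith

/-! ### Conditioning on the observations that fall into an event -/

open Classical in
/-- The indices of the observations in `E`. -/
noncomputable def hits (E : Set Ω) (s : ι → Ω) : Finset ι := Finset.univ.filter fun i => s i ∈ E

theorem mem_hits (E : Set Ω) (s : ι → Ω) (i : ι) : i ∈ hits E s ↔ s i ∈ E := by simp [hits]

/-- On `E` the measure `P` is `P E` times the conditional law, so on the box the product measures
differ by a power of `P E`. -/
theorem pi_inter_box_le (P : Measure Ω) [IsProbabilityMeasure P] (E : Set Ω) (hE : MeasurableSet E)
    (hPE : P E ≠ 0) (B : Set (ι → Ω)) (δ : ENNReal) (hB : (Measure.pi fun _ : ι => P[|E]) B ≤ δ) :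
    (Measure.pi fun _ : ι => P) (B ∩ Set.univ.pi fun _ => E) ≤ δ * P E ^ Fintype.card ι := by
  have h1 : (Measure.pi fun _ : ι => P.restrict E) =
      (P E ^ Fintype.card ι) • Measure.pi fun _ : ι => P[|E] := by
    refine (Measure.pi_eq fun t ht => ?_)
    simp only [Measure.smul_apply, Measure.pi_pi, smul_eq_mul]
    rw [← Finset.card_univ, ← Finset.prod_const, ← Finset.prod_mul_distrib]
    refine Finset.prod_congr rfl fun i _ => ?_
    rw [cond_apply hE, ← mul_assoc, ENNReal.mul_inv_cancel hPE (measure_ne_top _ _), one_mul,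
      Measure.restrict_apply (ht i), Set.inter_comm]
  rw [← Measure.restrict_apply' (MeasurableSet.univ_pi fun _ => hE), Measure.restrict_pi_pi, h1,
    Measure.smul_apply, smul_eq_mul, mul_comm]
  gcongr

/-- If a bad set of subsamples has conditional probability at most `δ` for every possible set of
indices in `E`, then the subsample in `E` is bad with probability at most `δ`. -/
theorem measure_hits_le (P : Measure Ω) [IsProbabilityMeasure P] (E : Set Ω) (hE : MeasurableSet E)
    (hPE : P E ≠ 0) (B : ∀ T : Finset ι, Set (T → Ω)) (δ : ENNReal)
    (hB : ∀ T : Finset ι, (Measure.pi fun _ : T => P[|E]) (B T) ≤ δ) :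
    (Measure.pi fun _ : ι => P) {s | (fun i : hits E s => s i) ∈ B (hits E s)} ≤ δ := by
  have hsub : {s : ι → Ω | (fun i : hits E s => s i) ∈ B (hits E s)} ⊆
      ⋃ T : Finset ι, (MeasurableEquiv.piEquivPiSubtypeProd (fun _ : ι => Ω) (· ∈ T)) ⁻¹'
        ((B T ∩ Set.univ.pi fun _ => E) ×ˢ (Set.univ.pi fun _ => Eᶜ)) := by
    intro s hs
    refine Set.mem_iUnion.2 ⟨hits E s, ⟨hs, fun i _ => (mem_hits E s i).1 i.2⟩, fun i _ => ?_⟩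
    exact fun h => i.2 ((mem_hits E s i).2 h)
  refine (measure_mono hsub).trans ((measure_iUnion_le _).trans ?_)
  rw [tsum_fintype]
  -- Decomposition by the exact set `T` of indices in `E`. Its probabilities sum to 1 by the
  -- binomial formula, so no union-bound factor is lost.
  calc _ ≤ ∑ T : Finset ι, δ * (P E ^ T.card * P Eᶜ ^ (Fintype.card ι - T.card)) := by
        refine Finset.sum_le_sum fun T _ => ?_
        rw [(measurePreserving_piEquivPiSubtypeProd (fun _ : ι => P) (· ∈ T)).measure_preimage_equiv,
          Measure.prod_prod, Measure.pi_pi, ← mul_assoc]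
        refine mul_le_mul' ?_ ?_
        · have h := pi_inter_box_le (ι := T) P E hE hPE (B T) δ (hB T)
          rw [Fintype.card_coe] at h
          convert! h
        · simp [Finset.prod_const]
    _ = δ := by
        rw [← Finset.mul_sum, Fintype.sum_pow_mul_eq_add_pow, measure_add_measure_compl hE,
          measure_univ, one_pow, mul_one]

end

section

/-! ### Averages under distributions over `ℱ` -/

section Mix

variable {α : Type*}

theorem summable_pmf_mul (Q : PMF α) {v : α → ℝ} {b : ℝ} (hv : ∀ f, |v f| ≤ b) :
    Summable fun f => (Q f).toReal * v f := by
  refine Summable.of_norm_bounded (g := fun f => (Q f).toReal * b)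
    ((ENNReal.summable_toReal Q.tsum_coe_ne_top).mul_right b) fun f => ?_
  rw [norm_mul, Real.norm_of_nonneg ENNReal.toReal_nonneg]
  exact mul_le_mul_of_nonneg_left (hv f) ENNReal.toReal_nonneg

theorem mix_const (Q : PMF α) (b : ℝ) : mix Q (fun _ => b) = b := by
  unfold mix
  rw [tsum_mul_right, ← ENNReal.tsum_toReal_eq fun f => Q.apply_ne_top f, Q.tsum_coe]
  simp

theorem mix_mono (Q : PMF α) {v w : α → ℝ} {b c : ℝ} (hv : ∀ f, |v f| ≤ b) (hw : ∀ f, |w f| ≤ c)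
    (h : ∀ f, v f ≤ w f) : mix Q v ≤ mix Q w :=
  (summable_pmf_mul Q hv).tsum_le_tsum
    (fun f => mul_le_mul_of_nonneg_left (h f) ENNReal.toReal_nonneg) (summable_pmf_mul Q hw)

theorem mix_add (Q : PMF α) {v w : α → ℝ} {b c : ℝ} (hv : ∀ f, |v f| ≤ b) (hw : ∀ f, |w f| ≤ c) :
    mix Q (fun f => v f + w f) = mix Q v + mix Q w := by
  unfold mix
  rw [← (summable_pmf_mul Q hv).tsum_add (summable_pmf_mul Q hw)]
  simp only [mul_add]

theorem mix_const_mul (Q : PMF α) (v : α → ℝ) (b : ℝ) :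
    mix Q (fun f => b * v f) = b * mix Q v := by
  unfold mix
  rw [← tsum_mul_left]
  simp only [mul_left_comm]

theorem mix_sub (Q : PMF α) {v w : α → ℝ} {b c : ℝ} (hv : ∀ f, |v f| ≤ b) (hw : ∀ f, |w f| ≤ c) :
    mix Q (fun f => v f - w f) = mix Q v - mix Q w := by
  unfold mix
  rw [← (summable_pmf_mul Q hv).tsum_sub (summable_pmf_mul Q hw)]
  simp only [mul_sub]

theorem abs_mix_le (Q : PMF α) {v : α → ℝ} {b : ℝ} (hv : ∀ f, |v f| ≤ b) : |mix Q v| ≤ b := by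
  obtain ⟨f⟩ : Nonempty α := Q.support_nonempty.to_subtype.map Subtype.val
  have hb : ∀ _ : α, |b| ≤ |b| := fun _ => le_rfl
  have hb' : ∀ _ : α, |-b| ≤ |-b| := fun _ => le_rfl
  rw [abs_le]
  constructor
  · rw [← mix_const Q (-b)]
    exact mix_mono Q hb' hv fun f => (abs_le.1 (hv f)).1
  · rw [← mix_const Q b]
    exact mix_mono Q hv hb fun f => (abs_le.1 (hv f)).2

theorem abs_mix_sub_mix_le (Q : PMF α) {v w : α → ℝ} {b c e : ℝ} (hv : ∀ f, |v f| ≤ b)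
    (hw : ∀ f, |w f| ≤ c) (h : ∀ f, |v f - w f| ≤ e) : |mix Q v - mix Q w| ≤ e := by
  rw [← mix_sub Q hv hw]; exact abs_mix_le Q h

theorem mix_map_uniform {t : ℕ} (g : Fin (t + 1) → α) (v : α → ℝ) :
    mix ((PMF.uniformOfFintype (Fin (t + 1))).map g) v =
      (1 / ((t : ℝ) + 1)) * ∑ s, v (g s) := by
  classical
  unfold mix
  have h : ∀ f, (((PMF.uniformOfFintype (Fin (t + 1))).map g) f).toReal * v f =
      ∑ s, if f = g s then (1 / ((t : ℝ) + 1)) * v f else 0 := by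
    intro f
    rw [PMF.map_apply, tsum_fintype, ENNReal.toReal_sum, Finset.sum_mul]
    · refine Finset.sum_congr rfl fun s _ => ?_
      split_ifs
      · rw [PMF.uniformOfFintype_apply, ENNReal.toReal_inv, Fintype.card_fin]
        have : ((t : ENNReal) + 1).toReal = (t : ℝ) + 1 := by
          rw [ENNReal.toReal_add (by simp) (by simp)]; simp
        simp [this]
      · simp
    · intro s _
      split_ifs
      · exact PMF.apply_ne_top _ _
      · simp
  simp only [h]
  rw [Summable.tsum_finsetSum, Finset.mul_sum]
  · refine Finset.sum_congr rfl fun s _ => ?_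
    rw [tsum_ite_eq]
  · intro s _
    refine summable_of_hasFiniteSupport ((Set.finite_singleton (g s)).subset ?_)
    intro f hf
    by_contra hne
    exact hf (if_neg hne)

end Mix

/-! ### Exponentiated gradient -/

/-- Hoeffding's lemma for a distribution on a finite set. -/
theorem sum_mul_exp_le {α : Type*} [Fintype α] (p x : α → ℝ) (hp : ∀ a, 0 ≤ p a)
    (hp1 : ∑ a, p a = 1) (r : ℝ) (hx : ∀ a, |x a| ≤ r) :
    ∑ a, p a * Real.exp (x a) ≤ Real.exp (∑ a, p a * x a + r ^ 2 / 2) := by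
  let _ : MeasurableSpace α := ⊤
  have hsum : ∑ a, ENNReal.ofReal (p a) = 1 := by
    rw [← ENNReal.ofReal_sum_of_nonneg fun a _ => hp a, hp1, ENNReal.ofReal_one]
  set Q : PMF α := PMF.ofFintype (fun a => ENNReal.ofReal (p a)) hsum
  have hint : ∀ y : α → ℝ, ∫ a, y a ∂Q.toMeasure = ∑ a, p a * y a := fun y => by
    rw [PMF.integral_eq_sum]
    simp [Q, ENNReal.toReal_ofReal (hp _)]
  have hr : 0 ≤ r := by
    obtain ⟨a⟩ : Nonempty α := by
      by_contra h
      rw [not_nonempty_iff] at h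
      simp at hp1
    exact (abs_nonneg _).trans (hx a)
  -- The centred variable has range `2r`, hence variance proxy `r²`; its moment bound is taken at 1.
  have h := (hasSubgaussianMGF_of_mem_Icc (μ := Q.toMeasure) (X := x) (a := -r) (b := r)
    (measurable_from_top.aemeasurable) (ae_of_all _ fun a => abs_le.1 (hx a))).mgf_le 1
  rw [mgf, hint, hint] at h
  have hc : (((‖r - -r‖₊ / 2) ^ 2 : NNReal) : ℝ) = r ^ 2 := by
    push_cast
    rw [Real.norm_of_nonneg (by linarith)]; ring
  rw [hc] at h
  simp only [one_mul, one_pow, mul_one, Real.exp_sub] at h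
  rw [Real.exp_add]
  calc ∑ a, p a * Real.exp (x a)
      = Real.exp (∑ a, p a * x a) *
          ∑ a, p a * (Real.exp (x a) / Real.exp (∑ a, p a * x a)) := by
        rw [Finset.mul_sum]
        refine Finset.sum_congr rfl fun a _ => ?_
        have := (Real.exp_pos (∑ a, p a * x a)).ne'
        field_simp
    _ ≤ _ := by gcongr

/-- Regret of the exponentiated gradient updates against every `λ ≥ 0` with `‖λ‖₁ ≤ B`. -/
theorem exponentiated_gradient_regret (B η r : ℝ) (hB : 0 ≤ B) (hη : 0 < η)
    (θ v : ℕ → Fin 3 → ℝ) (h0 : θ 0 = 0) (hstep : ∀ t, θ (t + 1) = θ t + η • v t)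
    (hv : ∀ t k, |v t k| ≤ r) (lam : Fin 3 → ℝ) (hlam : ∀ k, 0 ≤ lam k) (hlamB : ∑ k, lam k ≤ B)
    (T : ℕ) :
    ∑ t ∈ Finset.range T, ∑ k, lam k * v t k ≤
      ∑ t ∈ Finset.range T, ∑ k, (B * Real.exp (θ t k) / (1 + ∑ k', Real.exp (θ t k'))) * v t k
        + B * Real.log 4 / η + T * (η * r ^ 2 * B / 2) := by
  -- The potential. The summand 1 is the weight of the idle action, which allows total multiplier
  -- mass below `B`; initially `Z = 4`, whence `log 4`.
  set Z : ℕ → ℝ := fun t => 1 + ∑ k, Real.exp (θ t k) with hZ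
  have hZpos : ∀ t, 0 < Z t := fun t => by positivity
  set p : ℕ → Fin 3 → ℝ := fun t k => Real.exp (θ t k) / Z t with hp
  have hZstep : ∀ t, Z (t + 1) ≤ Z t * Real.exp (η * ∑ k, p t k * v t k + (η * r) ^ 2 / 2) := by
    intro t
    have h := sum_mul_exp_le (α := Option (Fin 3))
      (fun a => a.elim (1 / Z t) (p t)) (fun a => a.elim 0 fun k => η * v t k)
      (by rintro (_ | k)
          · exact (one_div_pos.2 (hZpos t)).le
          · exact (div_pos (Real.exp_pos _) (hZpos t)).le)
      (by simp only [Fintype.sum_option, Option.elim, hp]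
          rw [← Finset.sum_div, ← add_div]
          exact div_self (hZpos t).ne') (η * r)
      (by have hr : 0 ≤ r := (abs_nonneg _).trans (hv 0 0)
          rintro (_ | k)
          · simp; positivity
          · simp only [Option.elim]
            rw [abs_mul, abs_of_pos hη]
            gcongr; exact hv t k)
    simp only [Fintype.sum_option, Option.elim, Real.exp_zero, mul_one, mul_zero, zero_add] at h
    have h2 : Z (t + 1) = Z t * (1 / Z t + ∑ k, p t k * Real.exp (η * v t k)) := by
      rw [mul_add, mul_one_div_cancel (hZpos t).ne', Finset.mul_sum]
      simp only [hZ, hstep t, Pi.add_apply, Pi.smul_apply, smul_eq_mul, Real.exp_add]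
      congr 1
      refine Finset.sum_congr rfl fun k _ => ?_
      have := (hZpos t).ne'
      simp only [hp]
      field_simp
      rfl
    rw [h2]
    refine mul_le_mul_of_nonneg_left (h.trans (le_of_eq ?_)) (hZpos t).le
    congr 2
    rw [Finset.mul_sum]
    exact Finset.sum_congr rfl fun k _ => by ring
  have hlog : ∀ T : ℕ, Real.log (Z T) ≤ Real.log 4 +
      ∑ t ∈ Finset.range T, (η * ∑ k, p t k * v t k + (η * r) ^ 2 / 2) := by
    intro T
    induction T with
    | zero => simp only [hZ, h0, Pi.zero_apply, Real.exp_zero]; norm_num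
    | succ T ih =>
      rw [Finset.sum_range_succ, ← add_assoc]
      have := Real.log_le_log (hZpos (T + 1)) (hZstep T)
      rw [Real.log_mul (hZpos T).ne' (Real.exp_pos _).ne', Real.log_exp] at this
      linarith
  have hθ : ∀ T k, θ T k = η * ∑ t ∈ Finset.range T, v t k := by
    intro T k
    induction T with
    | zero => simp [h0]
    | succ T ih => rw [hstep, Finset.sum_range_succ, mul_add, ← ih]; simp
  have hZ1 : 0 ≤ Real.log (Z T) := Real.log_nonneg (by
    have : 0 ≤ ∑ k, Real.exp (θ T k) := by positivity
    simp only [hZ]; linarith)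
  -- The potential dominates the cumulative payoff of each constraint, and with `log Z ≥ 0` that of
  -- every admissible mixture.
  have hθlog : ∀ k, θ T k ≤ Real.log (Z T) := fun k => by
    rw [Real.le_log_iff_exp_le (hZpos T)]
    have := Finset.single_le_sum (f := fun k => Real.exp (θ T k))
      (fun k _ => (Real.exp_pos _).le) (Finset.mem_univ k)
    simp only [hZ]; linarith
  have h1 : η * ∑ t ∈ Finset.range T, ∑ k, lam k * v t k ≤ B * Real.log (Z T) := by
    calc η * ∑ t ∈ Finset.range T, ∑ k, lam k * v t k = ∑ k, lam k * θ T k := by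
          rw [Finset.sum_comm, Finset.mul_sum]
          refine Finset.sum_congr rfl fun k _ => ?_
          rw [hθ, ← Finset.mul_sum]; ring
      _ ≤ ∑ k, lam k * Real.log (Z T) := by
          gcongr with k
          · exact hlam k
          · exact hθlog k
      _ ≤ _ := by rw [← Finset.sum_mul]; gcongr
  have h2 := mul_le_mul_of_nonneg_left (hlog T) hB
  have h3 : B * ∑ t ∈ Finset.range T, (η * ∑ k, p t k * v t k + (η * r) ^ 2 / 2) =
      η * (∑ t ∈ Finset.range T, ∑ k, (B * Real.exp (θ t k) / Z t) * v t k +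
        T * (η * r ^ 2 * B / 2)) := by
    rw [Finset.sum_add_distrib, mul_add, mul_add, ← Finset.mul_sum, ← mul_assoc, mul_comm B η,
      mul_assoc, Finset.mul_sum]
    congr 1
    · congr 1
      refine Finset.sum_congr rfl fun t _ => ?_
      rw [Finset.mul_sum]
      refine Finset.sum_congr rfl fun k _ => ?_
      simp only [hp]; ring
    · simp; ring
  refine le_of_mul_le_mul_left ?_ hη
  have h4 : η * (B * Real.log 4 / η) = B * Real.log 4 := by field_simp
  linarith

end

section

namespace AlgInput

variable {𝒳 : Type*} {n : ℕ} {ℱ : Set (𝒳 → ℝ)}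

/-! ### Best responses -/

/-- The multipliers available to the `λ`-player. -/
def Feasible (I : AlgInput 𝒳 n) (lam : Fin 3 → ℝ) : Prop := (∀ k, 0 ≤ lam k) ∧ ∑ k, lam k ≤ I.Blam

/-- Here the slack and the classifier are decoupled, so their best responses can be computed
separately; the expression is affine in `(ξ, d, c)` and in `lam`. -/
theorem lagrangian_eq (I : AlgInput 𝒳 n) (ξ d c : ℝ) (lam : Fin 3 → ℝ) :
    I.lagrangian ξ d c lam =
      ξ * (1 - lam 0 - lam 1) + (lam 0 - lam 1) * d + lam 2 * (c - I.epsHat) := by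
  simp [lagrangian, viol, Fin.sum_univ_three]; ring

theorem bestXi_mem (I : AlgInput 𝒳 n) (hB : 0 ≤ I.Bxi) (lam : Fin 3 → ℝ) :
    I.bestXi lam ∈ Set.Icc 0 I.Bxi := by
  unfold bestXi; split_ifs <;> simp [hB]

theorem bestXi_le (I : AlgInput 𝒳 n) (lam : Fin 3 → ℝ) {ξ : ℝ} (hξ : ξ ∈ Set.Icc 0 I.Bxi) :
    I.bestXi lam * (1 - lam 0 - lam 1) ≤ ξ * (1 - lam 0 - lam 1) := by
  unfold bestXi; split_ifs with h
  · exact mul_le_mul_of_nonpos_right hξ.2 h.le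
  · rw [zero_mul]; exact mul_nonneg hξ.1 (not_lt.1 h)

theorem best_response_le (I : AlgInput 𝒳 n) {best : (Fin 3 → ℝ) → ℱ} (hbest : I.IsBestH ℱ best)
    {lam : Fin 3 → ℝ} (hlam : I.Feasible lam) {ξ : ℝ} (hξ : ξ ∈ Set.Icc 0 I.Bxi) (f : ℱ) :
    I.lagrangian (I.bestXi lam) (I.dispHat (best lam)) (I.costHat (best lam)) lam ≤
      I.lagrangian ξ (I.dispHat f) (I.costHat f) lam := by
  rw [lagrangian_eq, lagrangian_eq]
  linarith [I.bestXi_le lam hξ, hbest lam hlam.1 hlam.2 f]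

/-- A lower bound valid for every single `f` survives averaging, because the Lagrangian is affine in
disparity and cost. So randomization cannot beat the oracle. -/
theorem best_response_mix_le (I : AlgInput 𝒳 n) {best : (Fin 3 → ℝ) → ℱ}
    (hbest : I.IsBestH ℱ best) {bd bc : ℝ} (hd : ∀ f : ℱ, |I.dispHat f| ≤ bd)
    (hc : ∀ f : ℱ, |I.costHat f| ≤ bc)
    {lam : Fin 3 → ℝ} (hlam : I.Feasible lam) {ξ : ℝ} (hξ : ξ ∈ Set.Icc 0 I.Bxi) (Q : PMF ℱ) :
    I.lagrangian (I.bestXi lam) (I.dispHat (best lam)) (I.costHat (best lam)) lam ≤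
      I.lagrangian ξ (I.dispHatQ Q) (I.costHatQ Q) lam := by
  set L := I.lagrangian (I.bestXi lam) (I.dispHat (best lam)) (I.costHat (best lam)) lam
  set K := ξ * (1 - lam 0 - lam 1) - lam 2 * I.epsHat
  have h1 : ∀ f : ℱ, L - K ≤ (lam 0 - lam 1) * I.dispHat f + lam 2 * I.costHat f := fun f => by
    have := I.best_response_le hbest hlam hξ f
    rw [I.lagrangian_eq ξ] at this
    simp only [L, K]; linarith
  have hd' : ∀ f : ℱ, |(lam 0 - lam 1) * I.dispHat f| ≤ |lam 0 - lam 1| * bd := fun f => by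
    rw [abs_mul]; exact mul_le_mul_of_nonneg_left (hd f) (abs_nonneg _)
  have hc' : ∀ f : ℱ, |lam 2 * I.costHat f| ≤ |lam 2| * bc := fun f => by
    rw [abs_mul]; exact mul_le_mul_of_nonneg_left (hc f) (abs_nonneg _)
  have h2 := mix_mono Q (b := |L - K|) (fun _ => le_rfl)
    (fun f => (abs_add_le _ _).trans (add_le_add (hd' f) (hc' f))) h1
  rw [mix_const, mix_add Q hd' hc', mix_const_mul, mix_const_mul] at h2
  rw [I.lagrangian_eq ξ]
  simp only [dispHatQ, costHatQ]
  simp only [K] at h2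
  linarith

/-- A linear function on the scaled simplex with the origin is maximized at a vertex: the origin, or
all mass on a largest coordinate. -/
theorem bestLam_spec (I : AlgInput 𝒳 n) (v : Fin 3 → ℝ) {lam : Fin 3 → ℝ} (hlam : I.Feasible lam) :
    ∑ k, lam k * v k ≤ ∑ k, I.bestLam v k * v k := by
  obtain ⟨h0, h1⟩ := hlam
  simp only [Fin.sum_univ_three] at *
  have key : ∀ j, (∀ k, v k ≤ v j) → 0 ≤ v j →
      lam 0 * v 0 + lam 1 * v 1 + lam 2 * v 2 ≤ I.Blam * v j := by
    intro j hj hj0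
    have := mul_le_mul_of_nonneg_left (hj 0) (h0 0)
    have := mul_le_mul_of_nonneg_left (hj 1) (h0 1)
    have := mul_le_mul_of_nonneg_left (hj 2) (h0 2)
    have := mul_le_mul_of_nonneg_right h1 hj0
    linarith
  unfold bestLam
  split_ifs with ha hb hc
  · simp only [Pi.zero_apply, zero_mul, add_zero]
    have := mul_nonpos_of_nonneg_of_nonpos (h0 0) (ha 0)
    have := mul_nonpos_of_nonneg_of_nonpos (h0 1) (ha 1)
    have := mul_nonpos_of_nonneg_of_nonpos (h0 2) (ha 2)
    linarith
  all_goals push Not at ha; obtain ⟨i, hi⟩ := ha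
  · have hm : ∀ k, v k ≤ v 0 := by
      intro k; fin_cases k
      · exact le_rfl
      · exact hb.1
      · exact hb.2
    simpa using key 0 hm (hi.le.trans (hm i))
  · have hm : ∀ k, v k ≤ v 1 := by
      intro k; fin_cases k
      · by_contra h
        exact hb ⟨(not_le.1 h).le, hc.trans (not_le.1 h).le⟩
      · exact le_rfl
      · exact hc
    simpa using key 1 hm (hi.le.trans (hm i))
  · have h12 := not_le.1 hc
    have hm : ∀ k, v k ≤ v 2 := by
      intro k; fin_cases k
      · by_contra h
        exact hb ⟨h12.le.trans (not_le.1 h).le, (not_le.1 h).le⟩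
      · exact h12.le
      · exact le_rfl
    simpa using key 2 hm (hi.le.trans (hm i))

theorem bestLam_feasible (I : AlgInput 𝒳 n) (hB : 0 ≤ I.Blam) (v : Fin 3 → ℝ) :
    I.Feasible (I.bestLam v) := by
  unfold bestLam Feasible
  split_ifs
  · simp [hB]
  all_goals
    refine ⟨fun k => ?_, by simp [Fin.sum_univ_three]⟩
    fin_cases k <;> simp [hB]

theorem weights_feasible (I : AlgInput 𝒳 n) (hB : 0 ≤ I.Blam) (θ : Fin 3 → ℝ) :
    I.Feasible (I.weights θ) := by
  have h : 0 ≤ ∑ k, Real.exp (θ k) := by positivity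
  refine ⟨fun k => by unfold weights; positivity, ?_⟩
  unfold weights
  rw [← Finset.sum_div, ← Finset.mul_sum, div_le_iff₀ (by positivity)]
  nlinarith

/-! ### The averages formed by the algorithm -/

section Run

variable (I : AlgInput 𝒳 n) (η : ℝ) (best : (Fin 3 → ℝ) → ℱ)

/-- Slack, empirical disparity and empirical cost of iteration `t + 1`. -/
noncomputable def xiAt (t : ℕ) : ℝ := I.bestXi (I.lamAt η best t)
noncomputable def dAt (t : ℕ) : ℝ := I.dispHat (best (I.lamAt η best t))
noncomputable def cAt (t : ℕ) : ℝ := I.costHat (best (I.lamAt η best t))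

theorem mix_QHat (t : ℕ) (v : ℱ → ℝ) : mix (I.QHat η best t) v =
    (1 / ((t : ℝ) + 1)) * ∑ s ∈ Finset.range (t + 1), v (best (I.lamAt η best s)) := by
  have h : I.QHat η best t = (PMF.uniformOfFintype (Fin (t + 1))).map
      fun s : Fin (t + 1) => best (I.lamAt η best s) := by
    -- In `QHat` the index has type `ℕ`, so the uniform law on `Fin (t + 1)` enters through a
    -- monadic coercion, a bind followed by `pure`.
    change PMF.map _ (PMF.bind _ fun a => PMF.pure _) = _
    rw [PMF.map_bind]
    simp only [PMF.pure_map]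
    exact PMF.bind_pure_comp _ _
  rw [h, mix_map_uniform, ← Fin.sum_univ_eq_sum_range (fun s => v (best (I.lamAt η best s)))]

theorem lagrangian_average (t : ℕ) (lam : Fin 3 → ℝ) :
    I.lagrangian (I.xiHat η best t) (I.dispHatQ (I.QHat η best t)) (I.costHatQ (I.QHat η best t)) lam
      = (1 / ((t : ℝ) + 1)) * ∑ s ∈ Finset.range (t + 1),
        I.lagrangian (I.xiAt η best s) (I.dAt η best s) (I.cAt η best s) lam := by
  have ht : (t : ℝ) + 1 ≠ 0 := by positivity
  simp only [lagrangian_eq, dispHatQ, costHatQ, mix_QHat, xiHat, xiAt, dAt, cAt,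
    Finset.sum_add_distrib, ← Finset.sum_mul, ← Finset.mul_sum, Finset.sum_sub_distrib]
  simp
  field_simp

theorem lagrangian_lamHat (t : ℕ) (ξ d c : ℝ) :
    I.lagrangian ξ d c (I.lamHat η best t) = (1 / ((t : ℝ) + 1)) * ∑ s ∈ Finset.range (t + 1),
        I.lagrangian ξ d c (I.lamAt η best s) := by
  have ht : (t : ℝ) + 1 ≠ 0 := by positivity
  simp only [lagrangian_eq, lamHat, Pi.smul_apply, smul_eq_mul, Finset.sum_apply,
    Finset.sum_add_distrib, ← Finset.sum_mul, ← Finset.mul_sum, Finset.sum_sub_distrib]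
  simp
  field_simp

theorem lamHat_feasible (hB : 0 ≤ I.Blam) (t : ℕ) : I.Feasible (I.lamHat η best t) := by
  have ht : (0 : ℝ) < (t : ℝ) + 1 := by positivity
  have hw := fun s => I.weights_feasible hB (I.theta η best s)
  constructor
  · intro k
    simp only [lamHat, Pi.smul_apply, smul_eq_mul, Finset.sum_apply]
    exact mul_nonneg (by positivity) (Finset.sum_nonneg fun s _ => (hw s).1 k)
  · simp only [lamHat, Pi.smul_apply, smul_eq_mul, Finset.sum_apply]
    rw [← Finset.mul_sum, Finset.sum_comm]
    calc _ ≤ (1 / ((t : ℝ) + 1)) * ∑ s ∈ Finset.range (t + 1), I.Blam := by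
          gcongr with s
          exact (hw s).2
      _ = I.Blam := by simp; field_simp

theorem xiHat_mem (hB : 0 ≤ I.Bxi) (t : ℕ) : I.xiHat η best t ∈ Set.Icc 0 I.Bxi := by
  have ht : (0 : ℝ) < (t : ℝ) + 1 := by positivity
  constructor
  · exact mul_nonneg (by positivity) (Finset.sum_nonneg fun s _ => (I.bestXi_mem hB _).1)
  · calc _ ≤ (1 / ((t : ℝ) + 1)) * ∑ s ∈ Finset.range (t + 1), I.Bxi := by
          unfold xiHat
          gcongr with s
          exact (I.bestXi_mem hB _).2
      _ = I.Bxi := by simp; field_simp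

variable {I η best}

/-- The duality gap is at most the average regret. -/
theorem gap_le (hbest : I.IsBestH ℱ best) (hBl : 0 ≤ I.Blam) (hBx : 0 ≤ I.Bxi) (hη : 0 < η)
    {r : ℝ} (hr : ∀ (f : ℱ), ∀ ξ ∈ Set.Icc (0 : ℝ) I.Bxi, ∀ k,
      |I.viol ξ (I.dispHat f) (I.costHat f) k| ≤ r) (t : ℕ) :
    I.gap η best t ≤ I.Blam * Real.log 4 / (η * (t + 1)) + η * r ^ 2 * I.Blam / 2 := by
  have ht : (0 : ℝ) < (t : ℝ) + 1 := by positivity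
  set v : ℕ → Fin 3 → ℝ := fun s => I.viol (I.xiAt η best s) (I.dAt η best s) (I.cAt η best s)
  have hfeas : ∀ s, I.Feasible (I.lamAt η best s) := fun s => I.weights_feasible hBl _
  set ξ := I.xiHat η best t with hξ
  set d := I.dispHatQ (I.QHat η best t) with hd
  set c := I.costHatQ (I.QHat η best t) with hc
  set lam := I.lamHat η best t with hlam
  set lst := I.bestLam (I.viol ξ d c)
  have hlst : I.Feasible lst := I.bestLam_feasible hBl _
  have hreg := exponentiated_gradient_regret I.Blam η r hBl hη (I.theta η best) v rfl
    (fun s => rfl) (fun s k => hr _ _ (I.bestXi_mem hBx _) k) lst hlst.1 hlst.2 (t + 1)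
  set L := I.lagrangian ξ d c lam
  set Lup := I.lagrangian ξ d c lst
  set Llow := I.lagrangian (I.bestXi lam) (I.dispHat (best lam)) (I.costHat (best lam)) lam
  -- As `Llow ≤ L ≤ Lup`, both one-sided gaps are at most `Lup - Llow`.
  have h1 : L ≤ Lup := by
    simp only [L, Lup, lagrangian]
    linarith [I.bestLam_spec (I.viol ξ d c) (I.lamHat_feasible η best hBl t)]
  have h2 : Llow ≤ L := by
    simp only [L, hξ, hd, hc]
    rw [I.lagrangian_average]
    rw [one_div_mul_eq_div, le_div_iff₀ ht]
    calc Llow * ((t : ℝ) + 1) = ∑ s ∈ Finset.range (t + 1), Llow := by simp [mul_comm]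
      _ ≤ _ := Finset.sum_le_sum fun s _ => I.best_response_le hbest
          (I.lamHat_feasible η best hBl t) (I.bestXi_mem hBx _) _
  -- `Lup` averages the iterates against the fixed `lst`. The regret bound replaces `lst` by the
  -- multipliers of each round, and against those each iterate is at least as good as the response
  -- to the average multipliers.
  have h3 : Lup ≤ Llow + (I.Blam * Real.log 4 / (η * (t + 1)) + η * r ^ 2 * I.Blam / 2) := by
    have e1 : Lup = (1 / ((t : ℝ) + 1)) * ∑ s ∈ Finset.range (t + 1),
        (I.xiAt η best s + ∑ k, lst k * v s k) := I.lagrangian_average η best t lst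
    have e2 : Llow = (1 / ((t : ℝ) + 1)) * ∑ s ∈ Finset.range (t + 1),
        I.lagrangian (I.bestXi lam) (I.dispHat (best lam)) (I.costHat (best lam))
          (I.lamAt η best s) := I.lagrangian_lamHat η best t _ _ _
    have h4 : ∑ s ∈ Finset.range (t + 1),
        (I.xiAt η best s + ∑ k, I.lamAt η best s k * v s k) ≤ ∑ s ∈ Finset.range (t + 1),
        I.lagrangian (I.bestXi lam) (I.dispHat (best lam)) (I.costHat (best lam))
          (I.lamAt η best s) :=
      Finset.sum_le_sum fun s _ => I.best_response_le hbest (hfeas s) (I.bestXi_mem hBx _) _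
    rw [e1, e2, one_div_mul_eq_div, one_div_mul_eq_div, div_le_iff₀ ht, add_mul,
      div_mul_cancel₀ _ ht.ne']
    rw [Finset.sum_add_distrib] at h4 ⊢
    have h5 : (I.Blam * Real.log 4 / (η * (t + 1)) + η * r ^ 2 * I.Blam / 2) * ((t : ℝ) + 1) =
        I.Blam * Real.log 4 / η + ((t + 1 : ℕ) : ℝ) * (η * r ^ 2 * I.Blam / 2) := by
      push_cast; field_simp
    rw [h5]
    have h6 : ∑ s ∈ Finset.range (t + 1), ∑ k,
        (I.Blam * Real.exp (I.theta η best s k) / (1 + ∑ k', Real.exp (I.theta η best s k')))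
          * v s k = ∑ s ∈ Finset.range (t + 1), ∑ k, I.lamAt η best s k * v s k := rfl
    rw [h6] at hreg
    linarith
  change max (L - Llow) (Lup - L) ≤ _
  exact max_le (by linarith) (by linarith)

/-- The algorithm stops, with a bound on the number of iterations. -/
theorem exists_stopsAt (hbest : I.IsBestH ℱ best) (hBl : 0 < I.Blam) (hBx : 0 ≤ I.Bxi)
    (hnu : 0 < I.nu) {r : ℝ} (hr0 : 0 < r) (hη : η = I.nu / (2 * r ^ 2 * I.Blam))
    (hr : ∀ (f : ℱ), ∀ ξ ∈ Set.Icc (0 : ℝ) I.Bxi, ∀ k,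
      |I.viol ξ (I.dispHat f) (I.costHat f) k| ≤ r) :
    ∃ t : ℕ, I.StopsAt η best t ∧
      ((t + 1 : ℕ) : ℝ) ≤ 4 * r ^ 2 * I.Blam ^ 2 * Real.log 4 / I.nu ^ 2 + 1 := by
  classical
  have hη0 : 0 < η := by rw [hη]; positivity
  -- With this `η` the second regret term equals `ν/4`, and `X` is the number of rounds at which the
  -- first one equals `ν/2`.
  set X := 4 * r ^ 2 * I.Blam ^ 2 * Real.log 4 / I.nu ^ 2
  have hX : 0 < X := by
    have : 0 < Real.log 4 := Real.log_pos (by norm_num)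
    positivity
  have hfl : X ≤ (⌊X⌋₊ : ℝ) + 1 := (Nat.lt_floor_add_one X).le
  have hgap : I.gap η best ⌊X⌋₊ ≤ I.nu := by
    refine (gap_le hbest hBl.le hBx hη0 hr _).trans ?_
    have h1 : η * r ^ 2 * I.Blam / 2 ≤ I.nu / 2 := by
      rw [hη]
      have : I.nu / (2 * r ^ 2 * I.Blam) * r ^ 2 * I.Blam / 2 = I.nu / 4 := by
        field_simp; norm_num
      rw [this]; linarith
    have h2 : I.Blam * Real.log 4 / (η * ((⌊X⌋₊ : ℝ) + 1)) ≤ I.nu / 2 := by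
      rw [div_le_iff₀ (by positivity)]
      have h3 : I.nu / 2 * (η * X) = I.Blam * Real.log 4 := by
        simp only [X]; rw [hη]; field_simp; norm_num
      rw [← h3]; gcongr
    linarith
  have hex : ∃ t, I.gap η best t ≤ I.nu := ⟨_, hgap⟩
  refine ⟨Nat.find hex, ⟨Nat.find_spec hex, fun s hs => not_le.1 (Nat.find_min hex hs)⟩, ?_⟩
  have h1 : Nat.find hex ≤ ⌊X⌋₊ := Nat.find_min' hex hgap
  have h2 : (⌊X⌋₊ : ℝ) ≤ X := Nat.floor_le hX.le
  push_cast
  have : (Nat.find hex : ℝ) ≤ ⌊X⌋₊ := by exact_mod_cast h1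
  linarith

/-- Quality of an approximate saddle point compared with an empirically feasible `Q`. -/
theorem saddle_guarantee (hbest : I.IsBestH ℱ best) (hBl : 0 < I.Blam) (hBx : 0 ≤ I.Bxi)
    (hd : ∀ f : ℱ, |I.dispHat f| ≤ I.Bxi) {bc : ℝ} (hc : ∀ f : ℱ, |I.costHat f| ≤ bc)
    {t : ℕ} (hgap : I.gap η best t ≤ I.nu) (Q : PMF ℱ) (hQ : I.costHatQ Q ≤ I.epsHat) :
    I.costHatQ (I.QHat η best t) ≤ I.epsHat + (I.Bxi + 2 * I.nu) / I.Blam ∧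
    |I.dispHatQ (I.QHat η best t)| ≤
      |I.dispHatQ Q| + 2 * I.nu + (I.Bxi + 2 * I.nu) / I.Blam := by
  set ξ := I.xiHat η best t
  set d := I.dispHatQ (I.QHat η best t)
  set c := I.costHatQ (I.QHat η best t)
  set lam := I.lamHat η best t
  have hlam : I.Feasible lam := I.lamHat_feasible η best hBl.le t
  have hξ : ξ ∈ Set.Icc 0 I.Bxi := I.xiHat_mem η best hBx t
  obtain ⟨g1, g2⟩ := max_le_iff.1 (show max
    (I.lagrangian ξ d c lam - I.lagrangian (I.bestXi lam) (I.dispHat (best lam))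
      (I.costHat (best lam)) lam)
    (I.lagrangian ξ d c (I.bestLam (I.viol ξ d c)) - I.lagrangian ξ d c lam) ≤ I.nu from hgap)
  -- With slack `e` the comparator `Q` satisfies all three constraints, so its Lagrangian is at most
  -- `e` for any multipliers.
  set e := |I.dispHatQ Q|
  have he : e ∈ Set.Icc 0 I.Bxi := ⟨abs_nonneg _, abs_mix_le Q hd⟩
  have h1 := I.best_response_mix_le hbest hd hc hlam he Q
  have h2 : I.lagrangian e (I.dispHatQ Q) (I.costHatQ Q) lam ≤ e := by
    rw [lagrangian_eq]
    have a0 := mul_le_mul_of_nonneg_left (le_abs_self (I.dispHatQ Q)) (hlam.1 0)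
    have a1 := mul_le_mul_of_nonneg_left (neg_abs_le (I.dispHatQ Q)) (hlam.1 1)
    have a2 := mul_nonpos_of_nonneg_of_nonpos (hlam.1 2) (sub_nonpos.2 hQ)
    simp only [e]; linarith
  have h3 : ∀ l, I.Feasible l → ξ + ∑ k, l k * I.viol ξ d c k ≤ e + 2 * I.nu := by
    intro l hl
    have := I.bestLam_spec (I.viol ξ d c) hl
    have h4 : I.lagrangian ξ d c (I.bestLam (I.viol ξ d c)) =
      ξ + ∑ k, I.bestLam (I.viol ξ d c) k * I.viol ξ d c k := rfl
    linarith
  have hξe : ξ ≤ e + 2 * I.nu := by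
    simpa using h3 0 ⟨fun k => le_rfl, by simpa using hBl.le⟩
  -- All multiplier mass on constraint `k` turns the bound on the Lagrangian into one on the
  -- violation; `e ≤ B_ξ` and `ξ ≥ 0` remove the slacks.
  have hv : ∀ k, I.viol ξ d c k ≤ (I.Bxi + 2 * I.nu) / I.Blam := by
    intro k
    have := h3 (Pi.single k I.Blam) ⟨fun j => by
      by_cases hj : j = k
      · subst hj; simp [hBl.le]
      · simp [hj], by simp⟩
    rw [Finset.sum_eq_single k (fun j _ hj => by simp [hj]) (by simp)] at this
    rw [le_div_iff₀ hBl]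
    simp only [Pi.single_eq_same] at this
    linarith [he.2, hξ.1]
  have v0 := hv 0
  have v1 := hv 1
  have v2 := hv 2
  simp [viol] at v0 v1 v2
  refine ⟨by linarith, abs_le.2 ⟨by linarith, by linarith⟩⟩

end Run

end AlgInput

end

section

/-! ### The loss function -/

/-- A `[0,1]`-valued loss on `[0,1]²` that is 1-Lipschitz in the `ℓ₁`-norm. -/
structure LossBound (l : ℝ → ℝ → ℝ) : Prop where
  mem_Icc : ∀ y ∈ Set.Icc (0 : ℝ) 1, ∀ u ∈ Set.Icc (0 : ℝ) 1, l y u ∈ Set.Icc (0 : ℝ) 1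
  lipschitz : ∀ y ∈ Set.Icc (0 : ℝ) 1, ∀ y' ∈ Set.Icc (0 : ℝ) 1,
    ∀ u ∈ Set.Icc (0 : ℝ) 1, ∀ u' ∈ Set.Icc (0 : ℝ) 1, |l y u - l y' u'| ≤ |y - y'| + |u - u'|

/-- Projection to `[0,1]`. -/
noncomputable def clamp (t : ℝ) : ℝ := Set.projIcc (0 : ℝ) 1 zero_le_one t

theorem clamp_mem (t : ℝ) : clamp t ∈ Set.Icc (0 : ℝ) 1 := (Set.projIcc (0 : ℝ) 1 zero_le_one t).2

theorem clamp_of_mem {t : ℝ} (ht : t ∈ Set.Icc (0 : ℝ) 1) : clamp t = t := by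
  unfold clamp; rw [Set.projIcc_of_mem _ ht]

/-- Nothing is known about `l` off the unit square, so measurability is drawn from its composition
with the projection. -/
theorem LossBound.continuous_clamp {l : ℝ → ℝ → ℝ} (hl : LossBound l) :
    Continuous fun p : ℝ × ℝ => l (clamp p.1) (clamp p.2) := by
  refine (LipschitzWith.of_dist_le_mul (K := 2) fun p q => ?_).continuous
  have h1 : |clamp p.1 - clamp q.1| ≤ |p.1 - q.1| := Set.abs_projIcc_sub_projIcc zero_le_one
  have h2 : |clamp p.2 - clamp q.2| ≤ |p.2 - q.2| := Set.abs_projIcc_sub_projIcc zero_le_one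
  have h3 := hl.lipschitz _ (clamp_mem p.1) _ (clamp_mem q.1) _ (clamp_mem p.2) _ (clamp_mem q.2)
  have h4 : |p.1 - q.1| ≤ dist p q := by rw [← Real.dist_eq]; exact le_max_left _ _
  have h5 : |p.2 - q.2| ≤ dist p q := by rw [← Real.dist_eq]; exact le_max_right _ _
  rw [Real.dist_eq]
  push_cast
  linarith

theorem LossBound.measurable {l : ℝ → ℝ → ℝ} (hl : LossBound l) {Ω : Type*} [MeasurableSpace Ω]
    {y u : Ω → ℝ} (hy : Measurable y) (hu : Measurable u) (hy1 : ∀ o, y o ∈ Set.Icc (0 : ℝ) 1)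
    (hu1 : ∀ o, u o ∈ Set.Icc (0 : ℝ) 1) : Measurable fun o => l (y o) (u o) := by
  have := hl.continuous_clamp.measurable.comp (hy.prodMk hu)
  simpa only [Function.comp_def, clamp_of_mem (hy1 _), clamp_of_mem (hu1 _)] using this

theorem abs_le_one_of_mem {x : ℝ} (h : x ∈ Set.Icc (0 : ℝ) 1) : |x| ≤ 1 := by
  rw [abs_of_nonneg h.1]; exact h.2

/-! ### Discretization -/

theorem lowerY_spec (N : ℕ) (cover : Finset ℝ) (y : ℝ)
    (h : ∃ t ∈ cover, |y - t| ≤ 1 / (2 * (N : ℝ))) :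
    lowerY N cover y ∈ cover ∧ |y - lowerY N cover y| ≤ 1 / (2 * (N : ℝ)) := by
  have hfin : {t : ℝ | t ∈ cover ∧ |y - t| ≤ 1 / (2 * (N : ℝ))}.Finite :=
    cover.finite_toSet.subset fun t ht => ht.1
  exact Set.Nonempty.csInf_mem (s := {t : ℝ | t ∈ cover ∧ |y - t| ≤ 1 / (2 * (N : ℝ))})
    (by obtain ⟨t, h1, h2⟩ := h; exact ⟨t, h1, h2⟩) hfin

theorem grid_half_bounds {N j : ℕ} (hN : 1 ≤ N) (hj1 : 1 ≤ j) (hjN : j ≤ N) :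
    (j : ℝ) / N ∈ Set.Icc (0 : ℝ) 1 ∧ 0 ≤ (j : ℝ) / N - 1 / (2 * (N : ℝ)) := by
  have hN' : (0 : ℝ) < N := by exact_mod_cast hN
  have hj : (1 : ℝ) ≤ j := by exact_mod_cast hj1
  have hj' : (j : ℝ) ≤ N := by exact_mod_cast hjN
  refine ⟨⟨by positivity, (div_le_one hN').2 hj'⟩, ?_⟩
  rw [div_sub_div _ _ hN'.ne' (by positivity)]
  apply div_nonneg _ (by positivity)
  nlinarith

/-- The two predictions are at most `1/N` apart, so the Lipschitz bound cancels the factor `N`. -/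
theorem LossBound.abs_costWeight_le {l : ℝ → ℝ → ℝ} (hl : LossBound l) {N j : ℕ} (hN : 1 ≤ N)
    (hj1 : 1 ≤ j) (hjN : j ≤ N) {y : ℝ} (hy : y ∈ Set.Icc (0 : ℝ) 1) :
    |costWeight l N y ((j : ℝ) / N)| ≤ 1 := by
  have hN' : (0 : ℝ) < N := by exact_mod_cast hN
  obtain ⟨hz, h0⟩ := grid_half_bounds hN hj1 hjN
  set z := (j : ℝ) / N
  set a := 1 / (2 * (N : ℝ)) with ha
  have ha0 : 0 < a := by positivity
  have h1 : min (z + a) 1 ∈ Set.Icc (0 : ℝ) 1 :=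
    ⟨le_min (by linarith [hz.1]) zero_le_one, min_le_right _ _⟩
  have h2 : z - a ∈ Set.Icc (0 : ℝ) 1 := ⟨h0, by linarith [hz.2]⟩
  have h3 := hl.lipschitz y hy y hy _ h1 _ h2
  rw [sub_self, abs_zero, zero_add] at h3
  have h4 : |min (z + a) 1 - (z - a)| ≤ 2 * a := by
    rw [abs_of_nonneg]
    · linarith [min_le_left (z + a) 1]
    · have : z - a ≤ min (z + a) 1 := le_min (by linarith) h2.2
      linarith
  have h5 : (N : ℝ) * (2 * a) = 1 := by rw [ha]; field_simp
  unfold costWeight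
  rw [abs_mul, abs_of_pos hN']
  exact (mul_le_mul_of_nonneg_left (h3.trans h4) hN'.le).trans h5.le

variable {𝒳 : Type*}

/-- Cutoff `j/N` is passed exactly when `j ≤ ⌊N f(x)⌋`, so the classifiers truncate the sum. -/
theorem sum_mul_thr_grid {N : ℕ} (hN : 1 ≤ N) (f : 𝒳 → ℝ) (x : 𝒳)
    (hf : f x ∈ Set.Icc (0 : ℝ) 1) (a : ℕ → ℝ) :
    ∑ j ∈ Finset.Icc 1 N, a j * thr f x ((j : ℝ) / N) = ∑ j ∈ Finset.Icc 1 ⌊N * f x⌋₊, a j := by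
  have hN' : (0 : ℝ) < N := by exact_mod_cast hN
  have h0 : 0 ≤ N * f x := mul_nonneg hN'.le hf.1
  have hM : ⌊N * f x⌋₊ ≤ N := by
    have : N * f x ≤ N := by nlinarith [hf.2]
    exact (Nat.floor_mono this).trans (Nat.floor_natCast N).le
  have h1 : ∀ j : ℕ, a j * thr f x ((j : ℝ) / N) = if j ≤ ⌊N * f x⌋₊ then a j else 0 := by
    intro j
    have : (j : ℝ) / N ≤ f x ↔ j ≤ ⌊N * f x⌋₊ := by
      rw [Nat.le_floor_iff h0, div_le_iff₀ hN', mul_comm]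
    unfold thr
    simp only [this]
    split_ifs <;> simp
  simp only [h1]
  rw [← Finset.sum_filter]
  congr 1
  ext j
  simp only [Finset.mem_filter, Finset.mem_Icc]
  omega

theorem abs_grid_mean_sub_le {N : ℕ} (hN : 1 ≤ N) (f : 𝒳 → ℝ) (x : 𝒳)
    (hf : f x ∈ Set.Icc (0 : ℝ) 1) :
    |(1 / (N : ℝ)) * ∑ j ∈ Finset.Icc 1 N, thr f x ((j : ℝ) / N) - f x| ≤ 1 / N := by
  have hN' : (0 : ℝ) < N := by exact_mod_cast hN
  have h := sum_mul_thr_grid hN f x hf fun _ => 1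
  simp only [one_mul] at h
  rw [h]
  simp only [Finset.sum_const, Nat.card_Icc, nsmul_eq_mul, mul_one, Nat.add_sub_cancel]
  have h1 := Nat.floor_le (mul_nonneg hN'.le hf.1)
  have h2 := Nat.lt_floor_add_one (N * f x)
  have h3 : (1 / (N : ℝ)) * ⌊N * f x⌋₊ - f x = (⌊N * f x⌋₊ - N * f x) / N := by field_simp
  rw [h3, abs_div, abs_of_pos hN']
  gcongr
  rw [abs_le]; constructor <;> linarith

/-- The discretized loss differs from the loss by at most half a grid step. -/
theorem LossBound.abs_discretized_sub_le {l : ℝ → ℝ → ℝ} (hl : LossBound l) {N : ℕ} (hN : 1 ≤ N)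
    (f : 𝒳 → ℝ) (x : 𝒳) (hf : f x ∈ Set.Icc (0 : ℝ) 1) {y : ℝ} (hy : y ∈ Set.Icc (0 : ℝ) 1) :
    |l y (1 / (2 * (N : ℝ))) + (1 / (N : ℝ)) * ∑ j ∈ Finset.Icc 1 N,
      costWeight l N y ((j : ℝ) / N) * thr f x ((j : ℝ) / N) - l y (f x)| ≤
      1 / (2 * (N : ℝ)) := by
  have hN' : (0 : ℝ) < N := by exact_mod_cast hN
  have hN1 : (1 : ℝ) ≤ N := by exact_mod_cast hN
  set a := 1 / (2 * (N : ℝ)) with ha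
  have ha0 : 0 < a := by positivity
  have ha1 : 2 * a = 1 / N := by rw [ha]; field_simp
  have haN : 2 * a ≤ 1 := by rw [ha1]; exact (div_le_one hN').2 hN1
  set q : ℕ → ℝ := fun j => l y (min ((j : ℝ) / N + a) 1)
  set M := ⌊N * f x⌋₊
  have h1 := Nat.floor_le (mul_nonneg hN'.le hf.1)
  have h2 := Nat.lt_floor_add_one (N * f x)
  have hM : M ≤ N := by
    have : N * f x ≤ N := by nlinarith [hf.2]
    exact (Nat.floor_mono this).trans (Nat.floor_natCast N).le
  -- The costs telescope to the loss at the midpoint of the grid cell containing `f(x)`. The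
  -- truncation at 1 is active only at `j = N`, whose upper endpoint is never reused.
  have htel : ∀ K ≤ N, (1 / (N : ℝ)) * ∑ j ∈ Finset.Icc 1 K, costWeight l N y ((j : ℝ) / N) =
      q K - q 0 := by
    intro K
    induction K with
    | zero => simp
    | succ K ih =>
      intro hK
      rw [Finset.sum_Icc_succ_top (by omega), mul_add, ih (by omega)]
      have hKN : ((K + 1 : ℕ) : ℝ) / N ≤ 1 := (div_le_one hN').2 (by exact_mod_cast hK)
      have h3 : ((K + 1 : ℕ) : ℝ) / N - a = (K : ℝ) / N + a := by
        push_cast; rw [add_div, ← ha1]; ring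
      have h4 : min ((K : ℝ) / N + a) 1 = (K : ℝ) / N + a := min_eq_left (by linarith)
      simp only [q, costWeight, ← ha]
      rw [h3, h4, ← mul_assoc, one_div_mul_cancel hN'.ne']
      ring
  have hq0 : q 0 = l y a := by simp only [q]; congr 1; simp; linarith
  rw [sum_mul_thr_grid hN f x hf, htel M hM, hq0]
  have h5 : l y a + (q M - l y a) - l y (f x) = q M - l y (f x) := by ring
  rw [h5]
  have hMd : (M : ℝ) / N ≤ f x := by rw [div_le_iff₀ hN']; linarith
  have hMu : f x ≤ (M : ℝ) / N + 2 * a := by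
    rw [ha1, ← add_div, le_div_iff₀ hN']; linarith
  have hM0 : (0 : ℝ) ≤ (M : ℝ) / N := by positivity
  have h6 : min ((M : ℝ) / N + a) 1 ∈ Set.Icc (0 : ℝ) 1 :=
    ⟨le_min (by linarith) zero_le_one, min_le_right _ _⟩
  refine (hl.lipschitz y hy y hy _ h6 _ hf).trans ?_
  rw [sub_self, abs_zero, zero_add, abs_le]
  constructor
  · have : f x - a ≤ min ((M : ℝ) / N + a) 1 := le_min (by linarith) (by linarith [hf.2])
    linarith
  · linarith [min_le_left ((M : ℝ) / N + a) 1]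

theorem abs_mean_le {n : ℕ} {v : Fin n → ℝ} {e : ℝ} (he : 0 ≤ e) (h : ∀ i, |v i| ≤ e) :
    |(1 / (n : ℝ)) * ∑ i, v i| ≤ e := by
  rw [abs_mul, abs_of_nonneg (by positivity)]
  have h1 : |∑ i, v i| ≤ n * e := by
    refine (Finset.abs_sum_le_sum_abs _ _).trans ?_
    calc _ ≤ ∑ i : Fin n, e := Finset.sum_le_sum fun i _ => h i
      _ = n * e := by simp
  rcases Nat.eq_zero_or_pos n with h0 | h0
  · subst h0; simpa using he
  · have : (0 : ℝ) < n := by exact_mod_cast h0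
    rw [one_div_mul_eq_div, div_le_iff₀ this, mul_comm e]; exact h1

theorem abs_mean_grid_le {N : ℕ} {v : ℕ → ℝ} {e : ℝ} (hN : 1 ≤ N)
    (h : ∀ j ∈ Finset.Icc 1 N, |v j| ≤ e) :
    |(1 / (N : ℝ)) * ∑ j ∈ Finset.Icc 1 N, v j| ≤ e := by
  have hN' : (0 : ℝ) < N := by exact_mod_cast hN
  rw [abs_mul, abs_of_nonneg (by positivity), one_div_mul_eq_div, div_le_iff₀ hN', mul_comm e]
  refine (Finset.abs_sum_le_sum_abs _ _).trans ((Finset.sum_le_sum h).trans ?_)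
  simp

/-! ### Bounds on the empirical quantities -/

/-- The data of the algorithm lie in the unit interval and are covered. -/
structure AlgInput.Regular {n : ℕ} (I : AlgInput 𝒳 n) (ℱ : Set (𝒳 → ℝ)) : Prop where
  one_le_N : 1 ≤ I.N
  loss : LossBound I.l
  outcome : ∀ i, (I.data i).2.2 ∈ Set.Icc (0 : ℝ) 1
  cover_mem : ∀ t ∈ I.cover, t ∈ Set.Icc (0 : ℝ) 1
  covered : ∀ i, ∃ t ∈ I.cover, |(I.data i).2.2 - t| ≤ 1 / (2 * (I.N : ℝ))
  weight : ∀ x, ∀ m ∈ Set.Icc (0 : ℝ) 1, 0 ≤ I.g x m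
  disp : ∀ u ∈ Set.Icc (0 : ℝ) 1, ∀ v ∈ Set.Icc (0 : ℝ) 1, |I.β 0 * u + I.β 1 * v| ≤ I.Bxi
  pred : ∀ f ∈ ℱ, ∀ x, f x ∈ Set.Icc (0 : ℝ) 1

namespace AlgInput

variable {n : ℕ} {I : AlgInput 𝒳 n} {ℱ : Set (𝒳 → ℝ)}

theorem Regular.lowerY_mem (h : I.Regular ℱ) (i : Fin n) :
    lowerY I.N I.cover (I.data i).2.2 ∈ Set.Icc (0 : ℝ) 1 :=
  h.cover_mem _ (lowerY_spec _ _ _ (h.covered i)).1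

theorem Regular.abs_costHat_le (h : I.Regular ℱ) (f : 𝒳 → ℝ) : |I.costHat f| ≤ 1 := by
  refine abs_mean_le zero_le_one fun i => abs_mean_grid_le h.one_le_N fun j hj => ?_
  rw [Finset.mem_Icc] at hj
  rw [abs_mul]
  exact mul_le_one₀ (h.loss.abs_costWeight_le h.one_le_N hj.1 hj.2 (h.lowerY_mem i))
    (abs_nonneg _) (abs_thr_le _ _ _)

/-- Half a grid step comes from discretizing the prediction and half from replacing the outcome by
its cover element. -/
theorem Regular.abs_cost_sub_loss_le (h : I.Regular ℱ) {f : 𝒳 → ℝ} (hf : f ∈ ℱ) :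
    |I.costHat f + c0Hat I.l I.N I.cover I.data -
      (1 / (n : ℝ)) * ∑ i, I.l (I.data i).2.2 (f (I.data i).1)| ≤ 1 / I.N := by
  have hN' : (0 : ℝ) < I.N := by exact_mod_cast h.one_le_N
  have e : I.costHat f + c0Hat I.l I.N I.cover I.data -
      (1 / (n : ℝ)) * ∑ i, I.l (I.data i).2.2 (f (I.data i).1) =
      (1 / (n : ℝ)) * ∑ i, (I.l (lowerY I.N I.cover (I.data i).2.2) (1 / (2 * (I.N : ℝ))) +
        (1 / (I.N : ℝ)) * ∑ j ∈ Finset.Icc 1 I.N,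
          costWeight I.l I.N (lowerY I.N I.cover (I.data i).2.2) ((j : ℝ) / I.N) *
            thr f (I.data i).1 ((j : ℝ) / I.N) - I.l (I.data i).2.2 (f (I.data i).1)) := by
    unfold costHat c0Hat
    rw [Finset.sum_sub_distrib, Finset.sum_add_distrib]; ring
  rw [e]
  refine abs_mean_le (by positivity) fun i => ?_
  have h1 := h.loss.abs_discretized_sub_le h.one_le_N f (I.data i).1 (h.pred f hf _)
    (h.lowerY_mem i)
  have h2 := h.loss.lipschitz _ (h.lowerY_mem i) _ (h.outcome i) _ (h.pred f hf (I.data i).1) _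
    (h.pred f hf (I.data i).1)
  have h3 := (lowerY_spec _ _ _ (h.covered i)).2
  rw [sub_self, abs_zero, add_zero, abs_sub_comm (lowerY _ _ _)] at h2
  have h4 : 1 / (I.N : ℝ) = 1 / (2 * (I.N : ℝ)) + 1 / (2 * (I.N : ℝ)) := by field_simp; norm_num
  rw [h4]
  refine le_trans ?_ (add_le_add h1 (h2.trans h3))
  refine le_trans (le_of_eq ?_) (abs_add_le _ _)
  congr 1; ring

theorem Regular.gridThr_mem (h : I.Regular ℱ) (f : 𝒳 → ℝ) (x : 𝒳) :
    I.gridThr f x ∈ Set.Icc (0 : ℝ) 1 := by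
  refine ⟨mul_nonneg (by positivity) (Finset.sum_nonneg fun j _ => thr_nonneg _ _ _), ?_⟩
  exact (le_abs_self _).trans (abs_mean_grid_le h.one_le_N fun j _ => abs_thr_le _ _ _)

theorem Regular.groupWeight_nonneg (h : I.Regular ℱ) (a : Fin 2) (i : Fin n) :
    0 ≤ I.groupWeight a i :=
  Set.indicator_nonneg (fun _ _ => h.weight _ _ (h.outcome i)) _

/-- An empty group causes no exception: division by zero gives 0. Hence termination needs no
condition on the sample. -/
theorem Regular.ratio_mem (h : I.Regular ℱ) (f : 𝒳 → ℝ) (a : Fin 2) :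
    (∑ i, I.groupWeight a i * I.gridThr f (I.data i).1) / ∑ i, I.groupWeight a i ∈
      Set.Icc (0 : ℝ) 1 := by
  have h0 : 0 ≤ ∑ i, I.groupWeight a i := Finset.sum_nonneg fun i _ => h.groupWeight_nonneg a i
  refine ⟨div_nonneg (Finset.sum_nonneg fun i _ => mul_nonneg (h.groupWeight_nonneg a i)
    (h.gridThr_mem f _).1) h0, div_le_one_of_le₀ (Finset.sum_le_sum fun i _ => ?_) h0⟩
  exact mul_le_of_le_one_right (h.groupWeight_nonneg a i) (h.gridThr_mem f _).2

theorem Regular.abs_dispHat_le (h : I.Regular ℱ) (f : 𝒳 → ℝ) : |I.dispHat f| ≤ I.Bxi := by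
  unfold dispHat
  rw [Fin.sum_univ_two]
  exact h.disp _ (h.ratio_mem f 0) _ (h.ratio_mem f 1)

theorem Regular.abs_viol_le (h : I.Regular ℱ) (f : 𝒳 → ℝ) {ξ : ℝ} (hξ : ξ ∈ Set.Icc (0 : ℝ) I.Bxi)
    (k : Fin 3) :
    |I.viol ξ (I.dispHat f) (I.costHat f) k| ≤ 2 * I.Bxi + 1 + |I.epsHat| := by
  have hd := abs_le.1 (h.abs_dispHat_le f)
  have hc := h.abs_costHat_le f
  have he := abs_nonneg I.epsHat
  obtain ⟨h0, h1⟩ := hξ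
  fin_cases k <;> simp [viol]
  · rw [abs_le]; constructor <;> linarith
  · rw [abs_le]; constructor <;> linarith
  · have := abs_sub (I.costHat f) I.epsHat
    linarith

theorem Regular.bddAbove_viol (h : I.Regular ℱ) : BddAbove (Set.range
    fun p : ℱ × Set.Icc (0 : ℝ) I.Bxi × Fin 3 =>
      |I.viol p.2.1 (I.dispHat p.1) (I.costHat p.1) p.2.2|) := by
  refine ⟨2 * I.Bxi + 1 + |I.epsHat|, ?_⟩
  rintro _ ⟨p, rfl⟩
  exact h.abs_viol_le _ p.2.1.2 _

theorem Regular.abs_viol_le_rho (h : I.Regular ℱ) (f : ℱ) (ξ : ℝ)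
    (hξ : ξ ∈ Set.Icc (0 : ℝ) I.Bxi) (k : Fin 3) :
    |I.viol ξ (I.dispHat f) (I.costHat f) k| ≤ I.rho ℱ :=
  le_ciSup h.bddAbove_viol (f, ⟨ξ, hξ⟩, k)

theorem Regular.rho_le (h : I.Regular ℱ) (f : ℱ) (hB : 0 ≤ I.Bxi) :
    I.rho ℱ ≤ 2 * I.Bxi + 1 + |I.epsHat| := by
  have : Nonempty (ℱ × Set.Icc (0 : ℝ) I.Bxi × Fin 3) := ⟨(f, ⟨0, le_rfl, hB⟩, 0)⟩
  exact ciSup_le fun p => h.abs_viol_le _ p.2.1.2 _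

/-- The first constraint at the two extreme slacks differs by `B_ξ`, so `ρ ≥ B_ξ / 2`; the learning
rate is then well defined. -/
theorem Regular.rho_pos (h : I.Regular ℱ) (f : ℱ) (hB : 0 < I.Bxi) : 0 < I.rho ℱ := by
  have h0 := (abs_le.1 (h.abs_viol_le_rho f 0 ⟨le_rfl, hB.le⟩ 0)).2
  have h1 := (abs_le.1 (h.abs_viol_le_rho f I.Bxi ⟨hB.le, le_rfl⟩ 0)).1
  simp [viol] at h0 h1
  linarith

end AlgInput

end

section

variable {𝒳 : Type*} [MeasurableSpace 𝒳]

/-! ### Deviations on the whole grid -/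

/-- At every grid point and uniformly over `ℱ`, weighted sample means of the threshold
classifiers are within `D` of their expectations. -/
def GridDev {ι : Type*} [Fintype ι] (ℱ : Set (𝒳 → ℝ)) (N : ℕ) (w : ℕ → Obs 𝒳 → ℝ)
    (ν : Measure (Obs 𝒳)) (D : ℝ) (s : ι → Obs 𝒳) : Prop :=
  ∀ j ≤ N, ∀ f ∈ ℱ,
    |(1 / (Fintype.card ι : ℝ)) * ∑ i, w j (s i) * thr f (featX (s i)) ((j : ℝ) / N) -
      ∫ o, w j o * thr f (featX o) ((j : ℝ) / N) ∂ν| ≤ D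

/-- Union bound over `N + 1` cutoffs. Index 0 is included because for predictions in `[0,1]` the
classifier at cutoff 0 is identically 1, so the same event controls the mean of the weight itself.
-/
theorem measure_not_gridDev_le {ι : Type*} [Fintype ι] [DecidableEq ι] [Nonempty ι]
    (ℱ : Set (𝒳 → ℝ)) (hℱ : ∀ f ∈ ℱ, Measurable f)
    (hℱm : PointwiseMeasurable ℱ) (C φ : ℝ) (hφ : φ ≤ 1 / 2)
    (hR : ∀ m : ℕ, 1 ≤ m → rademacher (thrClass ℱ) m ≤ C * (m : ℝ) ^ (-φ))
    (ν : Measure (Obs 𝒳)) [IsProbabilityMeasure ν] (N : ℕ) (w : ℕ → Obs 𝒳 → ℝ)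
    (hw : ∀ j ≤ N, Measurable (w j)) (hw1 : ∀ j ≤ N, ∀ o, |w j o| ≤ 1)
    (δ : ℝ) (hδ0 : 0 < δ) (hδ1 : δ ≤ 1) :
    (Measure.pi fun _ : ι => ν) {s | ¬ GridDev ℱ N w ν
      ((2 * C + √(8 * Real.log (1 / (δ / (N + 1))))) * (Fintype.card ι : ℝ) ^ (-φ)) s} ≤
      ENNReal.ofReal δ := by
  set D := (2 * C + √(8 * Real.log (1 / (δ / (N + 1))))) * (Fintype.card ι : ℝ) ^ (-φ)
  have hN : (0 : ℝ) < (N : ℝ) + 1 := by positivity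
  have hsub : {s : ι → Obs 𝒳 | ¬ GridDev ℱ N w ν D s} ⊆ ⋃ j ∈ Finset.range (N + 1),
      {s | ∃ f ∈ ℱ, D <
    |(1 / (Fintype.card ι : ℝ)) * ∑ i, w j (s i) * thr f (featX (s i)) ((j : ℝ) / N) -
      ∫ o, w j o * thr f (featX o) ((j : ℝ) / N) ∂ν|} := by
    intro s hs
    simp only [GridDev, Set.mem_ofPred_eq] at hs
    push Not at hs
    obtain ⟨j, hj, f, hf, hlt⟩ := hs
    exact Set.mem_biUnion (Finset.mem_coe.2 (Finset.mem_range.2 (by omega))) ⟨f, hf, hlt⟩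
  refine (measure_mono hsub).trans ((measure_biUnion_finset_le _ _).trans ?_)
  calc _ ≤ ∑ j ∈ Finset.range (N + 1), ENNReal.ofReal (δ / (N + 1)) := by
        refine Finset.sum_le_sum fun j hj => ?_
        have hj' : j ≤ N := by have := Finset.mem_range.1 hj; omega
        refine measure_thr_mean_deviation ℱ hℱ hℱm C φ hφ hR ν (w j) (hw j hj') (hw1 j hj') _
          ⟨by positivity, div_le_one_of_le₀ (by exact_mod_cast hj') (by positivity)⟩ _
          (by positivity) ?_
        exact (div_le_self hδ0.le (by linarith [(Nat.cast_nonneg N : (0 : ℝ) ≤ N)])).trans hδ1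
    _ = ENNReal.ofReal δ := by
        rw [Finset.sum_const, Finset.card_range, nsmul_eq_mul, ← ENNReal.ofReal_natCast,
          ← ENNReal.ofReal_mul (by positivity)]
        congr 1
        push_cast; field_simp

theorem integrable_mul_thr (ν : Measure (Obs 𝒳)) [IsFiniteMeasure ν] {w : Obs 𝒳 → ℝ}
    (hw : Measurable w) (hw1 : ∀ o, |w o| ≤ 1) {f : 𝒳 → ℝ} (hf : Measurable f) (z : ℝ) :
    Integrable (fun o => w o * thr f (featX o) z) ν := by
  refine Integrable.of_bound
    (hw.mul ((measurable_thr hf z).comp measurable_featX)).aestronglyMeasurable 1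
    (ae_of_all _ fun o => ?_)
  rw [Real.norm_eq_abs, abs_mul]
  exact mul_le_one₀ (hw1 o) (abs_nonneg _) (abs_thr_le _ _ _)

theorem abs_integral_sub_le {Ω : Type*} [MeasurableSpace Ω] (ν : Measure Ω) [IsProbabilityMeasure ν]
    {u v : Ω → ℝ} (hu : Integrable u ν) (hv : Integrable v ν) {e : ℝ} (h : ∀ o, |u o - v o| ≤ e) :
    |∫ o, u o ∂ν - ∫ o, v o ∂ν| ≤ e := by
  rw [← integral_sub hu hv]
  have := norm_integral_le_of_norm_le_const (μ := ν) (f := fun o => u o - v o) (C := e)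
    (ae_of_all _ fun o => h o)
  simpa using this

theorem thr_zero {f : 𝒳 → ℝ} {x : 𝒳} (hf : f x ∈ Set.Icc (0 : ℝ) 1) (N : ℕ) :
    thr f x (((0 : ℕ) : ℝ) / N) = 1 := by
  simp [thr, hf.1]

/-! ### The loss -/

/-- Weights of the threshold classifiers in the discretized loss. -/
noncomputable def lossWeight (l : ℝ → ℝ → ℝ) (N : ℕ) (μ : 𝒳 → ℝ) (j : ℕ) (o : Obs 𝒳) : ℝ :=
  -- The constant term of the discretized loss is stored at cutoff 0.
  if j = 0 then l (μ (featX o)) (1 / (2 * (N : ℝ)))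
  else costWeight l N (μ (featX o)) ((j : ℝ) / N)

theorem half_grid_mem {N : ℕ} (hN : 1 ≤ N) : 1 / (2 * (N : ℝ)) ∈ Set.Icc (0 : ℝ) 1 := by
  have hN' : (1 : ℝ) ≤ N := by exact_mod_cast hN
  refine ⟨by positivity, ?_⟩
  rw [div_le_one (by positivity)]; linarith

theorem abs_lossWeight_le {l : ℝ → ℝ → ℝ} (hl : LossBound l) {N : ℕ} (hN : 1 ≤ N) {μ : 𝒳 → ℝ}
    (hμ1 : ∀ x, μ x ∈ Set.Icc (0 : ℝ) 1) (j : ℕ) (hj : j ≤ N) (o : Obs 𝒳) : |lossWeight l N μ j o| ≤ 1 := by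
  unfold lossWeight
  split_ifs with h
  · exact abs_le_one_of_mem (hl.mem_Icc _ (hμ1 _) _ (half_grid_mem hN))
  · exact hl.abs_costWeight_le hN (by omega) hj (hμ1 _)

theorem measurable_lossWeight {l : ℝ → ℝ → ℝ} (hl : LossBound l) {N : ℕ} (hN : 1 ≤ N) {μ : 𝒳 → ℝ}
    (hμ : Measurable μ) (hμ1 : ∀ x, μ x ∈ Set.Icc (0 : ℝ) 1)
    (j : ℕ) (hj : j ≤ N) : Measurable (lossWeight l N μ j) := by
  have hm : ∀ u ∈ Set.Icc (0 : ℝ) 1, Measurable fun o : Obs 𝒳 => l (μ (featX o)) u := fun u hu =>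
    hl.measurable (hμ.comp measurable_featX) measurable_const (fun _ => hμ1 _) (fun _ => hu)
  unfold lossWeight
  split_ifs with h
  · exact hm _ (half_grid_mem hN)
  · obtain ⟨hz, h0⟩ := grid_half_bounds hN (Nat.one_le_iff_ne_zero.2 h) hj
    have ha := (half_grid_mem hN).1
    refine Measurable.const_mul (Measurable.sub (hm _ ⟨le_min ?_ zero_le_one, min_le_right _ _⟩)
      (hm _ ⟨h0, ?_⟩)) _
    · linarith [hz.1]
    · linarith [hz.2]

theorem abs_lossMu_le {l : ℝ → ℝ → ℝ} (hl : LossBound l) {μ : 𝒳 → ℝ}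
    (hμ1 : ∀ x, μ x ∈ Set.Icc (0 : ℝ) 1)
    (P : Measure (Obs 𝒳)) [IsProbabilityMeasure P] {f : 𝒳 → ℝ}
    (hf1 : ∀ x, f x ∈ Set.Icc (0 : ℝ) 1) : |lossMu P μ l f| ≤ 1 := by
  have := norm_integral_le_of_norm_le_const (μ := P)
    (f := fun o => l (μ (featX o)) (f (featX o))) (C := 1)
    (ae_of_all _ fun o => abs_le_one_of_mem (hl.mem_Icc _ (hμ1 _) _ (hf1 _)))
  simpa [lossMu] using this

/-- Passage through the discretized loss costs half a grid step in the sample and half in the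
population; the constant term and the average over cutoffs cost `D` each. -/
theorem abs_loss_mean_sub_le {l : ℝ → ℝ → ℝ} (hl : LossBound l) {N : ℕ} (hN : 1 ≤ N) {μ : 𝒳 → ℝ}
    (hμ : Measurable μ) (hμ1 : ∀ x, μ x ∈ Set.Icc (0 : ℝ) 1)
    (P : Measure (Obs 𝒳)) [IsProbabilityMeasure P] {ℱ : Set (𝒳 → ℝ)}
    {n : ℕ} {D : ℝ} {s : Fin n → Obs 𝒳} (hs : GridDev ℱ N (lossWeight l N μ) P D s) {f : 𝒳 → ℝ} (hf : f ∈ ℱ) (hfm : Measurable f)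
    (hf1 : ∀ x, f x ∈ Set.Icc (0 : ℝ) 1) :
    |(1 / (n : ℝ)) * ∑ i, l (μ (featX (s i))) (f (featX (s i))) - lossMu P μ l f| ≤
      2 * D + 1 / N := by
  have hN' : (0 : ℝ) < N := by exact_mod_cast hN
  set t : ℕ → Obs 𝒳 → ℝ := fun j o => lossWeight l N μ j o * thr f (featX o) ((j : ℝ) / N)
  have hti : ∀ j ≤ N, Integrable (t j) P := fun j hj =>
    integrable_mul_thr P (measurable_lossWeight hl hN hμ hμ1 j hj)
      (abs_lossWeight_le hl hN hμ1 j hj) hfm _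
  set disc : Obs 𝒳 → ℝ := fun o => t 0 o + (1 / (N : ℝ)) * ∑ j ∈ Finset.Icc 1 N, t j o
  have hdisc : ∀ o, |disc o - l (μ (featX o)) (f (featX o))| ≤ 1 / (2 * (N : ℝ)) := by
    intro o
    refine le_trans (le_of_eq ?_) (hl.abs_discretized_sub_le hN f (featX o) (hf1 _) (hμ1 (featX o)))
    simp only [disc, t]
    rw [thr_zero (hf1 _), mul_one]
    congr 4
    refine Finset.sum_congr rfl fun j hj => ?_
    have : j ≠ 0 := by have := (Finset.mem_Icc.1 hj).1; omega
    simp [lossWeight, this]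
  have hint : ∀ j ∈ Finset.Icc 1 N, Integrable (t j) P := fun j hj =>
    hti j (Finset.mem_Icc.1 hj).2
  have hdi : Integrable disc P :=
    (hti 0 (Nat.zero_le _)).add ((integrable_finsetSum _ hint).const_mul _)
  have hdI : ∫ o, disc o ∂P = ∫ o, t 0 o ∂P +
      (1 / (N : ℝ)) * ∑ j ∈ Finset.Icc 1 N, ∫ o, t j o ∂P := by
    simp only [disc]
    rw [integral_add (hti 0 (Nat.zero_le _)) ((integrable_finsetSum _ hint).const_mul _),
      integral_const_mul, integral_finsetSum _ hint]
  have hli : Integrable (fun o => l (μ (featX o)) (f (featX o))) P :=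
    Integrable.of_bound (hl.measurable (hμ.comp measurable_featX) (hfm.comp measurable_featX)
      (fun _ => hμ1 _) (fun _ => hf1 _)).aestronglyMeasurable 1
      (ae_of_all _ fun o => abs_le_one_of_mem (hl.mem_Icc _ (hμ1 _) _ (hf1 _)))
  have h1 : |∫ o, disc o ∂P - lossMu P μ l f| ≤ 1 / (2 * (N : ℝ)) :=
    abs_integral_sub_le P hdi hli hdisc
  have h2 : |(1 / (n : ℝ)) * ∑ i, disc (s i) -
      (1 / (n : ℝ)) * ∑ i, l (μ (featX (s i))) (f (featX (s i)))| ≤ 1 / (2 * (N : ℝ)) := by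
    rw [← mul_sub, ← Finset.sum_sub_distrib]
    exact abs_mean_le (by positivity) fun i => hdisc _
  have hdev : ∀ j ≤ N, |(1 / (n : ℝ)) * ∑ i, t j (s i) - ∫ o, t j o ∂P| ≤ D := fun j hj => by
    have := hs j hj f hf
    rwa [Fintype.card_fin] at this
  have h3 : |(1 / (n : ℝ)) * ∑ i, disc (s i) - ∫ o, disc o ∂P| ≤ 2 * D := by
    have e : (1 / (n : ℝ)) * ∑ i, disc (s i) - ∫ o, disc o ∂P =
        ((1 / (n : ℝ)) * ∑ i, t 0 (s i) - ∫ o, t 0 o ∂P) + (1 / (N : ℝ)) *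
          ∑ j ∈ Finset.Icc 1 N, ((1 / (n : ℝ)) * ∑ i, t j (s i) - ∫ o, t j o ∂P) := by
      rw [hdI, Finset.sum_sub_distrib, ← Finset.mul_sum, Finset.sum_comm]
      simp only [disc]
      rw [Finset.sum_add_distrib, ← Finset.mul_sum]; ring
    rw [e]
    refine (abs_add_le _ _).trans ?_
    have a := abs_mean_grid_le hN (v := fun j => (1 / (n : ℝ)) * ∑ i, t j (s i) - ∫ o, t j o ∂P)
      fun j hj => hdev j (Finset.mem_Icc.1 hj).2
    linarith [hdev 0 (Nat.zero_le _)]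
  have h4 : 1 / (N : ℝ) = 1 / (2 * (N : ℝ)) + 1 / (2 * (N : ℝ)) := by field_simp; norm_num
  rw [h4]
  rw [abs_le] at *
  constructor <;> linarith [h1.1, h1.2, h2.1, h2.2, h3.1, h3.2]

/-! ### The disparity -/

/-- The error is `((A - A') + (A/B)(B' - B)) / B'` with `A/B ≤ 1`, so only the population
denominator has to be bounded below; the empirical one may even vanish. -/
theorem abs_div_sub_div_le {A B A' B' e₁ e₂ ω : ℝ} (hA : 0 ≤ A) (hAB : A ≤ B)
    (hω : 0 < ω) (hB' : ω ≤ B') (h1 : |A - A'| ≤ e₁) (h2 : |B - B'| ≤ e₂) :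
    |A / B - A' / B'| ≤ (e₁ + e₂) / ω := by
  have hB'0 : 0 < B' := hω.trans_le hB'
  have e : A / B - A' / B' = ((A - A') + (A / B) * (B' - B)) / B' := by
    rcases eq_or_ne B 0 with h0 | h0
    · have : A = 0 := le_antisymm (by rw [← h0]; exact hAB) hA
      subst this; simp; ring
    · field_simp; ring
  have hr : |A / B| ≤ 1 := by
    rw [abs_of_nonneg (div_nonneg hA (hA.trans hAB))]
    exact div_le_one_of_le₀ hAB (hA.trans hAB)
  have he : 0 ≤ e₁ + e₂ := add_nonneg ((abs_nonneg _).trans h1) ((abs_nonneg _).trans h2)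
  rw [e, abs_div, abs_of_pos hB'0]
  refine (div_le_div_of_nonneg_right ?_ hB'0.le).trans (div_le_div_of_nonneg_left he hω hB')
  refine (abs_add_le _ _).trans (add_le_add h1 ?_)
  rw [abs_mul, abs_sub_comm B']
  calc _ ≤ 1 * |B - B'| := by gcongr
    _ ≤ e₂ := by rw [one_mul]; exact h2

theorem abs_ratio_sub_le {ι : Type*} [Fintype ι] [Nonempty ι] (ν : Measure (Obs 𝒳))
    [IsProbabilityMeasure ν] {ℱ : Set (𝒳 → ℝ)} {N : ℕ} (hN : 1 ≤ N) {w : Obs 𝒳 → ℝ}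
    (hw : Measurable w) (hw1 : ∀ o, w o ∈ Set.Icc (0 : ℝ) 1) {D ω : ℝ} (hω : 0 < ω)
    (hωw : ω ≤ ∫ o, w o ∂ν) {s : ι → Obs 𝒳}
    (hs : GridDev ℱ N (fun _ => w) ν D s) {f : 𝒳 → ℝ} (hf : f ∈ ℱ) (hfm : Measurable f)
    (hf1 : ∀ x, f x ∈ Set.Icc (0 : ℝ) 1) :
    |(∑ i, w (s i) * ((1 / (N : ℝ)) * ∑ j ∈ Finset.Icc 1 N, thr f (featX (s i)) ((j : ℝ) / N))) /
        ∑ i, w (s i) - (∫ o, w o * f (featX o) ∂ν) / ∫ o, w o ∂ν| ≤ (2 * D + 1 / N) / ω := by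
  set m : ℝ := (Fintype.card ι : ℝ) with hm
  have hm0 : 0 < m := by rw [hm]; exact_mod_cast Fintype.card_pos
  have hN' : (0 : ℝ) < N := by exact_mod_cast hN
  have hw1' : ∀ o, |w o| ≤ 1 := fun o => abs_le_one_of_mem (hw1 o)
  set gm : 𝒳 → ℝ := fun x => (1 / (N : ℝ)) * ∑ j ∈ Finset.Icc 1 N, thr f x ((j : ℝ) / N)
  have hgm0 : ∀ x, 0 ≤ gm x := fun x =>
    mul_nonneg (by positivity) (Finset.sum_nonneg fun j _ => thr_nonneg _ _ _)
  have hgm1 : ∀ x, gm x ≤ 1 := fun x => (le_abs_self _).trans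
    (abs_mean_grid_le hN fun j _ => abs_thr_le _ _ _)
  set t : ℕ → Obs 𝒳 → ℝ := fun j o => w o * thr f (featX o) ((j : ℝ) / N)
  have hti : ∀ j, Integrable (t j) ν := fun j => integrable_mul_thr ν hw hw1' hfm _
  have hwgm : ∀ o, w o * gm (featX o) = (1 / (N : ℝ)) * ∑ j ∈ Finset.Icc 1 N, t j o := fun o => by
    simp only [gm, t, ← Finset.mul_sum]; ring
  have hgi : Integrable (fun o => w o * gm (featX o)) ν := by
    simp only [hwgm]
    exact (integrable_finsetSum _ fun j _ => hti j).const_mul _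
  have hfi : Integrable (fun o => w o * f (featX o)) ν := by
    refine Integrable.of_bound (hw.mul (hfm.comp measurable_featX)).aestronglyMeasurable 1
      (ae_of_all _ fun o => ?_)
    rw [Real.norm_eq_abs, abs_mul]
    exact mul_le_one₀ (hw1' o) (abs_nonneg _) (abs_le_one_of_mem (hf1 _))
  have hdev : ∀ j ≤ N, |(1 / m) * ∑ i, t j (s i) - ∫ o, t j o ∂ν| ≤ D := fun j hj => hs j hj f hf
  have h1 : |(1 / m) * ∑ i, w (s i) * gm (featX (s i)) - ∫ o, w o * gm (featX o) ∂ν| ≤ D := by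
    have e : (1 / m) * ∑ i, w (s i) * gm (featX (s i)) - ∫ o, w o * gm (featX o) ∂ν =
        (1 / (N : ℝ)) * ∑ j ∈ Finset.Icc 1 N, ((1 / m) * ∑ i, t j (s i) - ∫ o, t j o ∂ν) := by
      simp only [hwgm]
      rw [integral_const_mul, integral_finsetSum _ fun j _ => hti j, Finset.sum_sub_distrib,
        ← Finset.mul_sum, ← Finset.mul_sum, Finset.sum_comm]
      ring
    rw [e]
    exact abs_mean_grid_le hN fun j hj => hdev j (Finset.mem_Icc.1 hj).2
  have h2 : |∫ o, w o * gm (featX o) ∂ν - ∫ o, w o * f (featX o) ∂ν| ≤ 1 / N := by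
    refine abs_integral_sub_le ν hgi hfi fun o => ?_
    rw [← mul_sub, abs_mul]
    have := mul_le_mul (hw1' o) (abs_grid_mean_sub_le hN f (featX o) (hf1 _)) (abs_nonneg _)
      zero_le_one
    rwa [one_mul] at this
  have h3 : |(1 / m) * ∑ i, w (s i) - ∫ o, w o ∂ν| ≤ D := by
    have := hdev 0 (Nat.zero_le _)
    simp only [t, thr_zero (hf1 _), mul_one] at this
    exact this
  have h4 : |(1 / m) * ∑ i, w (s i) * gm (featX (s i)) - ∫ o, w o * f (featX o) ∂ν| ≤ D + 1 / N :=
    (abs_sub_le _ _ _).trans (add_le_add h1 h2)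
  have h5 := abs_div_sub_div_le
    (A := (1 / m) * ∑ i, w (s i) * gm (featX (s i))) (B := (1 / m) * ∑ i, w (s i))
    (mul_nonneg (by positivity) (Finset.sum_nonneg fun i _ => mul_nonneg (hw1 _).1 (hgm0 _)))
    (mul_le_mul_of_nonneg_left (Finset.sum_le_sum fun i _ =>
      mul_le_of_le_one_right (hw1 _).1 (hgm1 _)) (by positivity)) hω hωw h4 h3
  rw [mul_div_mul_left _ _ (by positivity)] at h5
  refine h5.trans (le_of_eq ?_)
  ring

/-- The sums over the group in the empirical disparity are sums over the subsample in the group. -/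
theorem sum_groupWeight_mul {n : ℕ} (I : AlgInput 𝒳 n) (μ : 𝒳 → ℝ) (s : Fin n → Obs 𝒳)
    (hI : I.data = modifiedData μ s) (a : Fin 2) (v : 𝒳 → ℝ) :
    ∑ i, I.groupWeight a i * v (I.data i).1 =
      ∑ i : hits (attrA ⁻¹' I.S a) s, I.g (featX (s i)) (μ (featX (s i))) * v (featX (s i)) := by
  classical
  rw [Finset.sum_coe_sort (hits (attrA ⁻¹' I.S a) s)
    (fun i => I.g (featX (s i)) (μ (featX (s i))) * v (featX (s i)))]
  unfold hits
  rw [Finset.sum_filter]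
  refine Finset.sum_congr rfl fun i _ => ?_
  simp only [AlgInput.groupWeight, hI, modifiedData, Set.indicator_apply, Set.mem_preimage]
  split_ifs <;> simp

theorem groupCount_eq {n : ℕ} (T : Set (Fin 2)) (s : Fin n → Obs 𝒳) :
    groupCount T s = (hits (attrA ⁻¹' T) s).card := by
  unfold groupCount
  rw [← Set.ncard_coe_finset]
  congr 1
  ext i
  simp [mem_hits]

theorem disparity_ratio_mem (ν : Measure (Obs 𝒳)) [IsFiniteMeasure ν] {w : Obs 𝒳 → ℝ}
    (hw : Measurable w) (hw1 : ∀ o, w o ∈ Set.Icc (0 : ℝ) 1) {f : 𝒳 → ℝ}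
    (hf1 : ∀ x, f x ∈ Set.Icc (0 : ℝ) 1) :
    (∫ o, w o * f (featX o) ∂ν) / ∫ o, w o ∂ν ∈ Set.Icc (0 : ℝ) 1 := by
  have h0 : 0 ≤ ∫ o, w o ∂ν := integral_nonneg fun o => (hw1 o).1
  refine ⟨div_nonneg (integral_nonneg fun o => mul_nonneg (hw1 o).1 (hf1 _).1) h0,
    div_le_one_of_le₀ ?_ h0⟩
  refine integral_mono_of_nonneg (ae_of_all _ fun o => mul_nonneg (hw1 o).1 (hf1 _).1)
    (Integrable.of_bound hw.aestronglyMeasurable 1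
      (ae_of_all _ fun o => abs_le_one_of_mem (hw1 o)))
    (ae_of_all _ fun o => mul_le_of_le_one_right (hw1 o).1 (hf1 _).2)

end

section

variable {𝒳 : Type*} [MeasurableSpace 𝒳]

/-! ### The loss of a fixed randomized prediction function -/

/-- The support is countable, so measurability and the interchange with integrals are available over
an uncountable `ℱ`. -/
theorem mix_eq_tsum_support {α : Type*} (Q : PMF α) (v : α → ℝ) :
    mix Q v = ∑' f : Q.support, (Q f).toReal * v f := by
  unfold mix
  refine (tsum_subtype_eq_of_support_subset fun f hf => ?_).symm
  rw [PMF.mem_support_iff]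
  intro h0
  simp [h0] at hf

theorem measurable_mix {Ω α : Type*} [MeasurableSpace Ω] (Q : PMF α) {v : α → Ω → ℝ}
    (hv : ∀ f, Measurable (v f)) : Measurable fun o => mix Q fun f => v f o := by
  have := Q.support_countable.to_subtype
  simp only [mix_eq_tsum_support]
  exact Measurable.tsum fun f => (hv f).const_mul _

theorem integral_mix {Ω α : Type*} [MeasurableSpace Ω] (P : Measure Ω) [IsProbabilityMeasure P]
    (Q : PMF α) {v : α → Ω → ℝ} (hv : ∀ f, Measurable (v f)) {b : ℝ} (hb : ∀ f o, |v f o| ≤ b) :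
    ∫ o, mix Q (fun f => v f o) ∂P = mix Q fun f => ∫ o, v f o ∂P := by
  have := Q.support_countable.to_subtype
  have hint : ∀ f, Integrable (v f) P := fun f =>
    Integrable.of_bound (hv f).aestronglyMeasurable b (ae_of_all _ fun o => hb f o)
  simp only [mix_eq_tsum_support]
  rw [← integral_tsum_of_summable_integral_norm
    (F := fun (f : Q.support) o => (Q f).toReal * v f o) (fun f => (hint f).const_mul _)]
  · simp only [integral_const_mul]
  · refine Summable.of_nonneg_of_le (f := fun f : Q.support => (Q f).toReal * b)
      (fun f => integral_nonneg fun o => norm_nonneg _) (fun f => ?_)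
      (((ENNReal.summable_toReal Q.tsum_coe_ne_top).mul_right b).subtype _)
    have h1 : ∀ o, ‖(Q f).toReal * v f o‖ ≤ (Q f).toReal * b := fun o => by
      rw [norm_mul, Real.norm_of_nonneg ENNReal.toReal_nonneg]
      exact mul_le_mul_of_nonneg_left (hb f o) ENNReal.toReal_nonneg
    calc _ ≤ ∫ o, (Q f).toReal * b ∂P :=
          integral_mono_of_nonneg (ae_of_all _ fun o => norm_nonneg _) (integrable_const _)
            (ae_of_all _ h1)
      _ = _ := by simp

/-- Hoeffding's inequality for i.i.d. sample means of a `[0,1]`-valued function. -/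
theorem measure_mean_ge_le {Ω : Type*} [MeasurableSpace Ω] (P : Measure Ω) [IsProbabilityMeasure P]
    (V : Ω → ℝ) (hV : Measurable V) (hV1 : ∀ o, V o ∈ Set.Icc (0 : ℝ) 1) {n : ℕ} (hn : 1 ≤ n)
    {t : ℝ} (ht : 0 ≤ t) :
    (Measure.pi fun _ : Fin n => P) {s | ∫ o, V o ∂P + t < (1 / (n : ℝ)) * ∑ i, V (s i)} ≤
      ENNReal.ofReal (Real.exp (-(2 * n * t ^ 2))) := by
  have hn0 : (0 : ℝ) < n := by exact_mod_cast hn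
  set Pn := Measure.pi fun _ : Fin n => P
  set X : Fin n → (Fin n → Ω) → ℝ := fun i s => V (s i) - ∫ o, V o ∂P
  have hind : iIndepFun X Pn :=
    iIndepFun_pi (X := fun _ o => V o - ∫ o, V o ∂P) fun _ => (hV.sub_const _).aemeasurable
  have hint : ∀ i : Fin n, ∫ s, V (s i) ∂Pn = ∫ o, V o ∂P := fun i =>
    integral_comp_eval (μ := fun _ : Fin n => P) hV.aestronglyMeasurable
  have hsub : ∀ i ∈ (Finset.univ : Finset (Fin n)),
      HasSubgaussianMGF (X i) ((‖(1 : ℝ) - 0‖₊ / 2) ^ 2) Pn := by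
    intro i _
    have := hasSubgaussianMGF_of_mem_Icc (μ := Pn) (X := fun s => V (s i)) (a := 0) (b := 1)
      (hV.comp (measurable_pi_apply i)).aemeasurable (ae_of_all _ fun s => hV1 _)
    rwa [hint i] at this
  have h := HasSubgaussianMGF.measure_sum_ge_le_of_iIndepFun hind hsub
    (ε := n * t) (by positivity)
  rw [← ofReal_measureReal]
  refine ENNReal.ofReal_le_ofReal ((measureReal_mono ?_).trans (h.trans (le_of_eq ?_)))
  · intro s hs
    simp only [Set.mem_ofPred_eq, X, Finset.sum_sub_distrib] at hs ⊢
    rw [one_div_mul_eq_div, lt_div_iff₀ hn0] at hs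
    simp; linarith
  · congr 1
    simp
    field_simp

/-- For fixed `Q` the averaged loss is one `[0,1]`-valued function of the observation, so Hoeffding
applies with no complexity term. -/
theorem measure_empirical_loss_ge_le (P : Measure (Obs 𝒳)) [IsProbabilityMeasure P]
    {l : ℝ → ℝ → ℝ} (hl : LossBound l) {μ : 𝒳 → ℝ} (hμ : Measurable μ)
    (hμ1 : ∀ x, μ x ∈ Set.Icc (0 : ℝ) 1) {ℱ : Set (𝒳 → ℝ)}
    (hℱ : ∀ f ∈ ℱ, Measurable f ∧ ∀ x, f x ∈ Set.Icc (0 : ℝ) 1) (Q : PMF ℱ) {n : ℕ} (hn : 1 ≤ n)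
    {t : ℝ} (ht : 0 ≤ t) :
    (Measure.pi fun _ : Fin n => P) {s | mix Q (fun f => lossMu P μ l f) + t <
      mix Q fun f => (1 / (n : ℝ)) * ∑ i, l (μ (featX (s i))) ((f : 𝒳 → ℝ) (featX (s i)))} ≤
      ENNReal.ofReal (Real.exp (-(2 * n * t ^ 2))) := by
  set v : ℱ → Obs 𝒳 → ℝ := fun f o => l (μ (featX o)) ((f : 𝒳 → ℝ) (featX o))
  have hv01 : ∀ f o, v f o ∈ Set.Icc (0 : ℝ) 1 := fun f o =>
    hl.mem_Icc _ (hμ1 _) _ ((hℱ f f.2).2 _)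
  have hvm : ∀ f, Measurable (v f) := fun f =>
    hl.measurable (hμ.comp measurable_featX) ((hℱ f f.2).1.comp measurable_featX) (fun _ => hμ1 _)
      (fun _ => (hℱ f f.2).2 _)
  have hvb : ∀ f o, |v f o| ≤ 1 := fun f o => abs_le_one_of_mem (hv01 f o)
  set V : Obs 𝒳 → ℝ := fun o => mix Q fun f => v f o
  have hV1 : ∀ o, V o ∈ Set.Icc (0 : ℝ) 1 := fun o =>
    ⟨tsum_nonneg fun f => mul_nonneg ENNReal.toReal_nonneg (hv01 f o).1,
      (le_abs_self _).trans (abs_mix_le Q fun f => hvb f o)⟩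
  have h := measure_mean_ge_le P V (measurable_mix Q hvm) hV1 hn ht
  rw [integral_mix P Q hvm hvb] at h
  refine (measure_mono ?_).trans h
  intro s hs
  have hsum : ∀ T : Finset (Fin n), (mix Q fun f => ∑ i ∈ T, v f (s i)) = ∑ i ∈ T, V (s i) := by
    intro T
    induction T using Finset.induction_on with
    | empty => simp [mix_const]
    | insert i T hi ih =>
      simp only [Finset.sum_insert hi]
      rw [mix_add Q (b := 1) (c := T.card) (fun f => hvb f _) (fun f => ?_), ih]
      refine (Finset.abs_sum_le_sum_abs _ _).trans ?_
      calc _ ≤ ∑ i ∈ T, (1 : ℝ) := Finset.sum_le_sum fun i _ => hvb f _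
        _ = T.card := by simp
  have hs' : mix Q (fun f => lossMu P μ l f) + t < mix Q fun f => (1 / (n : ℝ)) *
    ∑ i, v f (s i) := hs
  rw [mix_const_mul, hsum] at hs'
  exact hs'

/-! ### The disparity measures with weights `1`, `μ` and `1 - μ` -/

theorem integral_cond_eq {Ω : Type*} [MeasurableSpace Ω] (P : Measure Ω) (E : Set Ω) (f : Ω → ℝ) :
    ∫ o, f o ∂P[|E] = (P E)⁻¹.toReal * ∫ o in E, f o ∂P := by
  rw [ProbabilityTheory.cond, integral_smul_measure, smul_eq_mul]

theorem disparity_one_eq (P : Measure (Obs 𝒳)) [IsProbabilityMeasure P] (μ : 𝒳 → ℝ)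
    (S : Fin 2 → Set (Fin 2)) (β : Fin 2 → ℝ) (f : 𝒳 → ℝ) :
    disparity P μ (fun _ _ => 1) S β f = disparityOn P (fun a => {o | attrA o ∈ S a}) β f := by
  unfold disparity disparityOn
  refine Finset.sum_congr rfl fun a _ => ?_
  congr 1
  simp only [one_mul]
  have hset : {o : Obs 𝒳 | attrA o ∈ S a} = attrA ⁻¹' S a := rfl
  rw [hset]
  by_cases h : P (attrA ⁻¹' S a) = 0
  · rw [cond_eq_zero_of_meas_eq_zero h]; simp
  · have := cond_isProbabilityMeasure h
    simp

/-- Pulling a bounded function of `X` out of a conditional expectation given `X`. -/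
theorem integral_mul_condExp (P : Measure (Obs 𝒳)) [IsProbabilityMeasure P] {h : 𝒳 → ℝ}
    (hh : Measurable h) {b : ℝ} (hb : ∀ x, |h x| ≤ b) {U : Obs 𝒳 → ℝ} (hU : Integrable U P) :
    ∫ o, h (featX o) * U o ∂P = ∫ o, h (featX o) * (P[U | sigmaX 𝒳]) o ∂P := by
  have hm : sigmaX 𝒳 ≤ (inferInstance : MeasurableSpace (Obs 𝒳)) := measurable_featX.comap_le
  have hsm : StronglyMeasurable[sigmaX 𝒳] fun o : Obs 𝒳 => h (featX o) :=
    (hh.comp (comap_measurable featX)).stronglyMeasurable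
  have hi : Integrable ((fun o : Obs 𝒳 => h (featX o)) * U) P :=
    hU.bdd_mul (hh.comp measurable_featX).aestronglyMeasurable (ae_of_all _ fun o => hb _)
  have h1 := condExp_mul_of_stronglyMeasurable_left hsm hi hU
  have h2 := integral_condExp (μ := P) hm (f := (fun o : Obs 𝒳 => h (featX o)) * U)
  rw [integral_congr_ae h1] at h2
  exact h2.symm

/-- Conditioning on `X` replaces the indicator of the outcome event by `q`, since it is
conditionally independent of the group. With test functions `f` and 1 this matches numerator and
denominator. -/
theorem integral_cond_outcome_eq (P : Measure (Obs 𝒳)) [IsProbabilityMeasure P]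
    (hind : CondIndepGivenX P attrA outY) (e : ℝ) {q : 𝒳 → ℝ} (hq : Measurable q)
    (hq1 : ∀ x, q x ∈ Set.Icc (0 : ℝ) 1)
    (hqe : P[(outY ⁻¹' {e}).indicator (fun _ => (1 : ℝ)) | sigmaX 𝒳] =ᵐ[P] fun o => q (featX o))
    (T : Set (Fin 2)) {f : 𝒳 → ℝ} (hf : Measurable f) (hf1 : ∀ x, f x ∈ Set.Icc (0 : ℝ) 1) :
    (∫ o, q (featX o) * f (featX o) ∂P[|attrA ⁻¹' T]) / (∫ o, q (featX o) ∂P[|attrA ⁻¹' T]) =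
      ∫ o, f (featX o) ∂P[|{o | outY o = e ∧ attrA o ∈ T}] := by
  set B : Set (Obs 𝒳) := attrA ⁻¹' T
  set E : Set (Obs 𝒳) := {o | outY o = e ∧ attrA o ∈ T} with hE
  have hEB : attrA ⁻¹' T ∩ outY ⁻¹' {e} = E := by ext o; simp [hE, and_comm]
  have hBm : MeasurableSet B := measurable_attrA MeasurableSet.of_discrete
  have hEm : MeasurableSet E := by
    rw [← hEB]; exact hBm.inter (measurable_outY (measurableSet_singleton e))
  have hindi : ∀ A : Set (Obs 𝒳), MeasurableSet A →
      Integrable (A.indicator fun _ => (1 : ℝ)) P := fun A hA => (integrable_const 1).indicator hA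
  have hset : ∀ (A : Set (Obs 𝒳)), MeasurableSet A → ∀ u : Obs 𝒳 → ℝ,
      ∫ o in A, u o ∂P = ∫ o, u o * A.indicator (fun _ => (1 : ℝ)) o ∂P := by
    intro A hA u
    rw [← integral_indicator hA]
    refine integral_congr_ae (ae_of_all _ fun o => ?_)
    by_cases h : o ∈ A <;> simp [h]
  have key : ∀ h : 𝒳 → ℝ, Measurable h → (∀ x, h x ∈ Set.Icc (0 : ℝ) 1) →
      ∫ o in E, h (featX o) ∂P = ∫ o in B, q (featX o) * h (featX o) ∂P := by
    intro h hh hh1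
    rw [hset E hEm, hset B hBm,
      integral_mul_condExp P hh (fun x => abs_le_one_of_mem (hh1 x)) (hindi E hEm)]
    have h2 := integral_mul_condExp P (hq.mul hh) (b := 1) (fun x => by
      rw [Pi.mul_apply, abs_mul]
      exact mul_le_one₀ (abs_le_one_of_mem (hq1 x)) (abs_nonneg _) (abs_le_one_of_mem (hh1 x)))
      (hindi B hBm)
    simp only [Pi.mul_apply] at h2
    rw [h2]
    have h3 := hind T {e} MeasurableSet.of_discrete (measurableSet_singleton e)
    rw [hEB] at h3
    refine integral_congr_ae ?_
    filter_upwards [h3, hqe] with o ho1 ho2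
    rw [ho1, Pi.mul_apply, ho2]
    ring
  have hPE : P.real E = ∫ o in B, q (featX o) ∂P := by
    have := key (fun _ => 1) measurable_const (fun _ => by simp)
    simpa using this
  rw [integral_cond_eq, integral_cond_eq, integral_cond_eq, key f hf hf1, ENNReal.toReal_inv,
    ENNReal.toReal_inv]
  change _ / _ = (P.real E)⁻¹ * _
  rw [hPE]
  rcases eq_or_ne (P B) 0 with h0 | h0
  · simp [Measure.restrict_eq_zero.2 h0]
  · have h1 : (P B).toReal⁻¹ ≠ 0 :=
      inv_ne_zero (ENNReal.toReal_ne_zero.2 ⟨h0, measure_ne_top _ _⟩)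
    rw [mul_div_mul_left _ _ h1, div_eq_inv_mul]

theorem condExp_outcome_one {P : Measure (Obs 𝒳)} [IsProbabilityMeasure P] {μ : 𝒳 → ℝ}
    (hμ : IsRegression P μ) (hY : ∀ᵐ o ∂P, outY o = 0 ∨ outY o = 1) :
    P[(outY ⁻¹' {1}).indicator (fun _ => (1 : ℝ)) | sigmaX 𝒳] =ᵐ[P] fun o => μ (featX o) := by
  refine (condExp_congr_ae ?_).trans hμ.ae_eq.symm
  filter_upwards [hY] with o ho
  rcases ho with h | h <;> simp [Set.indicator, h]

theorem condExp_outcome_zero {P : Measure (Obs 𝒳)} [IsProbabilityMeasure P] {μ : 𝒳 → ℝ}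
    (hμ : IsRegression P μ) (hY : ∀ᵐ o ∂P, outY o = 0 ∨ outY o = 1) :
    P[(outY ⁻¹' {0}).indicator (fun _ => (1 : ℝ)) | sigmaX 𝒳] =ᵐ[P]
      fun o => 1 - μ (featX o) := by
  have hm : sigmaX 𝒳 ≤ (inferInstance : MeasurableSpace (Obs 𝒳)) := measurable_featX.comap_le
  have hYi : Integrable outY P := by
    refine Integrable.of_bound measurable_outY.aestronglyMeasurable 1 ?_
    filter_upwards [hY] with o ho
    rcases ho with h | h <;> simp [h]
  have h1 : (outY ⁻¹' {0}).indicator (fun _ => (1 : ℝ)) =ᵐ[P] (fun _ => (1 : ℝ)) - outY := by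
    filter_upwards [hY] with o ho
    rcases ho with h | h <;> simp [Set.indicator, h]
  have h2 := condExp_sub (μ := P) (integrable_const (1 : ℝ)) hYi (sigmaX 𝒳)
  filter_upwards [condExp_congr_ae (m := sigmaX 𝒳) h1, h2, hμ.ae_eq] with o ho1 ho2 ho3
  rw [ho1, ho2, ho3, Pi.sub_apply, condExp_const hm]

/-! ### Losses that are convex in the outcome -/

/-- Conditional Jensen, through a regular conditional distribution of the outcome. Clamping is
needed because the outcome lies in the unit interval only almost surely. -/
theorem lossMu_le_loss {P : Measure (Obs 𝒳)} [IsProbabilityMeasure P] {μ : 𝒳 → ℝ}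
    (hμ : IsRegression P μ) (hY : ∀ᵐ o ∂P, outY o ∈ Set.Icc (0 : ℝ) 1) {l : ℝ → ℝ → ℝ}
    (hl : LossBound l)
    (hconv : ∀ u ∈ Set.Icc (0 : ℝ) 1, ConvexOn ℝ (Set.Icc (0 : ℝ) 1) fun y => l y u) {f : 𝒳 → ℝ}
    (hf : Measurable f) (hf1 : ∀ x, f x ∈ Set.Icc (0 : ℝ) 1) :
    lossMu P μ l f ≤ loss P l f := by
  have hm : sigmaX 𝒳 ≤ (inferInstance : MeasurableSpace (Obs 𝒳)) := measurable_featX.comap_le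
  set κ := condDistrib (outY : Obs 𝒳 → ℝ) featX P
  set L : 𝒳 × ℝ → ℝ := fun p => l (clamp p.2) (f p.1)
  have hLm : Measurable L := by
    have hc : Measurable fun p : 𝒳 × ℝ => clamp p.2 :=
      (continuous_subtype_val.comp continuous_projIcc).measurable.comp measurable_snd
    exact hl.measurable hc (hf.comp measurable_fst) (fun _ => clamp_mem _) (fun _ => hf1 _)
  have hL1 : ∀ p, |L p| ≤ 1 := fun p =>
    abs_le_one_of_mem (hl.mem_Icc _ (clamp_mem _) _ (hf1 _))
  have hLi : Integrable (fun o : Obs 𝒳 => L (featX o, outY o)) P :=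
    Integrable.of_bound (hLm.comp (measurable_featX.prodMk
      measurable_outY)).aestronglyMeasurable 1 (ae_of_all _ fun o => hL1 _)
  have h1 := condExp_prod_ae_eq_integral_condDistrib (μ := P) measurable_featX
    measurable_outY.aemeasurable hLm.stronglyMeasurable hLi
  have h2 : loss P l f = ∫ o, ∫ y, L (featX o, y) ∂κ (featX o) ∂P := by
    rw [← integral_congr_ae h1, integral_condExp hm]
    refine integral_congr_ae ?_
    filter_upwards [hY] with o ho
    simp only [L, clamp_of_mem ho]
  have hcm : Measurable clamp := (continuous_subtype_val.comp continuous_projIcc).measurable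
  have hci : Integrable (fun o : Obs 𝒳 => clamp (outY o)) P :=
    Integrable.of_bound (hcm.comp measurable_outY).aestronglyMeasurable 1
      (ae_of_all _ fun o => abs_le_one_of_mem (clamp_mem _))
  have h3 := condExp_ae_eq_integral_condDistrib (μ := P) (X := featX) (Y := outY)
    measurable_featX measurable_outY.aemeasurable hcm.stronglyMeasurable hci
  have h4 : P[outY | sigmaX 𝒳] =ᵐ[P] P[fun o => clamp (outY o) | sigmaX 𝒳] := by
    refine condExp_congr_ae ?_
    filter_upwards [hY] with o ho
    rw [clamp_of_mem ho]
  rw [h2]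
  refine integral_mono_ae ?_ ?_ ?_
  · exact Integrable.of_bound (hl.measurable (hμ.measurable.comp measurable_featX)
      (hf.comp measurable_featX) (fun _ => hμ.mem_Icc _) (fun _ => hf1 _)).aestronglyMeasurable 1
      (ae_of_all _ fun o => abs_le_one_of_mem (hl.mem_Icc _ (hμ.mem_Icc _) _ (hf1 _)))
  · exact integrable_condExp.congr h1
  · filter_upwards [hμ.ae_eq, h3, h4] with o ho1 ho3 ho4
    have hmean : μ (featX o) = ∫ y, clamp y ∂κ (featX o) := by rw [ho1, ho4, ho3]
    rw [hmean]
    have hcont : ContinuousOn (fun y => l y (f (featX o))) (Set.Icc (0 : ℝ) 1) := by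
      have := (hl.continuous_clamp.comp (continuous_id.prodMk
        (continuous_const (y := f (featX o))))).continuousOn (s := Set.Icc (0 : ℝ) 1)
      refine this.congr fun y hy => ?_
      simp [clamp_of_mem hy, clamp_of_mem (hf1 (featX o))]
    exact (hconv _ (hf1 (featX o))).map_integral_le hcont isClosed_Icc
      (ae_of_all _ fun y => clamp_mem y)
      (Integrable.of_bound hcm.aestronglyMeasurable 1
        (ae_of_all _ fun y => abs_le_one_of_mem (clamp_mem y)))
      (Integrable.of_bound (hLm.comp measurable_prodMk_left).aestronglyMeasurable 1
        (ae_of_all _ fun y => hL1 (featX o, y)))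

end

section

variable {𝒳 : Type*}

/-! ### Guarantee for the returned solution in terms of uniform errors -/

/-- The loss bound follows from the cost test alone. If the problem is feasible, `Qs` is empirically
feasible and the saddle point passes the test, so null means infeasible. The disparity error `eD` is
quantified last because it is available only when the groups are nonempty. -/
theorem AlgInput.Regular.output_guarantee {n : ℕ} {I : AlgInput 𝒳 n} {ℱ : Set (𝒳 → ℝ)}
    (hI : I.Regular ℱ) {η : ℝ} {best : (Fin 3 → ℝ) → ℱ} (hbest : I.IsBestH ℱ best)
    (hBl : 0 < I.Blam) (hBx : 0 ≤ I.Bxi) {t : ℕ} (ht : I.StopsAt η best t)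
    {loss disp : ℱ → ℝ} {bl bd c eL : ℝ} (hl : ∀ f, |loss f| ≤ bl) (hd : ∀ f, |disp f| ≤ bd)
    (hloss : ∀ f : ℱ, |I.costHat f + c - loss f| ≤ eL) (feas : Prop) (Qs : PMF ℱ)
    (hQs : feas → I.costHatQ Qs ≤ I.epsHat) :
    (∃ Q : PMF ℱ, I.output η best t = some Q ∧
      mix Q loss ≤ I.epsHat + c + (I.Bxi + 2 * I.nu) / I.Blam + eL ∧
      (feas → ∀ eD, (∀ f : ℱ, |I.dispHat f - disp f| ≤ eD) →
        |mix Q disp| ≤ |mix Qs disp| + 2 * I.nu + (I.Bxi + 2 * I.nu) / I.Blam + 2 * eD)) ∨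
    (I.output η best t = none ∧ ¬ feas) := by
  have hd' : ∀ f : ℱ, |I.dispHat f| ≤ I.Bxi := fun f => hI.abs_dispHat_le f
  have hc' : ∀ f : ℱ, |I.costHat f| ≤ 1 := fun f => hI.abs_costHat_le f
  by_cases hout : I.costHatQ (I.QHat η best t) ≤ I.epsHat + (I.Bxi + 2 * I.nu) / I.Blam
  · refine Or.inl ⟨I.QHat η best t, by unfold AlgInput.output; rw [if_pos hout], ?_, ?_⟩
    · have h1 := abs_mix_sub_mix_le (I.QHat η best t) (v := fun f : ℱ => I.costHat f + c)
        (w := loss) (b := 1 + |c|) (c := bl)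
        (fun f => (abs_add_le _ _).trans (by linarith [hc' f])) hl hloss
      rw [mix_add _ hc' (fun _ => le_refl |c|), mix_const] at h1
      have h2 := (abs_le.1 h1).1
      unfold AlgInput.costHatQ at hout
      linarith
    · intro hf eD heD
      have h1 := (AlgInput.saddle_guarantee hbest hBl hBx hd' hc' ht.1 Qs (hQs hf)).2
      have h2 := abs_mix_sub_mix_le (I.QHat η best t) (v := fun f : ℱ => I.dispHat f)
        (w := disp) hd' hd heD
      have h3 := abs_mix_sub_mix_le Qs (v := fun f : ℱ => I.dispHat f) (w := disp) hd' hd heD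
      unfold AlgInput.dispHatQ at h1
      have h4 := abs_sub_abs_le_abs_sub (mix (I.QHat η best t) disp)
        (mix (I.QHat η best t) fun f : ℱ => I.dispHat f)
      rw [abs_sub_comm] at h4
      have h5 := abs_sub_abs_le_abs_sub (mix Qs fun f : ℱ => I.dispHat f) (mix Qs disp)
      linarith
  · refine Or.inr ⟨by unfold AlgInput.output; rw [if_neg hout], fun hf => hout ?_⟩
    exact (AlgInput.saddle_guarantee hbest hBl hBx hd' hc' ht.1 Qs (hQs hf)).1

variable [MeasurableSpace 𝒳]

/-! ### The good event -/

/-- The half-width of the uniform deviations over the grid, at sample size `m`. -/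
noncomputable def devWidth (C φ δ : ℝ) (N m : ℕ) : ℝ :=
  (2 * C + √(8 * Real.log (1 / (δ / (N + 1))))) * (m : ℝ) ^ (-φ)

/-- Four failures of probability at most `δ/8` each: the loss grid, the two groups, and Hoeffding
for `Q`. -/
theorem exists_good_event (P : Measure (Obs 𝒳)) [IsProbabilityMeasure P]
    {μ : 𝒳 → ℝ} (hμ : Measurable μ) (hμ1 : ∀ x, μ x ∈ Set.Icc (0 : ℝ) 1)
    {ℱ : Set (𝒳 → ℝ)} (hℱ : ∀ f ∈ ℱ, Measurable f ∧ ∀ x, f x ∈ Set.Icc (0 : ℝ) 1)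
    (hℱm : PointwiseMeasurable ℱ) {C φ : ℝ} (hφ : φ ≤ 1 / 2)
    (hR : ∀ m : ℕ, 1 ≤ m → rademacher (thrClass ℱ) m ≤ C * (m : ℝ) ^ (-φ))
    {l : ℝ → ℝ → ℝ} (hl : LossBound l) (S : Fin 2 → Set (Fin 2)) {w : Obs 𝒳 → ℝ}
    (hw : Measurable w) (hw1 : ∀ o, w o ∈ Set.Icc (0 : ℝ) 1) {ω : ℝ} (hω : 0 < ω) (β : Fin 2 → ℝ)
    (hwω : ∀ a, β a ≠ 0 → ω ≤ ∫ o, w o ∂P[|attrA ⁻¹' S a])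
    {n N : ℕ} (hn : 1 ≤ n) (hN : 1 ≤ N) {δ : ℝ} (hδ0 : 0 < δ) (hδ1 : δ < 1) (Q : PMF ℱ) :
    ∃ G : Set (Fin n → Obs 𝒳), MeasurableSet G ∧
      1 - δ ≤ (Measure.pi fun _ : Fin n => P).real G ∧ ∀ s ∈ G,
      GridDev ℱ N (lossWeight l N μ) P (devWidth C φ (δ / 8) N n) s ∧
      (∀ a, β a ≠ 0 → (hits (attrA ⁻¹' S a) s).Nonempty →
        GridDev ℱ N (fun _ => w) P[|attrA ⁻¹' S a]
          (devWidth C φ (δ / 8) N (hits (attrA ⁻¹' S a) s).card)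
          fun i : hits (attrA ⁻¹' S a) s => s i) ∧
      (mix Q fun f => (1 / (n : ℝ)) * ∑ i, l (μ (featX (s i))) ((f : 𝒳 → ℝ) (featX (s i)))) ≤
        mix Q (fun f => lossMu P μ l f) + √(-Real.log (δ / 8) / 2) * (n : ℝ) ^ (-(1 / 2) : ℝ) := by
  set Pn := Measure.pi fun _ : Fin n => P
  have hn0 : (0 : ℝ) < n := by exact_mod_cast hn
  have : Nonempty (Fin n) := ⟨⟨0, hn⟩⟩
  have hδ8 : 0 < δ / 8 := by positivity
  have hδ81 : δ / 8 ≤ 1 := by linarith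
  have hlog : 0 ≤ -Real.log (δ / 8) / 2 := by
    have := Real.log_nonpos hδ8.le hδ81; linarith
  set t := √(-Real.log (δ / 8) / 2) * (n : ℝ) ^ (-(1 / 2) : ℝ)
  have ht0 : 0 ≤ t := by positivity
  have ht : Real.exp (-(2 * n * t ^ 2)) = δ / 8 := by
    have h1 : ((n : ℝ) ^ (-(1 / 2) : ℝ)) ^ 2 = (n : ℝ)⁻¹ := by
      rw [← Real.rpow_natCast, ← Real.rpow_mul hn0.le, ← Real.rpow_neg_one]; norm_num
    simp only [t]
    rw [mul_pow, Real.sq_sqrt hlog, h1]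
    have : -(2 * (n : ℝ) * (-Real.log (δ / 8) / 2 * (n : ℝ)⁻¹)) = Real.log (δ / 8) := by
      field_simp
    rw [this, Real.exp_log hδ8]
  set B1 : Set (Fin n → Obs 𝒳) :=
    {s | ¬ GridDev ℱ N (lossWeight l N μ) P (devWidth C φ (δ / 8) N n) s}
  set B2 : Fin 2 → Set (Fin n → Obs 𝒳) := fun a =>
    {s | β a ≠ 0 ∧ (hits (attrA ⁻¹' S a) s).Nonempty ∧
      ¬ GridDev ℱ N (fun _ => w) P[|attrA ⁻¹' S a]
        (devWidth C φ (δ / 8) N (hits (attrA ⁻¹' S a) s).card)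
        fun i : hits (attrA ⁻¹' S a) s => s i}
  set B3 : Set (Fin n → Obs 𝒳) := {s | mix Q (fun f => lossMu P μ l f) + t <
      mix Q fun f => (1 / (n : ℝ)) * ∑ i, l (μ (featX (s i))) ((f : 𝒳 → ℝ) (featX (s i)))}
  have h1 : Pn B1 ≤ ENNReal.ofReal (δ / 8) := by
    have := measure_not_gridDev_le (ι := Fin n) ℱ (fun f hf => (hℱ f hf).1) hℱm C φ hφ hR P N
      (lossWeight l N μ) (fun j hj => measurable_lossWeight hl hN hμ hμ1 j hj)
      (fun j hj => abs_lossWeight_le hl hN hμ1 j hj) (δ / 8) hδ8 hδ81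
    rw [Fintype.card_fin] at this
    exact this
  have h2 : ∀ a, Pn (B2 a) ≤ ENNReal.ofReal (δ / 8) := by
    intro a
    by_cases ha : β a = 0
    · have : B2 a = ∅ := by simp [B2, ha]
      rw [this, measure_empty]; exact zero_le
    have hE : MeasurableSet (attrA ⁻¹' S a : Set (Obs 𝒳)) :=
      measurable_attrA MeasurableSet.of_discrete
    have hPE : P (attrA ⁻¹' S a) ≠ 0 := by
      intro h0
      have := hwω a ha
      rw [cond_eq_zero_of_meas_eq_zero h0, integral_zero_measure] at this
      linarith
    have hprob := cond_isProbabilityMeasure (μ := P) hPE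
    refine (measure_mono ?_).trans (measure_hits_le P (attrA ⁻¹' S a) hE hPE
      (fun T => {u | T.Nonempty ∧ ¬ GridDev ℱ N (fun _ => w) P[|attrA ⁻¹' S a]
        (devWidth C φ (δ / 8) N T.card) u}) (ENNReal.ofReal (δ / 8)) fun T => ?_)
    · exact fun s hs => hs.2
    · rcases T.eq_empty_or_nonempty with hT | hT
      · simp [hT]
      · have : Nonempty T := hT.to_subtype
        have h := measure_not_gridDev_le (ι := T) ℱ (fun f hf => (hℱ f hf).1) hℱm C φ hφ hR
          P[|attrA ⁻¹' S a] N (fun _ => w) (fun _ _ => hw)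
          (fun _ _ o => abs_le_one_of_mem (hw1 o)) (δ / 8) hδ8 hδ81
        rw [Fintype.card_coe] at h
        exact (measure_mono fun u hu => hu.2).trans h
  have h3 : Pn B3 ≤ ENNReal.ofReal (δ / 8) := by
    rw [← ht]
    exact measure_empirical_loss_ge_le P hl hμ hμ1 hℱ Q hn ht0
  set bad := B1 ∪ (B2 0 ∪ B2 1) ∪ B3
  have hbad : Pn bad ≤ ENNReal.ofReal δ := by
    refine (measure_union_le _ _).trans ?_
    refine (add_le_add ((measure_union_le _ _).trans
      (add_le_add h1 ((measure_union_le _ _).trans (add_le_add (h2 0) (h2 1))))) h3).trans ?_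
    rw [← ENNReal.ofReal_add hδ8.le hδ8.le, ← ENNReal.ofReal_add hδ8.le (by positivity),
      ← ENNReal.ofReal_add (by positivity) hδ8.le]
    exact ENNReal.ofReal_le_ofReal (by linarith)
  -- The bad set involves all of `ℱ` and is not known to be measurable, so its measurable hull is
  -- removed.
  refine ⟨(toMeasurable Pn bad)ᶜ, (measurableSet_toMeasurable _ _).compl, ?_, fun s hs => ?_⟩
  · rw [probReal_compl_eq_one_sub (measurableSet_toMeasurable _ _)]
    have : Pn.real (toMeasurable Pn bad) ≤ δ := by
      rw [measureReal_def, measure_toMeasurable]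
      exact ENNReal.toReal_le_of_le_ofReal hδ0.le hbad
    linarith
  · have hsb : s ∉ bad := fun h => hs (subset_toMeasurable _ _ h)
    simp only [bad, Set.mem_union, not_or] at hsb
    obtain ⟨⟨hs1, hs2, hs3⟩, hs4⟩ := hsb
    refine ⟨not_not.1 hs1, fun a ha hne => ?_, not_lt.1 hs4⟩
    by_contra hcon
    have : s ∈ B2 a := ⟨ha, hne, hcon⟩
    fin_cases a
    · exact hs2 this
    · exact hs3 this

/-! ### Numerical estimates -/

theorem one_le_logs {n : ℕ} (hn : 1 ≤ n) {δ : ℝ} (hδ0 : 0 < δ) (hδ1 : δ < 1) :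
    0 ≤ Real.log n ∧ 0 ≤ Real.log (1 / δ) := by
  refine ⟨Real.log_nonneg (by exact_mod_cast hn), Real.log_nonneg ?_⟩
  rw [le_div_iff₀ hδ0]; linarith

/-- The constant in front of the logarithmic factor in `devWidth`. -/
noncomputable def devConst (C cN' : ℝ) : ℝ := 2 * C + 8 * (Real.log 8 + |Real.log (2 * cN')| + 1)

theorem devConst_nonneg {C cN' : ℝ} (hC : 0 < C) : 0 ≤ devConst C cN' := by
  have : 0 < Real.log 8 := Real.log_pos (by norm_num)
  unfold devConst; positivity

/-- Since `N + 1 ≤ 2 cN' n^φ`, the logarithm is at most `aΛ` with `aΛ ≥ 1`, and its square root is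
bounded linearly; one power of the logarithmic factor is enough. -/
theorem devWidth_le {C φ cN' δ : ℝ} {N n m : ℕ} (hC : 0 < C) (hφ : φ ≤ 1 / 2)
    (hn : 1 ≤ n) (hN : 1 ≤ N) (hNn : (N : ℝ) ≤ cN' * (n : ℝ) ^ φ) (hδ0 : 0 < δ) (hδ1 : δ < 1) :
    devWidth C φ (δ / 8) N m ≤
      devConst C cN' * (1 + Real.log n + Real.log (1 / δ)) * (m : ℝ) ^ (-φ) := by
  obtain ⟨hl1, hl2⟩ := one_le_logs hn hδ0 hδ1
  have hn0 : (0 : ℝ) < n := by exact_mod_cast hn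
  have hN1 : (1 : ℝ) ≤ N := by exact_mod_cast hN
  have hnp : 0 < (n : ℝ) ^ φ := Real.rpow_pos_of_pos hn0 _
  have hc : 0 < cN' := by
    by_contra h
    have := mul_nonpos_of_nonpos_of_nonneg (not_lt.1 h) hnp.le
    linarith
  set Λ := 1 + Real.log n + Real.log (1 / δ)
  have hΛ : 1 ≤ Λ := by simp only [Λ]; linarith
  have h8 : 0 < Real.log 8 := Real.log_pos (by norm_num)
  set a := Real.log 8 + |Real.log (2 * cN')| + 1 with ha
  have ha1 : 1 ≤ a := by rw [ha]; linarith [abs_nonneg (Real.log (2 * cN'))]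
  have h1 : Real.log (1 / (δ / 8 / (N + 1))) ≤ a * Λ := by
    have e : 1 / (δ / 8 / ((N : ℝ) + 1)) = 8 * ((N : ℝ) + 1) * (1 / δ) := by field_simp
    rw [e, Real.log_mul (by positivity) (by positivity), Real.log_mul (by norm_num) (by positivity)]
    have h2 : Real.log ((N : ℝ) + 1) ≤ Real.log (2 * cN') + φ * Real.log n := by
      rw [← Real.log_rpow hn0, ← Real.log_mul (by positivity) hnp.ne']
      exact Real.log_le_log (by positivity) (by linarith)
    have h3 : φ * Real.log n ≤ Real.log n := by nlinarith
    have h4 := le_abs_self (Real.log (2 * cN'))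
    have h5 : a * Λ = a + a * (Real.log n + Real.log (1 / δ)) := by simp only [Λ]; ring
    have h6 := mul_le_mul_of_nonneg_right ha1 (add_nonneg hl1 hl2)
    rw [h5]; linarith
  have h2 : √(8 * Real.log (1 / (δ / 8 / (N + 1)))) ≤ 8 * a * Λ := by
    rw [Real.sqrt_le_left (by positivity)]
    have : 1 ≤ a * Λ := one_le_mul_of_one_le_of_one_le ha1 hΛ
    nlinarith
  unfold devWidth
  refine mul_le_mul_of_nonneg_right ?_ (by positivity)
  unfold devConst
  rw [← ha, add_mul]
  nlinarith

/-- This is what makes the required lower bound on `C'` exceed any fixed `b` for large `n`. -/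
theorem exists_threshold (φ cN : ℝ) (hφ0 : 0 < φ) (hcN : 0 < cN) (δ b : ℝ) :
    ∃ m : ℕ, 0 < δ → ∀ n ≥ m, b ≤ √(2 * Real.log (8 * (cN * (n : ℝ) ^ φ) / δ)) := by
  by_cases hδ : 0 < δ
  · have h1 : Filter.Tendsto (fun n : ℕ => √(2 * Real.log (8 * (cN * (n : ℝ) ^ φ) / δ)))
        Filter.atTop Filter.atTop := by
      refine Real.tendsto_sqrt_atTop.comp (Filter.Tendsto.const_mul_atTop two_pos ?_)
      refine Real.tendsto_log_atTop.comp (Filter.Tendsto.atTop_div_const hδ ?_)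
      refine Filter.Tendsto.const_mul_atTop (by norm_num) (Filter.Tendsto.const_mul_atTop hcN ?_)
      exact (tendsto_rpow_atTop hφ0).comp tendsto_natCast_atTop_atTop
    obtain ⟨m, hm⟩ := Filter.eventually_atTop.1 (h1.eventually_ge_atTop b)
    exact ⟨m, fun _ => hm⟩
  · exact ⟨0, fun h => absurd h hδ⟩

end

section

variable {𝒳 : Type*}

/-! ### The algorithm on the modified training data -/

theorem c0Hat_mem {n : ℕ} {I : AlgInput 𝒳 n} {ℱ : Set (𝒳 → ℝ)} (hI : I.Regular ℱ) :
    |c0Hat I.l I.N I.cover I.data| ≤ 1 :=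
  abs_mean_le zero_le_one fun i =>
    abs_le_one_of_mem (hI.loss.mem_Icc _ (hI.lowerY_mem i) _ (half_grid_mem hI.one_le_N))

/-- Bound on the number of iterations in terms of the rates of `ν` and `B_λ`. -/
theorem AlgInput.Regular.exists_stopsAt_le {n : ℕ} {I : AlgInput 𝒳 n} {ℱ : Set (𝒳 → ℝ)}
    (hI : I.Regular ℱ) {best : (Fin 3 → ℝ) → ℱ} (hbest : I.IsBestH ℱ best) (hBx : 0 < I.Bxi)
    {ε φ cν cB A : ℝ} (hε : 0 ≤ ε) (hφ0 : 0 < φ) (hn : 1 ≤ n) (hcν : 0 < cν) (hcB : 0 < cB)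
    (hA : 0 ≤ A) (hnu : I.nu = cν * (n : ℝ) ^ (-φ)) (hBl : I.Blam = cB * (n : ℝ) ^ φ)
    (heps : |I.epsHat| ≤ ε + 1 + A) :
    ∃ t : ℕ, I.StopsAt (I.learningRate ℱ) best t ∧ ((t + 1 : ℕ) : ℝ) ≤
      (4 * (2 * I.Bxi + ε + 2) ^ 2 * (cB / cν) ^ 2 * Real.log 4 + 1) * (1 + A) ^ 2 *
        (n : ℝ) ^ (4 * φ) := by
  have hn1 : (1 : ℝ) ≤ n := by exact_mod_cast hn
  have hn0 : (0 : ℝ) < n := by linarith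
  have hp : 0 < (n : ℝ) ^ φ := Real.rpow_pos_of_pos hn0 _
  have hBl0 : 0 < I.Blam := by rw [hBl]; positivity
  have hnu0 : 0 < I.nu := by rw [hnu]; positivity
  -- The oracle itself shows that `ℱ` is nonempty.
  set f := best 0
  have hr0 := hI.rho_pos f hBx
  obtain ⟨t, ht, hle⟩ := AlgInput.exists_stopsAt hbest hBl0 hBx.le hnu0 hr0
    (η := I.learningRate ℱ) rfl hI.abs_viol_le_rho
  refine ⟨t, ht, hle.trans ?_⟩
  have hlog : 0 < Real.log 4 := Real.log_pos (by norm_num)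
  set X := (n : ℝ) ^ (4 * φ) with hX
  have hX1 : 1 ≤ X := Real.one_le_rpow hn1 (by positivity)
  have h1 : I.Blam ^ 2 / I.nu ^ 2 = (cB / cν) ^ 2 * X := by
    have e : X = ((n : ℝ) ^ φ) ^ 4 := by
      rw [hX, ← Real.rpow_natCast, ← Real.rpow_mul hn0.le]; congr 1; push_cast; ring
    rw [hBl, hnu, Real.rpow_neg hn0.le, e]
    field_simp
  have h2 : I.rho ℱ ≤ (2 * I.Bxi + ε + 2) * (1 + A) := by
    have := hI.rho_le f hBx.le
    nlinarith [mul_nonneg hA hBx.le, mul_nonneg hA hε]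
  have h3 : I.rho ℱ ^ 2 ≤ (2 * I.Bxi + ε + 2) ^ 2 * (1 + A) ^ 2 := by
    rw [← mul_pow]; exact pow_le_pow_left₀ hr0.le h2 2
  have e : 4 * I.rho ℱ ^ 2 * I.Blam ^ 2 * Real.log 4 / I.nu ^ 2 =
      4 * I.rho ℱ ^ 2 * ((cB / cν) ^ 2 * X) * Real.log 4 := by
    rw [← h1]; ring
  have h4 : (1 : ℝ) ≤ (1 + A) ^ 2 * X :=
    one_le_mul_of_one_le_of_one_le (one_le_pow₀ (by linarith)) hX1
  rw [e]
  calc _ ≤ 4 * ((2 * I.Bxi + ε + 2) ^ 2 * (1 + A) ^ 2) * ((cB / cν) ^ 2 * X) * Real.log 4 +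
        (1 + A) ^ 2 * X := by gcongr
    _ = _ := by ring

variable [MeasurableSpace 𝒳]

/-- Uniform error of the empirical disparity on the good event. -/
theorem abs_dispHat_sub_disparity_le {n : ℕ} {I : AlgInput 𝒳 n} {ℱ : Set (𝒳 → ℝ)}
    (hI : I.Regular ℱ) {P : Measure (Obs 𝒳)} [IsProbabilityMeasure P] {μ : 𝒳 → ℝ}
    {s : Fin n → Obs 𝒳}
    (hdata : I.data = modifiedData μ s) (hfm : ∀ f ∈ ℱ, Measurable f)
    (hw : Measurable fun o : Obs 𝒳 => I.g (featX o) (μ (featX o)))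
    (hw1 : ∀ o : Obs 𝒳, I.g (featX o) (μ (featX o)) ∈ Set.Icc (0 : ℝ) 1) {ω : ℝ} (hω : 0 < ω)
    (hwω : ∀ a, I.β a ≠ 0 →
      ω ≤ ∫ o, I.g (featX o) (μ (featX o)) ∂P[|attrA ⁻¹' I.S a])
    {D : Fin 2 → ℝ}
    (hpos : ∀ a, I.β a ≠ 0 → (hits (attrA ⁻¹' I.S a) s).Nonempty)
    (hD : ∀ a, I.β a ≠ 0 → GridDev ℱ I.N (fun _ o => I.g (featX o) (μ (featX o)))
      P[|attrA ⁻¹' I.S a] (D a) fun i : hits (attrA ⁻¹' I.S a) s => s i) (f : ℱ) :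
    |I.dispHat f - disparity P μ I.g I.S I.β f| ≤ ∑ a, |I.β a| * ((2 * D a + 1 / I.N) / ω) := by
  unfold AlgInput.dispHat disparity
  rw [← Finset.sum_sub_distrib]
  refine (Finset.abs_sum_le_sum_abs _ _).trans (Finset.sum_le_sum fun a _ => ?_)
  rw [← mul_sub, abs_mul]
  by_cases ha : I.β a = 0
  · simp [ha]
  refine mul_le_mul_of_nonneg_left ?_ (abs_nonneg _)
  have hne : Nonempty (hits (attrA ⁻¹' I.S a) s) := (hpos a ha).to_subtype
  have hPE : P (attrA ⁻¹' I.S a) ≠ 0 := by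
    intro h0
    have := hwω a ha
    rw [cond_eq_zero_of_meas_eq_zero h0, integral_zero_measure] at this
    linarith
  have hprob := cond_isProbabilityMeasure (μ := P) hPE
  have h := abs_ratio_sub_le P[|attrA ⁻¹' I.S a] hI.one_le_N hw hw1 hω (hwω a ha) (hD a ha) f.2
    (hfm f f.2) (hI.pred f f.2)
  have e1 := sum_groupWeight_mul I μ s hdata a (I.gridThr f)
  have e2 := sum_groupWeight_mul I μ s hdata a fun _ => 1
  simp only [mul_one] at e2
  rw [e1, e2]
  exact h

end

/-! ### Assembling the rates on a good sample -/

section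

theorem loss_rate_le {C' R d q K Λ x : ℝ} (hC' : 1 ≤ C') (hR : 0 ≤ R) (hd : 0 ≤ d) (hq : 0 ≤ q)
    (hΛ : 1 ≤ Λ) (hx : 0 ≤ x) (hK : 1 + R + 2 * d + q ≤ K) :
    C' * x + R * x + 2 * (d * Λ * x) + q * x ≤ C' * (K * Λ) * x := by
  have hp : C' ≤ C' * Λ := le_mul_of_one_le_right (by linarith) hΛ
  have hp1 : 1 ≤ C' * Λ := hC'.trans hp
  have hpΛ : Λ ≤ C' * Λ := le_mul_of_one_le_left (by linarith) hC'
  have h1 := mul_le_mul_of_nonneg_left hK (by linarith : 0 ≤ C' * Λ)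
  have h2 := mul_le_mul_of_nonneg_left hp1 hR
  have h3 := mul_le_mul_of_nonneg_left hpΛ hd
  have h4 := mul_le_mul_of_nonneg_left hp1 hq
  have h5 : C' + R + 2 * (d * Λ) + q ≤ C' * (K * Λ) := by linarith
  have h6 := mul_le_mul_of_nonneg_right h5 hx
  linarith

theorem slack_rate_le {B c cB p x : ℝ} (hc : 0 ≤ c) (hcB : 0 < cB)
    (hpx : p * x = 1) (hx0 : 0 ≤ x) (hx1 : x ≤ 1) :
    (B + 2 * (c * x)) / (cB * p) ≤ (B + 2 * c) / cB * x := by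
  have h1 : (B + 2 * (c * x)) / (cB * p) = (B + 2 * (c * x)) / cB * x := by
    rw [div_mul_eq_div_div, div_eq_mul_inv _ p, ← eq_inv_of_mul_eq_one_right hpx]
  rw [h1]
  gcongr
  nlinarith

/-- In the application `x = n^(-φ)` and `y = n_a^(-φ)`; as `n_a ≤ n`, the grid error is absorbed
into the group rate. -/
theorem group_rate_le {b B d dev N cN ω x y Λ : ℝ} (hb0 : 0 ≤ b) (hb : b ≤ B) (hd : 0 ≤ d)
    (hcN : 0 < cN) (hω : 0 < ω) (hNx : 1 / N ≤ x / cN) (hxy : x ≤ y)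
    (hy : 0 ≤ y) (hΛ : 1 ≤ Λ) (hdev : dev ≤ d * Λ * y) :
    b * ((2 * dev + 1 / N) / ω) ≤ B * ((2 * d + 1 / cN) / ω) * Λ * y := by
  have h3 : x / cN ≤ 1 / cN * Λ * y := by
    rw [div_eq_mul_one_div, mul_comm, mul_assoc]
    refine mul_le_mul_of_nonneg_left ?_ (by positivity)
    nlinarith
  have h2 : 2 * dev + 1 / N ≤ (2 * d + 1 / cN) * Λ * y := by linarith
  have h5 : (2 * dev + 1 / N) / ω ≤ (2 * d + 1 / cN) * Λ * y / ω := by gcongr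
  have h6 : 0 ≤ (2 * d + 1 / cN) * Λ * y / ω := by positivity
  calc _ ≤ b * ((2 * d + 1 / cN) * Λ * y / ω) := mul_le_mul_of_nonneg_left h5 hb0
    _ ≤ B * ((2 * d + 1 / cN) * Λ * y / ω) := mul_le_mul_of_nonneg_right hb h6
    _ = _ := by ring

theorem disp_rate_le {v v' x c R T y₀ y₁ K Λ : ℝ} (hc : 0 ≤ c) (hR : 0 ≤ R)
    (hΛ : 1 ≤ Λ) (hx : 0 ≤ x) (hxy : x ≤ y₀ + y₁) (hK : 1 + 2 * c + R + 2 * T ≤ K)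
    (h : v ≤ v' + x + 2 * (c * x) + R * x + 2 * (T * Λ * (y₀ + y₁))) :
    v ≤ v' + K * Λ * y₀ + K * Λ * y₁ := by
  have h0 : 0 ≤ 1 + 2 * c + R := by positivity
  have hy : y₀ + y₁ ≤ Λ * (y₀ + y₁) := le_mul_of_one_le_left (hx.trans hxy) hΛ
  have h1 := mul_le_mul_of_nonneg_left (hxy.trans hy) h0
  have h2 := mul_le_mul_of_nonneg_right hK (mul_nonneg (by linarith : 0 ≤ Λ) (hx.trans hxy))
  linarith

variable {𝒳 : Type*} [MeasurableSpace 𝒳]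

/-- A feasible distribution whose absolute disparity is within `x` of the infimum. -/
theorem exists_nearly_optimal {ℱ : Set (𝒳 → ℝ)} (hne : ℱ.Nonempty) (loss disp : ℱ → ℝ) (ε : ℝ)
    {x : ℝ} (hx : 0 < x) :
    ∃ Qs : PMF ℱ, (∃ Q' : PMF ℱ, mix Q' loss ≤ ε) → mix Qs loss ≤ ε ∧
      ∀ Q' : PMF ℱ, mix Q' loss ≤ ε → |mix Qs disp| ≤ |mix Q' disp| + x := by
  by_cases hf : ∃ Q' : PMF ℱ, mix Q' loss ≤ ε
  · set V : Set ℝ := (fun Q' : PMF ℱ => |mix Q' disp|) '' {Q' | mix Q' loss ≤ ε}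
    have hVne : V.Nonempty := by obtain ⟨Q', hQ'⟩ := hf; exact ⟨_, Q', hQ', rfl⟩
    have hVb : BddBelow V := ⟨0, by rintro _ ⟨Q', _, rfl⟩; exact abs_nonneg _⟩
    -- The infimum need not be attained. A single near-minimizer, chosen without the sample, serves
    -- all feasible competitors at once.
    obtain ⟨_, ⟨Qs, hQs, rfl⟩, hlt⟩ := exists_lt_of_csInf_lt hVne (lt_add_of_pos_right _ hx)
    refine ⟨Qs, fun _ => ⟨hQs, fun Q' hQ' => hlt.le.trans ?_⟩⟩
    gcongr
    exact csInf_le hVb ⟨Q', hQ', rfl⟩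
  · obtain ⟨f, hfF⟩ := hne
    exact ⟨PMF.pure ⟨f, hfF⟩, fun h => absurd h hf⟩

/-- Hoeffding slack makes a feasible distribution empirically feasible. -/
theorem costHatQ_le_of_mean_loss_le {n : ℕ} {I : AlgInput 𝒳 n} {ℱ : Set (𝒳 → ℝ)}
    (hI : I.Regular ℱ) {b : ℝ} (Q : PMF ℱ)
    (h : (mix Q fun f => (1 / (n : ℝ)) * ∑ i, I.l (I.data i).2.2 ((f : 𝒳 → ℝ) (I.data i).1)) ≤ b) :
    I.costHatQ Q + c0Hat I.l I.N I.cover I.data ≤ b + 1 / I.N := by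
  set c0 := c0Hat I.l I.N I.cover I.data
  have h1 := abs_mix_sub_mix_le Q (v := fun f : ℱ => I.costHat f + c0)
    (w := fun f => (1 / (n : ℝ)) * ∑ i, I.l (I.data i).2.2 ((f : 𝒳 → ℝ) (I.data i).1))
    (b := 1 + |c0|) (c := 1)
    (fun f => (abs_add_le _ _).trans (by linarith [hI.abs_costHat_le (f : 𝒳 → ℝ)]))
    (fun f => abs_mean_le zero_le_one fun i =>
      abs_le_one_of_mem (hI.loss.mem_Icc _ (hI.outcome i) _ (hI.pred f f.2 _)))
    (fun f => hI.abs_cost_sub_loss_le f.2)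
  rw [mix_add _ (fun f : ℱ => hI.abs_costHat_le f) (fun _ => le_refl |c0|), mix_const] at h1
  have h2 := (abs_le.1 h1).2
  unfold AlgInput.costHatQ
  linarith

/-- The guarantee for the returned solution on a sample in the good event. -/
theorem output_of_good_sample {n : ℕ} (hn : 1 ≤ n) {I : AlgInput 𝒳 n} {ℱ : Set (𝒳 → ℝ)}
    (hI : I.Regular ℱ) (hfm : ∀ f ∈ ℱ, Measurable f) {P : Measure (Obs 𝒳)} [IsProbabilityMeasure P]
    {μ : 𝒳 → ℝ} (hμm : Measurable μ) (hμ1 : ∀ x, μ x ∈ Set.Icc (0 : ℝ) 1) {s : Fin n → Obs 𝒳}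
    (hdata : I.data = modifiedData μ s)
    (hw : Measurable fun o : Obs 𝒳 => I.g (featX o) (μ (featX o)))
    (hw1 : ∀ o : Obs 𝒳, I.g (featX o) (μ (featX o)) ∈ Set.Icc (0 : ℝ) 1) {ω : ℝ} (hω : 0 < ω)
    (hwω : ∀ a, I.β a ≠ 0 →
      ω ≤ ∫ o, I.g (featX o) (μ (featX o)) ∂P[|attrA ⁻¹' I.S a])
    (hβ : ∀ a, |I.β a| ≤ I.Bxi) (hBx : 0 < I.Bxi)
    {ε C φ cν cB cN cN' C' C'' δ K : ℝ} (hC : 0 < C) (hφ0 : 0 < φ) (hφ : φ ≤ 1 / 2)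
    (hcν : 0 < cν) (hcB : 0 < cB) (hcN : 0 < cN)
    (hN1 : cN * (n : ℝ) ^ φ ≤ I.N) (hN2 : (I.N : ℝ) ≤ cN' * (n : ℝ) ^ φ)
    (hnu : I.nu = cν * (n : ℝ) ^ (-φ)) (hBl : I.Blam = cB * (n : ℝ) ^ φ)
    (hδ0 : 0 < δ) (hδ1 : δ < 1) (hC' : 1 ≤ C') (hC'' : 0 ≤ C'')
    (hslack : C'' + (n : ℝ) ^ φ / I.N + √(-Real.log (δ / 8) / 2) ≤ C')
    (heps : I.epsHat + c0Hat I.l I.N I.cover I.data =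
      ε + C' * (n : ℝ) ^ (-φ) - C'' * (n : ℝ) ^ (-(1 / 2) : ℝ))
    (hKl : 1 + (I.Bxi + 2 * cν) / cB + 2 * devConst C cN' + 2 / cN ≤ K)
    (hKd : 1 + 2 * cν + (I.Bxi + 2 * cν) / cB +
      2 * (I.Bxi * ((2 * devConst C cN' + 1 / cN) / ω)) ≤ K)
    {Qs : PMF ℱ}
    (hQs : (∃ Q' : PMF ℱ, mix Q' (fun f => lossMu P μ I.l f) ≤ ε) →
      mix Qs (fun f => lossMu P μ I.l f) ≤ ε ∧
        ∀ Q' : PMF ℱ, mix Q' (fun f => lossMu P μ I.l f) ≤ ε →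
          |mix Qs (fun f => disparity P μ I.g I.S I.β f)| ≤
            |mix Q' (fun f => disparity P μ I.g I.S I.β f)| + (n : ℝ) ^ (-φ))
    (hG1 : GridDev ℱ I.N (lossWeight I.l I.N μ) P (devWidth C φ (δ / 8) I.N n) s)
    (hG2 : ∀ a, I.β a ≠ 0 → (hits (attrA ⁻¹' I.S a) s).Nonempty →
        GridDev ℱ I.N (fun _ o => I.g (featX o) (μ (featX o))) P[|attrA ⁻¹' I.S a]
          (devWidth C φ (δ / 8) I.N (hits (attrA ⁻¹' I.S a) s).card)
          fun i : hits (attrA ⁻¹' I.S a) s => s i)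
    (hG3 : (mix Qs fun f => (1 / (n : ℝ)) *
        ∑ i, I.l (μ (featX (s i))) ((f : 𝒳 → ℝ) (featX (s i)))) ≤
      mix Qs (fun f => lossMu P μ I.l f) +
        √(-Real.log (δ / 8) / 2) * (n : ℝ) ^ (-(1 / 2) : ℝ))
    {η : ℝ} {best : (Fin 3 → ℝ) → ℱ} (hbest : I.IsBestH ℱ best) {t : ℕ}
    (ht : I.StopsAt η best t) :
    (∃ Q : PMF ℱ, I.output η best t = some Q ∧
      mix Q (fun f => lossMu P μ I.l f) ≤ ε + C' * polylog K 1 n δ * (n : ℝ) ^ (-φ) ∧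
      ((∀ a, I.β a ≠ 0 → 0 < groupCount (I.S a) s) →
        ∀ Q' : PMF ℱ, mix Q' (fun f => lossMu P μ I.l f) ≤ ε →
          |mix Q (fun f => disparity P μ I.g I.S I.β f)| ≤
            |mix Q' (fun f => disparity P μ I.g I.S I.β f)|
              + polylog K 1 n δ * (groupCount (I.S 0) s : ℝ) ^ (-φ)
              + polylog K 1 n δ * (groupCount (I.S 1) s : ℝ) ^ (-φ))) ∨
    (I.output η best t = none ∧ ¬ ∃ Q' : PMF ℱ, mix Q' (fun f => lossMu P μ I.l f) ≤ ε) := by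
  have hn1 : (1 : ℝ) ≤ n := by exact_mod_cast hn
  have hn0 : (0 : ℝ) < n := by linarith
  have hnp : 0 < (n : ℝ) ^ φ := Real.rpow_pos_of_pos hn0 _
  have hN := hI.one_le_N
  have hN0 : (0 : ℝ) < I.N := by exact_mod_cast hN
  set x := (n : ℝ) ^ (-φ) with hx
  set r := (n : ℝ) ^ (-(1 / 2) : ℝ) with hr
  have hx0 : 0 < x := Real.rpow_pos_of_pos hn0 _
  have hr0 : 0 < r := Real.rpow_pos_of_pos hn0 _
  have hx1 : x ≤ 1 := Real.rpow_le_one_of_one_le_of_nonpos hn1 (by linarith)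
  have hrx : r ≤ x := Real.rpow_le_rpow_of_exponent_le hn1 (by linarith)
  have hnx : (n : ℝ) ^ φ * x = 1 := by
    rw [hx, ← Real.rpow_add hn0]; simp
  have hNx : 1 / (I.N : ℝ) ≤ x / cN := by
    rw [div_le_div_iff₀ hN0 hcN]
    have := mul_le_mul_of_nonneg_right hN1 hx0.le
    rw [mul_assoc, hnx] at this
    linarith
  have hBl0 : 0 < I.Blam := by rw [hBl]; exact mul_pos hcB hnp
  obtain ⟨hlog1, hlog2⟩ := one_le_logs hn hδ0 hδ1
  have hΛ : 1 ≤ 1 + Real.log n + Real.log (1 / δ) := by linarith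
  have hpoly : polylog K 1 n δ = K * (1 + Real.log n + Real.log (1 / δ)) := by simp [polylog]
  have hdw := fun m => devWidth_le (m := m) hC hφ hn hN hN2 hδ0 hδ1
  generalize 1 + Real.log n + Real.log (1 / δ) = Λ at hΛ hpoly hdw
  have hd0 : 0 ≤ devConst C cN' := devConst_nonneg hC
  generalize devConst C cN' = d at hKl hKd hdw hd0
  have hR : 0 ≤ (I.Bxi + 2 * cν) / cB := by positivity
  -- The tolerance offset covers the discretization and Hoeffding errors of `Qs`: multiply `hslack`
  -- by `x` and use `r ≤ x`.
  have hslack' : 1 / (I.N : ℝ) + √(-Real.log (δ / 8) / 2) * r ≤ C' * x - C'' * r := by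
    have h1 := mul_le_mul_of_nonneg_right hslack hx0.le
    have h2 : (n : ℝ) ^ φ / I.N * x = 1 / I.N := by rw [div_mul_eq_mul_div, hnx]
    have h3 := mul_le_mul_of_nonneg_left hrx hC''
    have h4 := mul_le_mul_of_nonneg_left hrx (Real.sqrt_nonneg (-Real.log (δ / 8) / 2))
    linarith
  have hlossb : ∀ f : ℱ, |lossMu P μ I.l f| ≤ 1 := fun f =>
    abs_lossMu_le hI.loss hμ1 P (hI.pred f f.2)
  have hdispb : ∀ f : ℱ, |disparity P μ I.g I.S I.β f| ≤ I.Bxi := fun f => by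
    unfold disparity
    rw [Fin.sum_univ_two]
    exact hI.disp _ (disparity_ratio_mem _ hw hw1 (hI.pred f f.2)) _
      (disparity_ratio_mem _ hw hw1 (hI.pred f f.2))
  have hQscost : (∃ Q' : PMF ℱ, mix Q' (fun f => lossMu P μ I.l f) ≤ ε) →
      I.costHatQ Qs ≤ I.epsHat := by
    intro hf
    have h1 := costHatQ_le_of_mean_loss_le hI (b := ε + √(-Real.log (δ / 8) / 2) * r) Qs
      (by rw [hdata]; exact hG3.trans (by linarith [(hQs hf).1]))
    linarith
  have hloss : ∀ f : ℱ, |I.costHat f + c0Hat I.l I.N I.cover I.data - lossMu P μ I.l f| ≤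
      2 * (d * Λ * x) + 2 / cN * x := by
    intro f
    have h1 := abs_loss_mean_sub_le hI.loss hN hμm hμ1 P hG1 f.2 (hfm f f.2) (hI.pred f f.2)
    have h2 := hdw n
    have h0 := hI.abs_cost_sub_loss_le f.2
    rw [hdata] at h0 ⊢
    have h3 := (abs_sub_le _ _ _).trans (add_le_add h0 h1)
    have e : 2 / cN * x = x / cN + x / cN := by ring
    refine h3.trans ?_
    rw [e]
    linarith
  have hratio : (I.Bxi + 2 * I.nu) / I.Blam ≤ (I.Bxi + 2 * cν) / cB * x := by
    rw [hnu, hBl]; exact slack_rate_le hcν.le hcB hnx hx0.le hx1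
  rcases hI.output_guarantee hbest hBl0 hBx.le ht hlossb hdispb hloss
    (∃ Q' : PMF ℱ, mix Q' (fun f => lossMu P μ I.l f) ≤ ε) Qs hQscost
    with ⟨Q, hQout, hQloss, hQdisp⟩ | hnull
  swap
  · exact Or.inr hnull
  refine Or.inl ⟨Q, hQout, ?_, fun hcount Q' hQ' => ?_⟩
  · have h1 := loss_rate_le hC' hR hd0 (by positivity : 0 ≤ 2 / cN) hΛ hx0.le hKl
    have h2 : 0 ≤ C'' * r := by positivity
    rw [hpoly]
    linarith
  · have hy0 : ∀ a, 0 ≤ (groupCount (I.S a) s : ℝ) ^ (-φ) := fun a => by positivity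
    have hT0 : 0 ≤ I.Bxi * ((2 * d + 1 / cN) / ω) := by positivity
    have hK0 : 0 ≤ K := by linarith
    rw [hpoly]
    -- If some `β_a ≠ 0`, that group has between 1 and `n` members, and the terms of order `n^(-φ)`
    -- can be charged to its rate; otherwise all disparities vanish.
    by_cases hβ0 : ∀ a, I.β a = 0
    · have hz : ∀ f, disparity P μ I.g I.S I.β f = 0 := fun f => by simp [disparity, hβ0]
      simp only [hz, mix_const, abs_zero, zero_add]
      exact add_nonneg (mul_nonneg (mul_nonneg hK0 (by linarith)) (hy0 0))
        (mul_nonneg (mul_nonneg hK0 (by linarith)) (hy0 1))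
    obtain ⟨b, hb⟩ := not_forall.1 hβ0
    have hne' : ∀ a, I.β a ≠ 0 → (hits (attrA ⁻¹' I.S a) s).Nonempty := fun a ha => by
      rw [← Finset.card_pos, ← groupCount_eq]; exact hcount a ha
    have hxy : ∀ a, I.β a ≠ 0 → x ≤ (groupCount (I.S a) s : ℝ) ^ (-φ) := fun a ha => by
      have h1 : 0 < groupCount (I.S a) s := hcount a ha
      have h2 : groupCount (I.S a) s ≤ n := by
        rw [groupCount_eq]
        simpa using Finset.card_le_univ (hits (attrA ⁻¹' I.S a) s)
      exact Real.rpow_le_rpow_of_nonpos (by exact_mod_cast h1) (by exact_mod_cast h2)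
        (by linarith)
    have hdisp := abs_dispHat_sub_disparity_le hI (P := P) (μ := μ) (s := s) hdata hfm hw hw1 hω hwω
      (D := fun a => devWidth C φ (δ / 8) I.N (hits (attrA ⁻¹' I.S a) s).card) hne'
      (fun a ha => hG2 a ha (hne' a ha))
    have herr : ∑ a, |I.β a| *
        ((2 * devWidth C φ (δ / 8) I.N (hits (attrA ⁻¹' I.S a) s).card + 1 / I.N) / ω) ≤
        I.Bxi * ((2 * d + 1 / cN) / ω) * Λ *
          ((groupCount (I.S 0) s : ℝ) ^ (-φ) + (groupCount (I.S 1) s : ℝ) ^ (-φ)) := by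
      rw [mul_add, ← Fin.sum_univ_two (fun a => I.Bxi * ((2 * d + 1 / cN) / ω) * Λ *
        (groupCount (I.S a) s : ℝ) ^ (-φ))]
      refine Finset.sum_le_sum fun a _ => ?_
      -- An empty group is possible only here; its rate `0 ^ (-φ)` is 0, so the term really is
      -- omitted.
      by_cases ha : I.β a = 0
      · rw [ha, abs_zero, zero_mul]
        exact mul_nonneg (mul_nonneg hT0 (by linarith)) (hy0 a)
      rw [← groupCount_eq]
      exact group_rate_le (abs_nonneg _) (hβ a) hd0 hcN hω hNx (hxy a ha) (hy0 a) hΛ (hdw _)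
    have h1 := hQdisp ⟨Q', hQ'⟩ _ fun f => (hdisp f).trans herr
    have h2 := (hQs ⟨Q', hQ'⟩).2 Q' hQ'
    have h3 : x ≤ (groupCount (I.S 0) s : ℝ) ^ (-φ) + (groupCount (I.S 1) s : ℝ) ^ (-φ) := by
      have h4 := hxy b hb
      have h5 := hy0 0
      have h6 := hy0 1
      fin_cases b
      · exact h4.trans (le_add_of_nonneg_right h6)
      · exact h4.trans (le_add_of_nonneg_left h5)
    refine disp_rate_le hcν.le hR hΛ hx0.le h3 hKd (h1.trans ?_)
    rw [hnu] at hratio ⊢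
    linarith

end

end FairRashomon

/-! ### The main theorem -/

open FairRashomon in
theorem theorem4
    -- loss tolerance, disparity parameters, and a bound `Bxi` on the absolute disparity
    (ε : ℝ) (hε : 0 ≤ ε) (β : Fin 2 → ℝ) (Bxi : ℝ) (hBxi0 : 0 < Bxi)
    (hBxi : ∀ u ∈ Set.Icc (0 : ℝ) 1, ∀ v ∈ Set.Icc (0 : ℝ) 1, |β 0 * u + β 1 * v| ≤ Bxi)
    -- complexity constants, lower bound on the mean weights, constants of proportionality
    (C φ : ℝ) (hC : 0 < C) (hφ0 : 0 < φ) (hφ : φ ≤ 1 / 2) (ω : ℝ) (hω : 0 < ω)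
    (cν cB cN cN' : ℝ) (hcν : 0 < cν) (hcB : 0 < cB) (hcN : 0 < cN) (hcN' : cN ≤ cN') :
    ∃ (K : ℝ) (p : ℕ) (n₀ : ℝ → ℝ → ℕ),
    ∀ {𝒳 : Type*} [MeasurableSpace 𝒳]
    -- the population
    (P : Measure (Obs 𝒳)) [IsProbabilityMeasure P]
    (_hY : ∀ᵐ o ∂P, outY o ∈ Set.Icc (0 : ℝ) 1)
    (_hsel : SelectionOnObservables P) (_hpos : Positivity P)
    (μ : 𝒳 → ℝ) (_hμ : IsRegression P μ)
    -- the model class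
    (ℱ : Set (𝒳 → ℝ)) (_hℱ : ∀ f ∈ ℱ, Measurable f ∧ ∀ x, f x ∈ Set.Icc (0 : ℝ) 1)
    (_hℱm : PointwiseMeasurable ℱ)
    (_hR : ∀ m : ℕ, 1 ≤ m → rademacher (thrClass ℱ) m ≤ C * (m : ℝ) ^ (-φ))
    -- the loss
    (l : ℝ → ℝ → ℝ)
    (_hl01 : ∀ y ∈ Set.Icc (0 : ℝ) 1, ∀ u ∈ Set.Icc (0 : ℝ) 1, l y u ∈ Set.Icc (0 : ℝ) 1)
    (_hlLip : ∀ y ∈ Set.Icc (0 : ℝ) 1, ∀ y' ∈ Set.Icc (0 : ℝ) 1,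
      ∀ u ∈ Set.Icc (0 : ℝ) 1, ∀ u' ∈ Set.Icc (0 : ℝ) 1,
        |l y u - l y' u'| ≤ |y - y'| + |u - u'|)
    -- groups and weights of the disparity measure
    (S : Fin 2 → Set (Fin 2)) (g : 𝒳 → ℝ → ℝ) (_hgm : Measurable (Function.uncurry g))
    (_hg01 : ∀ x, ∀ m ∈ Set.Icc (0 : ℝ) 1, g x m ∈ Set.Icc (0 : ℝ) 1)
    (_hgpos : ∀ a, β a ≠ 0 →
      ω ≤ ∫ o, g (featX o) (μ (featX o)) ∂P[|attrA ⁻¹' S a]),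
    -- the error guarantees
    (∀ (n : ℕ), 1 ≤ n → ∀ (δ : ℝ), 0 < δ → δ < 1 →
      ∀ (N : ℕ), cN * (n : ℝ) ^ φ ≤ N → (N : ℝ) ≤ cN' * (n : ℝ) ^ φ →
      ∀ (cover : Finset ℝ), (∀ t ∈ cover, t ∈ Set.Icc (0 : ℝ) 1) →
        (∀ x, ∃ t ∈ cover, |μ x - t| ≤ 1 / (2 * (N : ℝ))) →
      ∀ (C' C'' : ℝ), 2 * C + 2 + √(2 * Real.log (8 * N / δ)) ≤ C' →
        √(-Real.log (δ / 8) / 2) ≤ C'' →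
      let I : (Fin n → Obs 𝒳) → AlgInput 𝒳 n :=
        selectiveInput μ β S g l ε Bxi φ cν cB C' C'' N cover
      -- iteration bound, for every sample and every best-response oracle
      (∀ (s : Fin n → Obs 𝒳) (best : (Fin 3 → ℝ) → ℱ), (I s).IsBestH ℱ best →
        ∃ t : ℕ, (I s).StopsAt ((I s).learningRate ℱ) best t ∧
          ((t + 1 : ℕ) : ℝ) ≤
            K * (1 + C' * (n : ℝ) ^ (-φ) + C'' * (n : ℝ) ^ (-(1 / 2) : ℝ)) ^ 2 *
              (n : ℝ) ^ (4 * φ)) ∧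
      -- quality of the returned solution, with probability at least `1 - δ`
      (n₀ δ C'' ≤ n ∨ C'' + (n : ℝ) ^ φ / N + √(-Real.log (δ / 8) / 2) ≤ C' →
        ∃ G : Set (Fin n → Obs 𝒳), MeasurableSet G ∧
          1 - δ ≤ (Measure.pi fun _ : Fin n => P).real G ∧
          ∀ s ∈ G, ∀ best : (Fin 3 → ℝ) → ℱ, (I s).IsBestH ℱ best →
          ∀ t : ℕ, (I s).StopsAt ((I s).learningRate ℱ) best t →
            (∃ Q : PMF ℱ, (I s).output ((I s).learningRate ℱ) best t = some Q ∧
              mix Q (fun f => lossMu P μ l f) ≤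
                ε + C' * polylog K p n δ * (n : ℝ) ^ (-φ) ∧
              ((∀ a, β a ≠ 0 → 0 < groupCount (S a) s) →
                ∀ Q' : PMF ℱ, mix Q' (fun f => lossMu P μ l f) ≤ ε →
                  |mix Q (fun f => disparity P μ g S β f)| ≤
                    |mix Q' (fun f => disparity P μ g S β f)|
                      + polylog K p n δ * (groupCount (S 0) s : ℝ) ^ (-φ)
                      + polylog K p n δ * (groupCount (S 1) s : ℝ) ^ (-φ))) ∨
            ((I s).output ((I s).learningRate ℱ) best t = none ∧
              ¬ ∃ Q' : PMF ℱ, mix Q' (fun f => lossMu P μ l f) ≤ ε))) ∧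
    -- the disparity with weight `1`, `μ` or `1 - μ` is the one that conditions on the events
    -- `{A ∈ Sₐ}`, `{Y* = 1, A ∈ Sₐ}` or `{Y* = 0, A ∈ Sₐ}`
    (∀ Q : PMF ℱ, mix Q (fun f => disparity P μ (fun _ _ => 1) S β f) =
      mix Q (fun f => disparityOn P (fun a => {o | attrA o ∈ S a}) β f)) ∧
    ((∀ᵐ o ∂P, outY o = 0 ∨ outY o = 1) → CondIndepGivenX P attrA outY →
      ∀ Q : PMF ℱ,
        mix Q (fun f => disparity P μ (fun _ m => m) S β f) =
          mix Q (fun f => disparityOn P (fun a => {o | outY o = 1 ∧ attrA o ∈ S a}) β f) ∧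
        mix Q (fun f => disparity P μ (fun _ m => 1 - m) S β f) =
          mix Q (fun f => disparityOn P (fun a => {o | outY o = 0 ∧ attrA o ∈ S a}) β f)) ∧
    -- for a loss convex in the outcome, feasibility for the true loss implies feasibility
    -- for `loss_μ`
    ((∀ u ∈ Set.Icc (0 : ℝ) 1, ConvexOn ℝ (Set.Icc (0 : ℝ) 1) (fun y => l y u)) →
      ∀ Q : PMF ℱ, mix Q (fun f => lossMu P μ l f) ≤ mix Q (fun f => loss P l f)) := by
  -- The summand `1 / cN` bounds `n^φ / N`, so the threshold need not depend on `N`.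
  choose n₀ hn₀ using fun δ C'' : ℝ =>
    exists_threshold φ cN hφ0 hcN δ (C'' + 1 / cN + √(-Real.log (δ / 8) / 2))
  have hβ : ∀ a, |β a| ≤ Bxi := by
    have h0 := hBxi 1 (by simp) 0 (by simp)
    have h1 := hBxi 0 (by simp) 1 (by simp)
    intro a
    fin_cases a
    · simpa using h0
    · simpa using h1
  obtain ⟨K, hK, hKl, hKd⟩ : ∃ K : ℝ,
      4 * (2 * Bxi + ε + 2) ^ 2 * (cB / cν) ^ 2 * Real.log 4 + 1 ≤ K ∧
      1 + (Bxi + 2 * cν) / cB + 2 * devConst C cN' + 2 / cN ≤ K ∧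
      1 + 2 * cν + (Bxi + 2 * cν) / cB +
        2 * (Bxi * ((2 * devConst C cN' + 1 / cN) / ω)) ≤ K :=
    ⟨max _ (max _ _), le_max_left _ _, (le_max_left _ _).trans (le_max_right _ _),
      (le_max_right _ _).trans (le_max_right _ _)⟩
  refine ⟨K, 1, n₀, ?_⟩
  intro 𝒳 _ P _ hY hsel hpos μ hμ ℱ hℱ hℱm hR l hl01 hlLip S g hgm hg01 hgpos
  have hl : LossBound l := ⟨hl01, hlLip⟩
  have hμm := hμ.measurable
  have hμ1 := hμ.mem_Icc
  have hw : Measurable fun o : Obs 𝒳 => g (featX o) (μ (featX o)) :=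
    hgm.comp (measurable_featX.prodMk (hμm.comp measurable_featX))
  have hw1 : ∀ o : Obs 𝒳, g (featX o) (μ (featX o)) ∈ Set.Icc (0 : ℝ) 1 :=
    fun o => hg01 _ _ (hμ1 _)
  refine ⟨?_, fun Q => ?_, fun hY01 hind Q => ⟨?_, ?_⟩, fun hconv Q => ?_⟩
  · intro n hn δ hδ0 hδ1 N hN1 hN2 cover hcov1 hcov2 C' C'' hC' hC'' I
    have hn1 : (1 : ℝ) ≤ n := by exact_mod_cast hn
    have hn0 : (0 : ℝ) < n := by linarith
    have hnp : 0 < (n : ℝ) ^ φ := Real.rpow_pos_of_pos hn0 _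
    have hN0 : (0 : ℝ) < N := lt_of_lt_of_le (by positivity) hN1
    have hN : 1 ≤ N := by exact_mod_cast hN0
    have hC'2 : 1 ≤ C' := by
      have := Real.sqrt_nonneg (2 * Real.log (8 * N / δ)); linarith
    have hC''0 : 0 ≤ C'' := (Real.sqrt_nonneg _).trans hC''
    have hx0 : 0 < (n : ℝ) ^ (-φ) := Real.rpow_pos_of_pos hn0 _
    have hreg : ∀ s, (I s).Regular ℱ := fun s =>
      { one_le_N := hN
        loss := hl
        outcome := fun i => hμ1 _
        cover_mem := hcov1
        covered := fun i => hcov2 _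
        weight := fun y m hm => (hg01 y m hm).1
        disp := hBxi
        pred := fun f hf => (hℱ f hf).2 }
    have h2 : 0 ≤ C' * (n : ℝ) ^ (-φ) := by positivity
    have h3 : 0 ≤ C'' * (n : ℝ) ^ (-(1 / 2) : ℝ) := by positivity
    constructor
    · intro s best hbest
      have heps : |(I s).epsHat| ≤
          ε + 1 + (C' * (n : ℝ) ^ (-φ) + C'' * (n : ℝ) ^ (-(1 / 2) : ℝ)) := by
        have h1 := abs_le.1 (c0Hat_mem (hreg s))
        change |ε - c0Hat l N cover (modifiedData μ s) + C' * (n : ℝ) ^ (-φ) -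
          C'' * (n : ℝ) ^ (-(1 / 2) : ℝ)| ≤ _
        change -1 ≤ c0Hat l N cover (modifiedData μ s) ∧
          c0Hat l N cover (modifiedData μ s) ≤ 1 at h1
        rw [abs_le]; constructor <;> linarith [h1.1, h1.2]
      obtain ⟨t, ht, hle⟩ := (hreg s).exists_stopsAt_le hbest hBxi0 hε hφ0 hn hcν hcB
        (add_nonneg h2 h3) rfl rfl heps
      refine ⟨t, ht, hle.trans ?_⟩
      rw [add_assoc 1]
      exact mul_le_mul_of_nonneg_right (mul_le_mul_of_nonneg_right hK (sq_nonneg _))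
        (Real.rpow_nonneg hn0.le _)
    · intro hcase
      have hbig : C'' + (n : ℝ) ^ φ / N + √(-Real.log (δ / 8) / 2) ≤ C' := by
        rcases hcase with h | h
        · have h1 := hn₀ δ C'' hδ0 n h
          have h2 : √(2 * Real.log (8 * (cN * (n : ℝ) ^ φ) / δ)) ≤
              √(2 * Real.log (8 * N / δ)) := by
            refine Real.sqrt_le_sqrt (mul_le_mul_of_nonneg_left (Real.log_le_log (by positivity) ?_)
              two_pos.le)
            gcongr
          have h3 : (n : ℝ) ^ φ / N ≤ 1 / cN := by
            rw [div_le_div_iff₀ hN0 hcN]; linarith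
          linarith
        · exact h
      -- An empty class admits no oracle, so any event works.
      rcases ℱ.eq_empty_or_nonempty with hemp | hne
      · refine ⟨Set.univ, MeasurableSet.univ, by simp [hδ0.le], ?_⟩
        intro s _ best
        exact absurd (best 0).2 (by simp [hemp])
      -- `Qs`, and hence the good event, is fixed before the sample and the oracle; the guarantee
      -- therefore holds for all oracles simultaneously.
      obtain ⟨Qs, hQs⟩ := exists_nearly_optimal hne (fun f : ℱ => lossMu P μ l f)
        (fun f => disparity P μ g S β f) ε hx0
      obtain ⟨G, hGm, hGP, hG⟩ := exists_good_event P hμm hμ1 hℱ hℱm hφ hR hl S hw hw1 hω β hgpos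
        hn hN hδ0 hδ1 Qs
      refine ⟨G, hGm, hGP, fun s hs best hbest t ht => ?_⟩
      obtain ⟨hG1, hG2, hG3⟩ := hG s hs
      have heps : (I s).epsHat + c0Hat l N cover (modifiedData μ s) =
          ε + C' * (n : ℝ) ^ (-φ) - C'' * (n : ℝ) ^ (-(1 / 2) : ℝ) := by
        change ε - c0Hat l N cover (modifiedData μ s) + C' * (n : ℝ) ^ (-φ) -
          C'' * (n : ℝ) ^ (-(1 / 2) : ℝ) + c0Hat l N cover (modifiedData μ s) = _
        ring
      exact output_of_good_sample hn (hreg s) (fun f hf => (hℱ f hf).1) hμm hμ1 rfl hw hw1 hω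
        hgpos hβ hBxi0 hC hφ0 hφ hcν hcB hcN hN1 hN2 rfl rfl hδ0 hδ1 hC'2 hC''0 hbig heps hKl hKd
        hQs hG1 hG2 hG3 hbest ht
  · simp only [disparity_one_eq]
  · unfold mix
    refine tsum_congr fun f => ?_
    congr 1
    unfold disparity disparityOn
    refine Finset.sum_congr rfl fun a _ => ?_
    congr 1
    exact integral_cond_outcome_eq P hind 1 hμm hμ1 (condExp_outcome_one hμ hY01) (S a)
      (hℱ f f.2).1 (hℱ f f.2).2
  · unfold mix
    refine tsum_congr fun f => ?_
    congr 1
    unfold disparity disparityOn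
    refine Finset.sum_congr rfl fun a _ => ?_
    congr 1
    exact integral_cond_outcome_eq P hind 0 (q := fun x => 1 - μ x) (measurable_const.sub hμm)
      (fun x => ⟨by linarith [(hμ1 x).2], by linarith [(hμ1 x).1]⟩)
      (condExp_outcome_zero hμ hY01) (S a) (hℱ f f.2).1 (hℱ f f.2).2
  · refine mix_mono Q (b := 1) (c := 1) (fun f => abs_lossMu_le hl hμ1 P (hℱ f f.2).2) (fun f => ?_)
      fun f => lossMu_le_loss hμ hY hl hconv (hℱ f f.2).1 (hℱ f f.2).2
    have := norm_integral_le_of_norm_le_const (μ := P)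
      (f := fun o => l (outY o) ((f : 𝒳 → ℝ) (featX o))) (C := 1) (by
        filter_upwards [hY] with o ho
        exact abs_le_one_of_mem (hl.mem_Icc _ ho _ ((hℱ f f.2).2 _)))
    simpa [loss] using this
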